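/- **Setting.** Let $\mu$ be a $\sigma$-finite measure on $\mathbb R$, $V_1,V_2:\mathbb R\to\mathbb R$ functions, $N\ge 0$ an integer, $X\in\mathbb C$. For $L,M\ge 0$ put $$B_{L,M}(\alpha,\beta)=\prod_{1\le j<k\le L}|\alpha_k-\alpha_j|\prod_{1\le j<k\le M}|\beta_k-\beta_j|^4\prod_{j=1}^L\prod_{k=1}^M|\alpha_j-\beta_k|^2\prod_{j=1}^Le^{-V_1(\alpha_j)}\prod_{k=1}^Me^{-2V_2(\beta_k)},$$ $$Z_{L,M}=\frac1{L!\,M!}\int_{\mathbb R^L\times\mathbb R^M}B_{L,M}\,d\mu^L(\alpha)\,d\mu^M(\beta),\qquad Z_N(X)=\sum_{L+2M=2N}X^LZ_{L,M}.$$ On $\mathbb C[z]$ define $$\langle\phi,\psi\rangle_{1,V}=\tfrac12\iint\phi(y)\psi(z)\,\mathrm{sgn}(z-y)e^{-V(y)-V(z)}d\mu(y)d\mu(z),\qquad \langle\phi,\psi\rangle_{4,V}=\tfrac12\int(\phi\psi'-\phi'\psi)e^{-2V}d\mu .$$ **General formula.** Assume that $x^ke^{-V_1}$ ($0\le k\le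 2N-1$) and $x^ke^{-2V_2}$ ($0\le k\le 4N-4$) are $\mu$-integrable. Let $p_j$ be monic polynomials of degree $j$ ($0\le j<2N$), $p_{-1}=0$, and let $\zeta_j,h^{(1)}_j,h^{(4)}_j\in\mathbb C$ be such that for $0\le m,n<N$ $$\langle p_{2m},p_{2n+1}-\zeta_np_{2n-1}\rangle_{1,V_1}=h^{(1)}_n\delta_{n,m},\quad \langle p_{2m},p_{2n}\rangle_{1,V_1}=\langle p_{2n+1}-\zeta_np_{2n-1},p_{2m+1}-\zeta_mp_{2m-1}\rangle_{1,V_1}=0,$$ $$\langle p_{2m},p_{2n+1}\rangle_{4,V_2}=h^{(4)}_{2n}\delta_{n,m}-h^{(4)}_{2m-1}\delta_{m-1,n},\quad \langle p_{2m},p_{2n}\rangle_{4,V_2}=\langle p_{2m+1},p_{2n+1}\rangle_{4,V_2}=0.$$ Let $(\alpha_j)$ satisfy $\alpha_{-1}=0$, $\alpha_0=1$ and, for $0\le j<N$, $$h^{(4)}_{2j+1}\alpha_{j+1}-\bigl(X^2h^{(1)}_j+h^{(4)}_{2j}+\zeta_jh^{(4)}_{2j-1}\bigr)\alpha_j+\zeta_jh^{(4)}_{2j-2}\alpha_{j-1}=0,$$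 where for $j=0$ the terms containing $\zeta_0$ are absent. Then all integrals in $Z_N(X)$ converge absolutely and $$Z_N(X)=2^N\,\alpha_N\prod_{j=0}^{N-1}h^{(4)}_{2j+1}.$$ **Classical cases.** For a weight $e^{-2V}$ and a function $f$ put $V_1=V+\frac12\log f$, $V_2=V-\frac12\log f$, and let $\mu$ be Lebesgue measure on the stated interval. Write $(u)_k=u(u+1)\cdots(u+k-1)$, let $L_n^{(a)}$ be the Laguerre polynomials, and let $$S_n(x^2;a,b,c)=(a+b)_n(a+c)_n\,{}_3F_2\!\left({-n,\,a+ix,\,a-ix\atop a+b,\,a+c};1\right),$$ $$W_n(x^2;a,b,c,d)=(a+b)_n(a+c)_n(a+d)_n\,{}_4F_3\!\left({-n,\,n+a+b+c+d-1,\,a+ix,\,a-ix\atop a+b,\,a+c,\,a+d};1\right)$$ be the continuous dual Hahn and the Wilson polynomials (polynomials in $x^2$ and in the parameters). In each case below all integrals in $Z_N(X)$ converge absolutely, and the following holds. 1. *Gaussian*, $e^{-2V}=e^{-x^2}$, $f=1$ on $\mathbb R$: $Z_N(X)=2^N\alpha_N\prod_{j=0}^{N-1}h^{(4)}_{2j+1}$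 with $\alpha_N=\frac{4^NN!}{(2N)!}L_N^{(-1/2)}(-X^2)$ and $h^{(4)}_j=2^{-j-1}\sqrt\pi\,\Gamma(j+2)$. 2. *Laguerre*, $e^{-2V}=x^ae^{-x}$, $f=x$ on $(0,\infty)$, $a>-1$: $Z_N(X)=2^N\alpha_N\prod_{j=0}^{N-1}h^{(4)}_{2j+1}$ with $$\alpha_N=\frac1{(2N)!}\,\frac{S_N\bigl(-X^2;\frac{a+1}2,\frac12,0\bigr)}{(\frac{a+2}2)_N(\frac{a+1}2)_N},\qquad h^{(4)}_j=\tfrac12\Gamma(j+2)\Gamma(j+a+2).$$ 3. *Jacobi*, $e^{-2V}=(1-x)^a(1+x)^b$, $f=1-x^2$ on $(-1,1)$, $a,b>-1$: $Z_N(X)=2^N\alpha_N\prod_{j=0}^{N-1}h^{(4)}_{2j+1}$ with $$\alpha_N=\frac{\Gamma(4N+a+b+2)\Gamma(b+1)}{4^N(2N)!\,\Gamma(2N+b+1)\Gamma(a+b+2)}\;\frac{W_N\bigl(-\frac{X^2}4;\frac{a+1}2,\frac{b+1}2,\frac12,0\bigr)}{(\frac{a+b+2}2)_N(\frac{a+2}2)_N(\frac{a+1}2)_N},$$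 $$h^{(4)}_j=2^{a+b+2j+2}\frac{\Gamma(j+2)\Gamma(j+a+2)\Gamma(j+b+2)\Gamma(j+a+b+2)}{\Gamma(2j+a+b+2)\Gamma(2j+a+b+4)}.$$ 4. *Generalised Cauchy*, $e^{-2V}=(1-ix)^c(1+ix)^{\bar c}$, $c=-p+iq$ with $p,q\in\mathbb R$, $f=1+x^2$ on $\mathbb R$, $p>2N-\frac12$: $$Z_N(X)=2^N\prod_{j=0}^{N-1}h^{(1)}_j\cdot\frac{(-4)^N\,W_N\bigl(\frac{X^2}4;\frac{\bar c+1}2,\frac{c+1}2,\frac12,0\bigr)}{(N+\frac12-p)_N},$$ $$h^{(1)}_j=2^{4j-2p+3}\pi\frac{\Gamma(2j+1)\Gamma(2p-4j)\Gamma(2p-4j-2)}{\Gamma(2p-2j)\,\Gamma(p+iq-2j)\Gamma(p-iq-2j)}.$$ -/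

import Mathlib

open MeasureTheory

noncomputable section

namespace MixedCharge

/-! ### The two-component log-gas on the line -/

/-- Boltzmann factor of `L` charges `+1` at `α` and `M` charges `+2` at `β`, in the confining
potentials `V₁` and `V₂`. -/
def boltzmann (V₁ V₂ : ℝ → ℝ) (L M : ℕ) (α : Fin L → ℝ) (β : Fin M → ℝ) : ℝ :=
  (∏ j : Fin L, ∏ k ∈ Finset.Ioi j, |α k - α j|) *
  (∏ j : Fin M, ∏ k ∈ Finset.Ioi j, |β k - β j| ^ 4) *
  (∏ j : Fin L, ∏ k : Fin M, |α j - β k| ^ 2) *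
  (∏ j : Fin L, Real.exp (-V₁ (α j))) * (∏ k : Fin M, Real.exp (-2 * V₂ (β k)))

/-- The partition function `Z_{L,M}` with fixed numbers of particles of the two species; positions
are integrated against the reference measure `μ`. -/
def fixedPartition (μ : Measure ℝ) (V₁ V₂ : ℝ → ℝ) (L M : ℕ) : ℝ :=
  1 / ((L.factorial : ℝ) * (M.factorial : ℝ)) *
    ∫ x : (Fin L → ℝ) × (Fin M → ℝ), boltzmann V₁ V₂ L M x.1 x.2
      ∂((Measure.pi fun _ : Fin L => μ).prod (Measure.pi fun _ : Fin M => μ))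

/-- The grand canonical partition function `Z_N(X)` with fugacity `X`: the sum of
`X ^ L * Z_{L,M}` over all `(L, M)` with `L + 2 * M = 2 * N`. -/
def grandPartition (μ : Measure ℝ) (V₁ V₂ : ℝ → ℝ) (N : ℕ) (X : ℂ) : ℂ :=
  ∑ a ∈ (Finset.range (2 * N + 1) ×ˢ Finset.range (N + 1)).filter
      (fun a => a.1 + 2 * a.2 = 2 * N),
    X ^ a.1 * (fixedPartition μ V₁ V₂ a.1 a.2 : ℂ)

/-- All integrals occurring in `Z_N(X)` converge absolutely. -/
def PartitionConverges (μ : Measure ℝ) (V₁ V₂ : ℝ → ℝ) (N : ℕ) : Prop :=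
  ∀ L M : ℕ, L + 2 * M = 2 * N →
    Integrable (fun x : (Fin L → ℝ) × (Fin M → ℝ) => boltzmann V₁ V₂ L M x.1 x.2)
      ((Measure.pi fun _ : Fin L => μ).prod (Measure.pi fun _ : Fin M => μ))

/-! ### The skew inner products and the relations between them -/

/-- The skew inner product `⟨φ, ψ⟩_{1,V}`. -/
def skewOne (μ : Measure ℝ) (V : ℝ → ℝ) (φ ψ : Polynomial ℂ) : ℂ :=
  1 / 2 * ∫ t : ℝ × ℝ, φ.eval (t.1 : ℂ) * ψ.eval (t.2 : ℂ) *
    ((Real.sign (t.2 - t.1) * Real.exp (-V t.1 - V t.2) : ℝ) : ℂ) ∂(μ.prod μ)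

/-- The skew inner product `⟨φ, ψ⟩_{4,V}`. -/
def skewFour (μ : Measure ℝ) (V : ℝ → ℝ) (φ ψ : Polynomial ℂ) : ℂ :=
  1 / 2 * ∫ z : ℝ, (φ.eval (z : ℂ) * ψ.derivative.eval (z : ℂ) -
    φ.derivative.eval (z : ℂ) * ψ.eval (z : ℂ)) * (Real.exp (-2 * V z) : ℂ) ∂μ

/-- The polynomial `p_{2n+1} - ζ_n p_{2n-1}`, with `p_{-1} = 0`. -/
def oddCombination (p : ℕ → Polynomial ℂ) (ζ : ℕ → ℂ) : ℕ → Polynomial ℂ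
  | 0 => p 1
  | n + 1 => p (2 * n + 3) - Polynomial.C (ζ (n + 1)) * p (2 * n + 1)

/-- The monic polynomials `p_0, …, p_{2N-1}` satisfy the relations, with respect to both skew inner
products, that make the mixed model solvable. An infinite sequence `p_0, p_1, …` satisfies the
relations for all indices if and only if this holds for every `N`. -/
structure SkewRelations (μ : Measure ℝ) (V₁ V₂ : ℝ → ℝ) (N : ℕ) (p : ℕ → Polynomial ℂ)
    (ζ h₁ h₄ : ℕ → ℂ) : Prop where
  monic : ∀ j < 2 * N, (p j).Monic
  natDegree : ∀ j < 2 * N, (p j).natDegree = j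
  one_even_odd : ∀ m < N, ∀ n < N,
    skewOne μ V₁ (p (2 * m)) (oddCombination p ζ n) = if n = m then h₁ n else 0
  one_even_even : ∀ m < N, ∀ n < N, skewOne μ V₁ (p (2 * m)) (p (2 * n)) = 0
  one_odd_odd : ∀ m < N, ∀ n < N,
    skewOne μ V₁ (oddCombination p ζ n) (oddCombination p ζ m) = 0
  four_even_odd : ∀ m < N, ∀ n < N,
    skewFour μ V₂ (p (2 * m)) (p (2 * n + 1)) =
      (if n = m then h₄ (2 * n) else 0) - (if m = n + 1 then h₄ (2 * n + 1) else 0)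
  four_even_even : ∀ m < N, ∀ n < N, skewFour μ V₂ (p (2 * m)) (p (2 * n)) = 0
  four_odd_odd : ∀ m < N, ∀ n < N, skewFour μ V₂ (p (2 * m + 1)) (p (2 * n + 1)) = 0

/-- The recurrence
`h₄(2j+1) α_{j+1} - (X² h₁(j) + h₄(2j) + ζ_j h₄(2j-1)) α_j + ζ_j h₄(2j-2) α_{j-1} = 0`
for `0 ≤ j < N`, with `α_{-1} = 0`, `α_0 = 1`. For `j = 0` the terms that stem from `p_{-1} = 0`,
namely those containing `ζ_0`, are absent. -/
structure AlphaRecurrence (X : ℂ) (ζ h₁ h₄ : ℕ → ℂ) (N : ℕ) (α : ℕ → ℂ) : Prop where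
  init : α 0 = 1
  first : 0 < N → h₄ 1 * α 1 - (X ^ 2 * h₁ 0 + h₄ 0) * α 0 = 0
  step : ∀ i, i + 1 < N →
    h₄ (2 * i + 3) * α (i + 2)
      - (X ^ 2 * h₁ (i + 1) + h₄ (2 * i + 2) + ζ (i + 1) * h₄ (2 * i + 1)) * α (i + 1)
      + ζ (i + 1) * h₄ (2 * i) * α i = 0

/-! ### Hypergeometric polynomials -/

/-- The Pochhammer symbol `(a)_k = a (a+1) ⋯ (a+k-1)`. -/
def poch (a : ℂ) (k : ℕ) : ℂ := (ascPochhammer ℂ k).eval a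

/-- The Laguerre polynomial `L_n^{(a)}(x)`, in the standard (not monic) normalisation. -/
def laguerreL (n : ℕ) (a x : ℂ) : ℂ :=
  ∑ k ∈ Finset.range (n + 1),
    poch (a + k + 1) (n - k) / ((n - k).factorial : ℂ) * ((-x) ^ k / (k.factorial : ℂ))

/-- The continuous dual Hahn polynomial `S_n(y; a, b, c)` in the variable `y = x²`, that is
`(a+b)_n (a+c)_n` times the `₃F₂` with upper parameters `-n, a+ix, a-ix` and lower parameters
`a+b, a+c` at argument `1`; note `(a+ix)_k (a-ix)_k = ∏_{i<k} ((a+i)² + y)`. -/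
def dualHahn (n : ℕ) (y a b c : ℂ) : ℂ :=
  ∑ k ∈ Finset.range (n + 1),
    poch (-n) k / (k.factorial : ℂ) * (∏ i ∈ Finset.range k, ((a + i) ^ 2 + y)) *
      (poch (a + b + k) (n - k) * poch (a + c + k) (n - k))

/-- The Wilson polynomial `W_n(y; a, b, c, d)` in the variable `y = x²`, that is
`(a+b)_n (a+c)_n (a+d)_n` times the `₄F₃` with upper parameters `-n, n+a+b+c+d-1, a+ix, a-ix` and
lower parameters `a+b, a+c, a+d` at argument `1`. -/
def wilson (n : ℕ) (y a b c d : ℂ) : ℂ :=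
  ∑ k ∈ Finset.range (n + 1),
    poch (-n) k * poch (n + a + b + c + d - 1) k / (k.factorial : ℂ) *
      (∏ i ∈ Finset.range k, ((a + i) ^ 2 + y)) *
      (poch (a + b + k) (n - k) * poch (a + c + k) (n - k) * poch (a + d + k) (n - k))

/-! ### The classical weights

A classical weight `exp (-2 V)` with Pearson pair `(f, g)`, `2 V' = g / f`, gives the potentials
`V₁ = V + (log f) / 2` and `V₂ = V - (log f) / 2`. -/

def potentialOne (V f : ℝ → ℝ) (x : ℝ) : ℝ := V x + Real.log (f x) / 2

def potentialTwo (V f : ℝ → ℝ) (x : ℝ) : ℝ := V x - Real.log (f x) / 2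

/-- Gaussian weight `exp (-x²)` on `ℝ`. -/
def gaussV (x : ℝ) : ℝ := x ^ 2 / 2

def gaussF (_ : ℝ) : ℝ := 1

/-- Laguerre weight `x ^ a * exp (-x)` on `(0, ∞)`. -/
def laguerreV (a x : ℝ) : ℝ := (x - a * Real.log x) / 2

def laguerreF (x : ℝ) : ℝ := x

/-- Jacobi weight `(1 - x) ^ a * (1 + x) ^ b` on `(-1, 1)`. -/
def jacobiV (a b x : ℝ) : ℝ := -(a * Real.log (1 - x) + b * Real.log (1 + x)) / 2

def jacobiF (x : ℝ) : ℝ := 1 - x ^ 2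

/-- Generalised Cauchy weight `(1 - i x) ^ c * (1 + i x) ^ (conj c)` on `ℝ`, where `c = -p + i q`;
it equals `(1 + x²) ^ (-p) * exp (2 q arctan x)`. -/
def cauchyV (p q x : ℝ) : ℝ := (p * Real.log (1 + x ^ 2) - 2 * q * Real.arctan x) / 2

def cauchyF (x : ℝ) : ℝ := 1 + x ^ 2

/-- The normalisation `h⁽⁴⁾_j` for the Gaussian weight. -/
def gaussH4 (j : ℕ) : ℝ := (1 / 2) ^ (j + 1) * Real.sqrt Real.pi * Real.Gamma (j + 2)

/-- The normalisation `h⁽⁴⁾_j` for the Laguerre weight. -/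
def laguerreH4 (a : ℝ) (j : ℕ) : ℝ := 1 / 2 * Real.Gamma (j + 2) * Real.Gamma (j + a + 2)

/-- The normalisation `h⁽⁴⁾_j` for the Jacobi weight. -/
def jacobiH4 (a b : ℝ) (j : ℕ) : ℝ :=
  (2 : ℝ) ^ (a + b + 2 * j + 2) *
    (Real.Gamma (j + 2) * Real.Gamma (j + a + 2) * Real.Gamma (j + b + 2) *
      Real.Gamma (j + a + b + 2)) /
    (Real.Gamma (2 * j + a + b + 2) * Real.Gamma (2 * j + a + b + 4))

/-- The normalisation `h⁽¹⁾_j` for the generalised Cauchy weight. -/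
def cauchyH1 (p q : ℝ) (j : ℕ) : ℝ :=
  (2 : ℝ) ^ (4 * j - 2 * p + 3) * Real.pi *
    (Real.Gamma (2 * j + 1) * Real.Gamma (2 * p - 4 * j) * Real.Gamma (2 * p - 4 * j - 2)) /
    (Real.Gamma (2 * p - 2 * j) * ‖Complex.Gamma (p - 2 * j + q * Complex.I)‖ ^ 2)

/-- `α_N` for the Gaussian weight. -/
def gaussAlpha (X : ℂ) (N : ℕ) : ℂ :=
  4 ^ N * (N.factorial : ℂ) / ((2 * N).factorial : ℂ) * laguerreL N (-1 / 2) (-X ^ 2)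

/-- `α_N` for the Laguerre weight. -/
def laguerreAlpha (a : ℝ) (X : ℂ) (N : ℕ) : ℂ :=
  1 / ((2 * N).factorial : ℂ) *
    (dualHahn N (-X ^ 2) ((a + 1) / 2) (1 / 2) 0 /
      (poch ((a + 2) / 2) N * poch ((a + 1) / 2) N))

/-- `α_N` for the Jacobi weight. -/
def jacobiAlpha (a b : ℝ) (X : ℂ) (N : ℕ) : ℂ :=
  ((Real.Gamma (4 * N + a + b + 2) * Real.Gamma (b + 1) /
      (4 ^ N * ((2 * N).factorial : ℝ) * Real.Gamma (2 * N + b + 1) *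
        Real.Gamma (a + b + 2)) : ℝ) : ℂ) *
    (wilson N (-X ^ 2 / 4) ((a + 1) / 2) ((b + 1) / 2) (1 / 2) 0 /
      (poch ((a + b + 2) / 2) N * poch ((a + 2) / 2) N * poch ((a + 1) / 2) N))

end MixedCharge

end

open MixedCharge

open MeasureTheory

open MixedCharge

noncomputable section

/-! Up to signs the Boltzmann factor is a confluent Vandermonde determinant (`det_confluentEval`): a
charge `+1` at `α j` contributes an evaluation row, a charge `+2` at `β k` a value row and a
derivative row. The absolute values leave only the product of the signs of `α k - α j`, and by de
Bruijn's observation (`pfSum_signMatrix`) that product is itself a Pfaffian, of the matrix of signs.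
When both are expanded and integrated, the charges `+1` are matched in pairs; each pair produces the
form `⟨·,·⟩₁` and each charge `+2` the form `⟨·,·⟩₄`. Thus `l! M! Z_{2l,M}` is a polarised Pfaffian
with `l` factors of the first form and `M` of the second (`fixedPartition_eq_pfSum`), and by
multilinearity the sum over `l` is a single Pfaffian of `X² ⟨·,·⟩₁ + ⟨·,·⟩₄` in an arbitrary monic
basis (`grandPartition_eq_pfSum`).

In the basis `p_{2n}`, `p_{2n+1} - ζ_n p_{2n-1}` only even and odd members are coupled, so the
Pfaffian is an `N × N` determinant. The first form is diagonal in it and the second tridiagonal, so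
the determinant is a continuant (`grandPartition_eq_continuant`); the recurrence for `α` is the
continuant recurrence with the product of the `h₄ (2j+1)` split off.

For a classical weight `w = e^{-2V}` the Pearson equation `(f w)' = τ w` holds with `deg f ≤ 2`,
`deg τ ≤ 1`. Let `D φ = f φ' + τ φ / 2` and `Λ φ = ∫ φ w`. Then `(φ e^{-V₂})' = (D φ) e^{-V₁}` and
`D` is antisymmetric for `Λ`, which gives `⟨φ, ψ⟩₄ = Λ(φ D ψ)` and `⟨φ, D χ⟩₁ = -Λ(φ χ)`: the two
forms represent `D` and, up to sign, its inverse. Since `D` raises degrees by at most one and is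
antisymmetric, it couples an orthogonal polynomial only to its two neighbours, and this yields all
the skew relations (`IsPearson.skewRelations`). With `k_j` the leading coefficient of `D p_j` and
`r_j` the squared norm, the continuants divided by the product of the `h₁` obey `E_{n+2} = (X² +
γ_{2n+2} + γ_{2n+1}) E_{n+1} - γ_{2n+1} γ_{2n} E_n`, where `γ_j = k_j² r_{j+1} / r_j`.

The norms follow from Rodrigues' formula and the total masses of `f^j w`. The resulting recurrence
is that of Laguerre, continuous dual Hahn or Wilson polynomials, checked on coefficients in a Newton
basis (`newtonSum_recurrence`). The mass of the generalised Cauchy weight comes from a recurrence in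
`p`, the asymptotics as `p → ∞` and Gauss's product for the Gamma function (`cauchyIntegral_eq`). -/

namespace MixedCharge

/-! ### Polarised Pfaffians -/

section Pfaffian

variable {K K' : Type*} [Fintype K] [DecidableEq K] [Fintype K'] [DecidableEq K']

/-- The signed sum over all ways of filling the pairs `(k, 0), (k, 1)`; for a constant family of
skew-symmetric matrices it is `2 ^ |K| * |K|!` times the Pfaffian. -/
def pfSum (A : K → K × Fin 2 → K × Fin 2 → ℂ) : ℂ :=
  ∑ σ : Equiv.Perm (K × Fin 2), ((Equiv.Perm.sign σ : ℤ) : ℂ) *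
    ∏ k, A k (σ (k, 0)) (σ (k, 1))

lemma pfSum_reindex (e : K ≃ K') (A : K' → K' × Fin 2 → K' × Fin 2 → ℂ) :
    pfSum (fun k a b => A (e k) (e a.1, a.2) (e b.1, b.2)) = pfSum A := by
  unfold pfSum
  set E : K × Fin 2 ≃ K' × Fin 2 := e.prodCongr (Equiv.refl _) with hE
  refine Fintype.sum_equiv (Equiv.permCongr E) _ _ fun σ => ?_
  rw [Equiv.Perm.sign_permCongr]
  congr 1
  refine Fintype.prod_equiv e _ _ fun k => ?_
  simp [hE, Equiv.permCongr_apply, Prod.map]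

/-- The permutation acts alike on the first and on the second members of the pairs, so its sign
occurs squared. Hence it does not matter which pair carries which form. -/
lemma pfSum_perm_index (π : Equiv.Perm K) (A : K → K × Fin 2 → K × Fin 2 → ℂ) :
    pfSum (fun k => A (π k)) = pfSum A := by
  unfold pfSum
  refine Fintype.sum_equiv (Equiv.mulRight (Equiv.prodCongrLeft fun _ : Fin 2 => π⁻¹)) _ _ fun σ => ?_
  have hs : Equiv.Perm.sign (Equiv.prodCongrLeft fun _ : Fin 2 => π⁻¹) = 1 := by
    rw [Equiv.Perm.sign_prodCongrLeft]
    simp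
  congr 1
  · simp [Equiv.Perm.sign_mul, hs]
  · refine Fintype.prod_equiv π _ _ fun k => ?_
    simp [Equiv.prodCongrLeft]

lemma pfSum_comp_perm (π : Equiv.Perm (K × Fin 2)) (A : K → K × Fin 2 → K × Fin 2 → ℂ) :
    pfSum (fun k a b => A k (π a) (π b)) = ((Equiv.Perm.sign π : ℤ) : ℂ) * pfSum A := by
  unfold pfSum
  rw [Finset.mul_sum]
  refine Fintype.sum_equiv (Equiv.mulLeft π) _ _ fun σ => ?_
  have h : ((Equiv.Perm.sign π : ℤ) : ℂ) * ((Equiv.Perm.sign π : ℤ) : ℂ) = 1 := by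
    rw [← Int.cast_mul, ← Units.val_mul, Int.units_mul_self]; simp
  simp only [Equiv.coe_mulLeft, Equiv.Perm.sign_mul, Units.val_mul, Int.cast_mul,
    Equiv.Perm.mul_apply]
  rw [← mul_assoc, ← mul_assoc, h, one_mul]

/-- A swap inside a pair can be absorbed into `σ`, and its sign offsets the minus sign, so all `2 ^
|K|` terms of the expanded product contribute equally. In particular only the antisymmetric part of
each factor matters. -/
lemma pfSum_sub_swap (A : K → K × Fin 2 → K × Fin 2 → ℂ) :
    pfSum (fun k a b => A k a b - A k b a) = 2 ^ Fintype.card K * pfSum A := by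
  have h1 : ∀ σ : Equiv.Perm (K × Fin 2),
      ∏ k, (A k (σ (k, 0)) (σ (k, 1)) - A k (σ (k, 1)) (σ (k, 0))) =
        ∑ t : K → Equiv.Perm (Fin 2), (∏ k, ((Equiv.Perm.sign (t k) : ℤ) : ℂ)) *
          ∏ k, A k (σ (k, t k 0)) (σ (k, t k 1)) := by
    intro σ
    have h2 : ∀ k, A k (σ (k, 0)) (σ (k, 1)) - A k (σ (k, 1)) (σ (k, 0)) =
        ∑ t : Equiv.Perm (Fin 2), ((Equiv.Perm.sign t : ℤ) : ℂ) *
          A k (σ (k, t 0)) (σ (k, t 1)) := by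
      intro k
      rw [show (Finset.univ : Finset (Equiv.Perm (Fin 2))) = {1, Equiv.swap 0 1} by decide]
      rw [Finset.sum_pair (by decide)]
      simp [sub_eq_add_neg]
    simp_rw [h2, Finset.prod_univ_sum, Fintype.piFinset_univ, Finset.prod_mul_distrib]
  unfold pfSum
  simp_rw [h1, Finset.mul_sum]
  rw [Finset.sum_comm]
  have h3 : ∀ t : K → Equiv.Perm (Fin 2),
      ∑ σ : Equiv.Perm (K × Fin 2), ((Equiv.Perm.sign σ : ℤ) : ℂ) *
        ((∏ k, ((Equiv.Perm.sign (t k) : ℤ) : ℂ)) * ∏ k, A k (σ (k, t k 0)) (σ (k, t k 1))) =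
      ∑ σ : Equiv.Perm (K × Fin 2), ((Equiv.Perm.sign σ : ℤ) : ℂ) *
        ∏ k, A k (σ (k, 0)) (σ (k, 1)) := by
    intro t
    refine Fintype.sum_equiv (Equiv.mulRight (Equiv.prodCongrRight t)) _ _ fun σ => ?_
    simp only [Equiv.coe_mulRight, Equiv.Perm.sign_mul, Units.val_mul, Int.cast_mul,
      Equiv.Perm.mul_apply, Equiv.Perm.sign_prodCongrRight, Units.coe_prod, Int.cast_prod,
      Equiv.prodCongrRight_apply]
    ring
  rw [Finset.sum_congr rfl fun t _ => h3 t, Finset.sum_const, Finset.card_univ, Fintype.card_fun,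
    Fintype.card_perm, Fintype.card_fin]
  simp [Finset.mul_sum]

lemma pfSum_smul (c : K → ℂ) (A : K → K × Fin 2 → K × Fin 2 → ℂ) :
    pfSum (fun k a b => c k * A k a b) = (∏ k, c k) * pfSum A := by
  simp only [pfSum, Finset.prod_mul_distrib, Finset.mul_sum]
  exact Finset.sum_congr rfl fun σ _ => by ring

/-- The multilinear map `v ↦ ∏ k, B (v (k, 0)) (v (k, 1))`. -/
def pairProd {V : Type*} [AddCommGroup V] [Module ℂ V] (B : V →ₗ[ℂ] V →ₗ[ℂ] ℂ) :
    MultilinearMap ℂ (fun _ : K × Fin 2 => V) ℂ :=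
  MultilinearMap.mk' (fun v => ∏ k, B (v (k, 0)) (v (k, 1)))
    (by
      rintro v ⟨k, e⟩ x y
      simp only [← Finset.mul_prod_erase Finset.univ _ (Finset.mem_univ k)]
      have h : ∀ z : V, ∏ i ∈ Finset.univ.erase k, B (Function.update v (k, e) z (i, 0))
          (Function.update v (k, e) z (i, 1)) = ∏ i ∈ Finset.univ.erase k, B (v (i, 0)) (v (i, 1)) :=
        fun z => Finset.prod_congr rfl fun i hi => by
          have hik := Finset.ne_of_mem_erase hi
          rw [Function.update_of_ne (by simp [hik]), Function.update_of_ne (by simp [hik])]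
      rw [h, h, h, ← add_mul]
      congr 1
      fin_cases e <;> simp)
    (by
      rintro v ⟨k, e⟩ c x
      simp only [← Finset.mul_prod_erase Finset.univ _ (Finset.mem_univ k)]
      have h : ∀ z : V, ∏ i ∈ Finset.univ.erase k, B (Function.update v (k, e) z (i, 0))
          (Function.update v (k, e) z (i, 1)) = ∏ i ∈ Finset.univ.erase k, B (v (i, 0)) (v (i, 1)) :=
        fun z => Finset.prod_congr rfl fun i hi => by
          have hik := Finset.ne_of_mem_erase hi
          rw [Function.update_of_ne (by simp [hik]), Function.update_of_ne (by simp [hik])]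
      rw [h, h, smul_eq_mul, ← mul_assoc]
      congr 1
      fin_cases e <;> simp)

lemma pairProd_apply {V : Type*} [AddCommGroup V] [Module ℂ V] (B : V →ₗ[ℂ] V →ₗ[ℂ] ℂ)
    (v : K × Fin 2 → V) : pairProd B v = ∏ k, B (v (k, 0)) (v (k, 1)) := rfl

lemma alternatization_pairProd {V : Type*} [AddCommGroup V] [Module ℂ V]
    (B : V →ₗ[ℂ] V →ₗ[ℂ] ℂ) (v : K × Fin 2 → V) :
    MultilinearMap.alternatization (pairProd (K := K) B) v =
      pfSum fun _ a b => B (v a) (v b) := by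
  rw [MultilinearMap.alternatization_apply]
  unfold pfSum
  refine Finset.sum_congr rfl fun σ _ => ?_
  rw [MultilinearMap.domDomCongr_apply, pairProd_apply, Units.smul_def, zsmul_eq_mul]

/-- As a function of the rows of `P` the left side is an alternating form of top degree, hence a
multiple of the determinant; the multiple is its value at `P = 1`. -/
lemma pfSum_congruence (P C : Matrix (K × Fin 2) (K × Fin 2) ℂ) :
    pfSum (fun _ => P * C * P.transpose) = P.det * pfSum (fun _ : K => C) := by
  set f := MultilinearMap.alternatization (pairProd (K := K) (Matrix.toLinearMap₂' ℂ C))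
  have h1 := congrArg (fun g => g P.row) (f.eq_smul_basis_det (Pi.basisFun ℂ _))
  simp only [f, AlternatingMap.smul_apply, alternatization_pairProd, Pi.basisFun_det,
    smul_eq_mul] at h1
  have h2 : Matrix.detRowAlternating P.row = P.det := rfl
  rw [h2] at h1
  have h3 : (fun a b => Matrix.toLinearMap₂' ℂ C (P.row a) (P.row b)) = P * C * P.transpose := by
    ext a b
    rw [Matrix.toLinearMap₂'_apply', Matrix.mul_apply_eq_vecMul, Matrix.dotProduct_mulVec]
    rw [Matrix.mul_apply_eq_vecMul]
    rfl
  have h4 : (fun a b => Matrix.toLinearMap₂' ℂ C ((Pi.basisFun ℂ (K × Fin 2)) a)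
      ((Pi.basisFun ℂ (K × Fin 2)) b)) = C := by
    ext a b
    rw [Matrix.toLinearMap₂'_apply', Pi.basisFun_apply, Pi.basisFun_apply, Matrix.mulVec_single_one,
      single_one_dotProduct]
    rfl
  have h5 : pfSum (fun _ : K => P * C * P.transpose) =
      pfSum (fun (_ : K) a b => Matrix.toLinearMap₂' ℂ C (P.row a) (P.row b)) := by rw [← h3]
  rw [h5, h1, mul_comm]
  congr 1
  exact congrArg (fun c => pfSum fun _ : K => c) h4

/-- The standard symplectic matrix, with unit blocks on the pairs `(k, 0), (k, 1)`. -/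
def stdSymplectic (K : Type*) [DecidableEq K] : Matrix (K × Fin 2) (K × Fin 2) ℂ :=
  fun a b => (if a.1 = b.1 ∧ a.2 = 0 ∧ b.2 = 1 then 1 else 0) -
    (if b.1 = a.1 ∧ b.2 = 0 ∧ a.2 = 1 then 1 else 0)

/-- The matrix is the antisymmetrisation of a 0-1 matrix. For the latter only those `σ` survive that
carry pairs to pairs without swapping; there are `|K|!` of them, all even because the permutation of
the pairs acts twice. -/
lemma pfSum_stdSymplectic :
    pfSum (fun _ : K => stdSymplectic K) = 2 ^ Fintype.card K * (Fintype.card K).factorial := by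
  have h := pfSum_sub_swap (K := K)
    (fun _ a b => if a.1 = b.1 ∧ a.2 = 0 ∧ b.2 = 1 then 1 else 0)
  have h0 : pfSum (fun _ : K => stdSymplectic K) = _ := h
  rw [h0]
  congr 1
  unfold pfSum
  have h1 : ∀ σ : Equiv.Perm (K × Fin 2),
      (∏ k, if (σ (k, 0)).1 = (σ (k, 1)).1 ∧ (σ (k, 0)).2 = 0 ∧ (σ (k, 1)).2 = 1
        then (1 : ℂ) else 0) =
      ∑ π : Equiv.Perm K, if σ = Equiv.prodCongrLeft (fun _ : Fin 2 => π) then 1 else 0 := by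
    intro σ
    rw [Finset.prod_ite_zero]
    simp only [Finset.mem_univ, true_implies, Finset.prod_const_one]
    split_ifs with hσ
    · have hinj : Function.Injective fun k => (σ (k, 0)).1 := by
        intro k k' hk
        have : σ (k, 0) = σ (k', 0) := by
          ext
          · simpa using hk
          · simp [(hσ k).2.1, (hσ k').2.1]
        simpa using σ.injective this
      set π : Equiv.Perm K := Equiv.ofBijective _ (Finite.injective_iff_bijective.1 hinj)
      rw [Finset.sum_eq_single π]
      · rw [if_pos]
        ext ⟨k, e⟩
        · fin_cases e
          · rfl
          · exact (hσ k).1.symm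
        · fin_cases e
          · simp [(hσ k).2.1]
          · simp [(hσ k).2.2]
      · intro π' _ hne
        rw [if_neg]
        rintro rfl
        exact hne (Equiv.ext fun k => rfl)
      · simp
    · symm
      refine Finset.sum_eq_zero fun π _ => if_neg ?_
      rintro rfl
      exact hσ fun k => ⟨rfl, rfl, rfl⟩
  simp_rw [h1, Finset.mul_sum]
  rw [Finset.sum_comm]
  simp [Equiv.Perm.sign_prodCongrLeft, ← Fintype.card_perm]

/-- Such a matrix is congruent to the standard symplectic one through `diag (c, 1)`, with `c` the
block that couples first to second members. -/
lemma pfSum_of_alternating_blocks (C : Matrix (K × Fin 2) (K × Fin 2) ℂ)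
    (h00 : ∀ i j, C (i, 0) (j, 0) = 0) (h11 : ∀ i j, C (i, 1) (j, 1) = 0)
    (h10 : ∀ i j, C (i, 1) (j, 0) = -C (j, 0) (i, 1)) :
    pfSum (fun _ : K => C) = 2 ^ Fintype.card K * (Fintype.card K).factorial *
      (Matrix.of fun i j => C (i, 0) (j, 1)).det := by
  set c : Matrix K K ℂ := Matrix.of fun i j => C (i, 0) (j, 1) with hc
  set P : Matrix (K × Fin 2) (K × Fin 2) ℂ :=
    Matrix.blockDiagonal fun e : Fin 2 => if e = 0 then c else 1 with hP
  have h : C = P * stdSymplectic K * P.transpose := by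
    ext ⟨i, e⟩ ⟨j, e'⟩
    simp only [Matrix.mul_apply, Fintype.sum_prod_type, Fin.sum_univ_two, hP,
      Matrix.blockDiagonal_apply, stdSymplectic, Matrix.transpose_apply]
    fin_cases e <;> fin_cases e' <;>
      simp [h00, h11, h10, hc, Matrix.one_apply, Finset.sum_ite_eq]
  rw [h, pfSum_congruence, pfSum_stdSymplectic, mul_comm]
  congr 1
  rw [hP, Matrix.det_blockDiagonal, Fin.prod_univ_two]
  simp

end Pfaffian

/-! ### The product of signs as a Pfaffian -/

section SignProduct

/-- The product of the signs of `α j - α i` over `i < j`. -/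
def signProd {n : ℕ} (α : Fin n → ℝ) : ℝ := Real.sign (Matrix.vandermonde α).det

lemma real_sign_mul (a b : ℝ) : Real.sign (a * b) = Real.sign a * Real.sign b := by
  rcases lt_trichotomy a 0 with ha | rfl | ha <;> rcases lt_trichotomy b 0 with hb | rfl | hb <;>
    simp [Real.sign_of_pos, Real.sign_of_neg, mul_pos_of_neg_of_neg, mul_neg_of_neg_of_pos,
      mul_neg_of_pos_of_neg, *]

lemma real_sign_units (u : ℤˣ) : Real.sign ((u : ℤ) : ℝ) = ((u : ℤ) : ℝ) := by
  rcases Int.units_eq_one_or u with rfl | rfl <;> simp [Real.sign_neg]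

lemma signProd_eq_zero {n : ℕ} {α : Fin n → ℝ} (h : ¬ Function.Injective α) : signProd α = 0 := by
  rw [signProd, Matrix.det_vandermonde_eq_zero_iff.2, Real.sign_zero]
  simp only [Function.Injective, not_forall] at h
  obtain ⟨i, j, h1, h2⟩ := h
  exact ⟨i, j, h1, h2⟩

lemma signProd_of_strictMono {n : ℕ} {α : Fin n → ℝ} (h : StrictMono α) : signProd α = 1 := by
  rw [signProd, Matrix.det_vandermonde]
  refine Real.sign_of_pos (Finset.prod_pos fun i _ => Finset.prod_pos fun j hj => ?_)
  exact sub_pos.2 (h (Finset.mem_Ioi.1 hj))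

lemma signProd_comp_perm {n : ℕ} (α : Fin n → ℝ) (π : Equiv.Perm (Fin n)) :
    signProd (α ∘ π) = ((Equiv.Perm.sign π : ℤ) : ℝ) * signProd α := by
  have h : (Matrix.vandermonde (α ∘ π)).det =
      ((Equiv.Perm.sign π : ℤ) : ℝ) * (Matrix.vandermonde α).det := by
    rw [← Matrix.det_permute]; rfl
  rw [signProd, h, real_sign_mul, real_sign_units, signProd]

/-- The matrix of signs of differences, indexed by pairs. -/
def signMatrix {l : ℕ} (α : Fin (l * 2) → ℝ) (a b : Fin l × Fin 2) : ℂ :=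
  (Real.sign (α (finProdFinEquiv b) - α (finProdFinEquiv a)) : ℂ)

lemma pfSum_signMatrix_comp_perm {l : ℕ} (α : Fin (l * 2) → ℝ) (π : Equiv.Perm (Fin (l * 2))) :
    pfSum (fun _ : Fin l => signMatrix (α ∘ π)) =
      ((Equiv.Perm.sign π : ℤ) : ℂ) * pfSum (fun _ : Fin l => signMatrix α) := by
  have h := pfSum_comp_perm (finProdFinEquiv.symm.permCongr π) (fun _ : Fin l => signMatrix α)
  rw [Equiv.Perm.sign_permCongr] at h
  rw [← h]
  congr 1
  funext _ a b
  simp only [signMatrix, Equiv.permCongr_apply, Equiv.symm_symm, Equiv.apply_symm_apply,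
    Function.comp_apply]

/-- For increasing points the matrix is `1` above and `-1` below the diagonal, and it is congruent
to the standard symplectic matrix through a unitriangular one, of determinant `1`. -/
lemma pfSum_signMatrix_of_strictMono {l : ℕ} {α : Fin (l * 2) → ℝ} (h : StrictMono α) :
    pfSum (fun _ : Fin l => signMatrix α) = 2 ^ l * l.factorial := by
  -- Row `a` is the unit vector at `a` plus `(-1, 1)` on every earlier pair. When two rows are
  -- paired symplectically, common earlier pairs carry parallel vectors and cancel, while the pair
  -- of the smaller row contributes `1`.
  set P : Matrix (Fin l × Fin 2) (Fin l × Fin 2) ℂ := fun a b =>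
    (if a = b then 1 else 0) - if b.1 < a.1 then (if b.2 = 0 then 1 else -1) else 0 with hP
  have hdet : P.det = 1 := by
    rw [← Matrix.det_submatrix_equiv_self finProdFinEquiv.symm P, Matrix.det_of_isLowerTriangular]
    · refine Finset.prod_eq_one fun i _ => ?_
      rw [Matrix.submatrix_apply]
      simp [hP]
    · intro i j hij
      have h1 : i < j := hij
      obtain ⟨a, rfl⟩ := finProdFinEquiv.surjective i
      obtain ⟨b, rfl⟩ := finProdFinEquiv.surjective j
      have h3 : ¬ b.1 < a.1 := by
        intro h4
        simp only [Fin.lt_def, finProdFinEquiv_apply_val] at h1 h4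
        omega
      have h2 : a ≠ b := by rintro rfl; exact lt_irrefl _ h1
      rw [Matrix.submatrix_apply]
      simp [hP, h2, h3]
  have hmul : P * stdSymplectic (Fin l) * P.transpose = (signMatrix α : Matrix _ _ ℂ) := by
    ext ⟨i, e⟩ ⟨j, e'⟩
    have h0 : (P * stdSymplectic (Fin l) * P.transpose) (i, e) (j, e') =
        ∑ k, (P (i, e) (k, 0) * P (j, e') (k, 1) - P (i, e) (k, 1) * P (j, e') (k, 0)) := by
      simp only [Matrix.mul_apply, Fintype.sum_prod_type, Fin.sum_univ_two, stdSymplectic,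
        Matrix.transpose_apply]
      refine Finset.sum_congr rfl fun k _ => ?_
      simp
      ring
    rw [h0]
    have hs : signMatrix α (i, e) (j, e') =
        if i < j then 1 else if j < i then -1 else ((e' : ℕ) : ℂ) - ((e : ℕ) : ℂ) := by
      have key : ∀ a b : Fin l × Fin 2, finProdFinEquiv a < finProdFinEquiv b →
          signMatrix α a b = 1 := fun a b hab => by
        rw [signMatrix, Real.sign_of_pos (sub_pos.2 (h hab))]; simp
      have key' : ∀ a b : Fin l × Fin 2, finProdFinEquiv b < finProdFinEquiv a →
          signMatrix α a b = -1 := fun a b hab => by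
        rw [signMatrix, Real.sign_of_neg (sub_neg.2 (h hab))]; simp
      rcases lt_trichotomy i j with hij | rfl | hij
      · rw [if_pos hij, key]
        simp only [Fin.lt_def, finProdFinEquiv_apply_val] at hij ⊢
        omega
      · simp only [lt_irrefl, if_false]
        fin_cases e <;> fin_cases e'
        · simp [signMatrix]
        · rw [key]
          · simp
          · simp [Fin.lt_def]
        · rw [key']
          · simp
          · simp [Fin.lt_def]
        · simp [signMatrix]
      · rw [if_neg (not_lt.2 hij.le), if_pos hij, key']
        simp only [Fin.lt_def, finProdFinEquiv_apply_val] at hij ⊢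
        omega
    rw [hs]
    rcases lt_trichotomy i j with hij | rfl | hij
    · rw [Finset.sum_eq_single i]
      · fin_cases e <;> simp [hP, hij, hij.ne']
      · intro k _ hk
        rcases lt_or_ge k i with hki | hki
        · have : k < j := hki.trans hij
          simp [hP, hki, this, hki.ne', this.ne']
        · simp [hP, hki.not_gt, Ne.symm hk]
      · simp
    · rw [Finset.sum_eq_single i]
      · fin_cases e <;> fin_cases e' <;> simp [hP]
      · intro k _ hk
        by_cases hki : k < i <;> simp [hP, hki, Ne.symm hk]
      · simp
    · rw [Finset.sum_eq_single j]
      · fin_cases e' <;> simp [hP, hij, hij.ne', hij.not_gt]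
      · intro k _ hk
        rcases lt_or_ge k j with hki | hki
        · have : k < i := hki.trans hij
          simp [hP, hki, this, hki.ne', this.ne']
        · simp [hP, hki.not_gt, Ne.symm hk]
      · simp
  have := pfSum_congruence (K := Fin l) P (stdSymplectic (Fin l))
  rw [hdet, one_mul, pfSum_stdSymplectic, hmul, Fintype.card_fin] at this
  exact this

/-- The Pfaffian of the matrix of signs of differences is the product of the signs. -/
theorem pfSum_signMatrix {l : ℕ} (α : Fin (l * 2) → ℝ) :
    pfSum (fun _ : Fin l => signMatrix α) = 2 ^ l * l.factorial * (signProd α : ℂ) := by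
  by_cases hα : Function.Injective α
  -- Both sides change by the same sign when the points are permuted, so the points may be sorted.
  · have hmono : StrictMono (α ∘ Tuple.sort α) :=
      (Tuple.monotone_sort α).strictMono_of_injective (hα.comp (Tuple.sort α).injective)
    have h1 := pfSum_signMatrix_of_strictMono hmono
    have h2 := signProd_of_strictMono hmono
    rw [pfSum_signMatrix_comp_perm] at h1
    rw [signProd_comp_perm] at h2
    set s := Equiv.Perm.sign (Tuple.sort α)
    have hs : ((s : ℤ) : ℂ) * ((s : ℤ) : ℂ) = 1 := by
      rw [← Int.cast_mul, ← Units.val_mul, Int.units_mul_self]; simp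
    have h2' : ((s : ℤ) : ℂ) * (signProd α : ℂ) = 1 := by exact_mod_cast congrArg (fun x : ℝ => (x : ℂ)) h2
    have hs0 : ((s : ℤ) : ℂ) ≠ 0 := left_ne_zero_of_mul_eq_one hs
    apply mul_left_cancel₀ hs0
    linear_combination h1 - 2 ^ l * l.factorial * h2'
  · rw [signProd_eq_zero hα]
    simp only [Function.Injective, not_forall] at hα
    obtain ⟨i, j, h1, h2⟩ := hα
    -- Exchanging two coinciding points leaves `α` unchanged and flips the sign of the Pfaffian,
    -- which therefore vanishes.
    have h3 : α ∘ Equiv.swap i j = α := by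
      funext k
      rcases eq_or_ne k i with rfl | hi
      · simp [h1]
      rcases eq_or_ne k j with rfl | hj
      · simp [h1]
      simp [Equiv.swap_apply_of_ne_of_ne hi hj]
    have h4 := pfSum_signMatrix_comp_perm α (Equiv.swap i j)
    rw [h3, Equiv.Perm.sign_swap h2] at h4
    push_cast at h4 ⊢
    linear_combination h4 / 2

end SignProduct

/-! ### The confluent Vandermonde determinant -/

section ConfluentVandermonde

variable {l M : ℕ}

/-- The position of a pair index in the linear order: all `inl` pairs, then all `inr` pairs. -/
def pairIndex (l M : ℕ) : (Fin l ⊕ Fin M) × Fin 2 ≃ Fin ((l + M) * 2) :=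
  (finSumFinEquiv.prodCongr (Equiv.refl _)).trans finProdFinEquiv

lemma pairIndex_inl (i : Fin l) (e : Fin 2) :
    (pairIndex l M (Sum.inl i, e) : ℕ) = e + 2 * i := by
  simp [pairIndex]

lemma pairIndex_inr (k : Fin M) (e : Fin 2) :
    (pairIndex l M (Sum.inr k, e) : ℕ) = e + 2 * (l + k) := by
  simp [pairIndex]

lemma prod_sum_prod {K K' : Type*} [Fintype K] [Fintype K'] (f : (K ⊕ K') × Fin 2 → ℂ) :
    ∏ a, f a = (∏ a : K × Fin 2, f (Sum.inl a.1, a.2)) * ∏ a : K' × Fin 2, f (Sum.inr a.1, a.2) := by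
  simp only [Fintype.prod_prod_type, Fintype.prod_sum_type]

/-- The determinant is the same for every monic family with one member in each degree, so the choice
of basis can be postponed. The points are ordered by `pairIndex`. -/
lemma det_eval_pairs (q : ℕ → Polynomial ℂ) (hq : ∀ j < 2 * (l + M), (q j).Monic)
    (hd : ∀ j < 2 * (l + M), (q j).natDegree = j) (v : (Fin l ⊕ Fin M) × Fin 2 → ℂ) :
    (Matrix.of fun j i => (q (pairIndex l M j)).eval (v i)).det =
      ∏ i, ∏ j, if pairIndex l M i < pairIndex l M j then v j - v i else 1 := by
  have h1 := Matrix.det_eval_matrixOfPolynomials_eq_det_vandermonde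
    (fun i => v ((pairIndex l M).symm i)) (fun j => q j)
    (fun i => hd i (by have := i.2; omega)) (fun i => hq i (by have := i.2; omega))
  rw [Matrix.det_vandermonde] at h1
  rw [← Matrix.det_transpose,
    ← Matrix.det_submatrix_equiv_self (pairIndex l M).symm]
  have h2 : ((Matrix.of fun j i => (q (pairIndex l M j)).eval (v i)).transpose.submatrix
      (pairIndex l M).symm (pairIndex l M).symm) =
      Matrix.of fun i j : Fin ((l + M) * 2) => (q j).eval (v ((pairIndex l M).symm i)) := by
    ext i j
    rw [Matrix.submatrix_apply, Matrix.transpose_apply, Matrix.of_apply, Matrix.of_apply,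
      Equiv.apply_symm_apply]
  rw [h2, ← h1]
  refine Fintype.prod_equiv (pairIndex l M).symm _ _ fun i => ?_
  rw [← Finset.prod_filter]
  refine Finset.prod_bij (fun j _ => (pairIndex l M).symm j) ?_ ?_ ?_ ?_
  · intro j hj
    simpa using hj
  · intro j _ j' _ h
    simpa using h
  · intro j hj
    exact ⟨pairIndex l M j, by simpa using hj, by simp⟩
  · intro j _
    rfl

/-- The discretised confluent Vandermonde determinant. -/
lemma det_eval_split_pairs (q : ℕ → Polynomial ℂ) (hq : ∀ j < 2 * (l + M), (q j).Monic)
    (hd : ∀ j < 2 * (l + M), (q j).natDegree = j) (x : Fin (l * 2) → ℂ) (y : Fin M → ℂ) (t : ℂ) :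
    (Matrix.of fun j i => (q (pairIndex l M j)).eval
      (Sum.elim (fun k => x (finProdFinEquiv (k, i.2))) (fun k => y k + (i.2 : ℕ) * t) i.1)).det =
      t ^ M * ((∏ i, ∏ j ∈ Finset.Ioi i, (x j - x i)) *
        (∏ j, ∏ k ∈ Finset.Ioi j, ((y k - y j) ^ 2 * (y k - y j + t) * (y k - y j - t))) *
        ∏ i, ∏ k, ((x i - y k) * (x i - y k - t))) := by
  rw [det_eval_pairs q hq hd (fun i =>
    Sum.elim (fun k => x (finProdFinEquiv (k, i.2))) (fun k => y k + (i.2 : ℕ) * t) i.1),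
    prod_sum_prod]
  simp only [prod_sum_prod, Sum.elim_inl, Sum.elim_inr]
  have hll : ∀ a b : Fin l × Fin 2, pairIndex l M (Sum.inl a.1, a.2) <
      pairIndex l M (Sum.inl b.1, b.2) ↔ finProdFinEquiv a < finProdFinEquiv b := by
    intro a b
    simp only [Fin.lt_def, pairIndex_inl, finProdFinEquiv_apply_val]
  have hlr : ∀ (a : Fin l × Fin 2) (b : Fin M × Fin 2), pairIndex l M (Sum.inl a.1, a.2) <
      pairIndex l M (Sum.inr b.1, b.2) ↔ True := by
    intro a b
    simp only [Fin.lt_def, pairIndex_inl, pairIndex_inr, iff_true]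
    have := a.2.2; have := a.1.2
    omega
  have hrl : ∀ (a : Fin l × Fin 2) (b : Fin M × Fin 2), pairIndex l M (Sum.inr b.1, b.2) <
      pairIndex l M (Sum.inl a.1, a.2) ↔ False := by
    intro a b
    simp only [Fin.lt_def, pairIndex_inl, pairIndex_inr, iff_false]
    have := a.2.2; have := a.1.2
    omega
  have hrr : ∀ a b : Fin M × Fin 2, pairIndex l M (Sum.inr a.1, a.2) <
      pairIndex l M (Sum.inr b.1, b.2) ↔ a.1 < b.1 ∨ a.1 = b.1 ∧ a.2 < b.2 := by
    intro a b
    simp only [Fin.lt_def, pairIndex_inr, Fin.ext_iff]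
    have := a.2.2; have := b.2.2
    omega
  simp only [hll, hlr, hrl, hrr, if_true, if_false, Finset.prod_const_one, one_mul]
  rw [Finset.prod_mul_distrib]
  have e1 : ∏ a : Fin l × Fin 2, ∏ b : Fin l × Fin 2,
      (if finProdFinEquiv a < finProdFinEquiv b then x (finProdFinEquiv b) - x (finProdFinEquiv a)
        else 1) = ∏ i, ∏ j ∈ Finset.Ioi i, (x j - x i) := by
    refine Fintype.prod_equiv finProdFinEquiv _ _ fun a => ?_
    rw [← Finset.prod_filter]
    refine Finset.prod_bij (fun j _ => finProdFinEquiv j) ?_ ?_ ?_ ?_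
    · intro j hj
      simpa using hj
    · intro j _ j' _ h
      simpa using h
    · intro j hj
      obtain ⟨b, rfl⟩ := finProdFinEquiv.surjective j
      exact ⟨b, by simpa using hj, rfl⟩
    · intro j _
      rfl
  have e2 : ∏ a : Fin l × Fin 2, ∏ b : Fin M × Fin 2,
      (y b.1 + ((b.2 : ℕ) : ℂ) * t - x (finProdFinEquiv a)) =
        ∏ i, ∏ k, ((x i - y k) * (x i - y k - t)) := by
    refine Fintype.prod_equiv finProdFinEquiv _ _ fun a => ?_
    rw [Fintype.prod_prod_type]
    refine Finset.prod_congr rfl fun k _ => ?_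
    rw [Fin.prod_univ_two]
    simp
    ring
  -- The pair `j` with itself contributes the single difference `t`, whence `t ^ M`; two different
  -- pairs contribute four differences.
  have e3 : ∏ a : Fin M × Fin 2, ∏ b : Fin M × Fin 2,
      (if a.1 < b.1 ∨ a.1 = b.1 ∧ a.2 < b.2 then
        y b.1 + ((b.2 : ℕ) : ℂ) * t - (y a.1 + ((a.2 : ℕ) : ℂ) * t) else 1) =
      t ^ M * ∏ j, ∏ k ∈ Finset.Ioi j, ((y k - y j) ^ 2 * (y k - y j + t) * (y k - y j - t)) := by
    rw [Fintype.prod_prod_type, show t ^ M = ∏ _j : Fin M, t by simp, ← Finset.prod_mul_distrib]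
    refine Finset.prod_congr rfl fun j _ => ?_
    rw [Fin.prod_univ_two, Fintype.prod_prod_type, Fintype.prod_prod_type, ← Finset.prod_mul_distrib]
    simp only [Fin.prod_univ_two]
    rw [← Finset.mul_prod_erase Finset.univ _ (Finset.mem_univ j)]
    congr 1
    · simp
    · rw [← Finset.prod_subset (s₁ := Finset.Ioi j)]
      · refine Finset.prod_congr rfl fun k hk => ?_
        simp only [Finset.mem_Ioi.1 hk, true_or, if_true]
        simp
        ring
      · intro k hk
        simpa using (Finset.mem_Ioi.1 hk).ne'
      · intro k hk hk'
        have h1 : ¬ j < k := fun h => hk' (Finset.mem_Ioi.2 h)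
        have h2 : j ≠ k := (Finset.ne_of_mem_erase hk).symm
        simp [h1, h2]
  rw [e1, e2, e3]
  ring

/-- Grouping the rows in twos makes a determinant a polarised Pfaffian with one rank-one factor for
each pair of rows. -/
lemma det_eq_pfSum {K : Type*} [Fintype K] [DecidableEq K]
    (u : K × Fin 2 → K × Fin 2 → ℂ) :
    (Matrix.of fun j i => u i j).det = pfSum fun k a b => u (k, 0) a * u (k, 1) b := by
  rw [Matrix.det_apply']
  unfold pfSum
  refine Finset.sum_congr rfl fun σ _ => ?_
  rw [Fintype.prod_prod_type]
  simp [Fin.prod_univ_two]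

/-- Evaluation of `φ` at the point with the given pair index: at an `inr` pair the second functional
is the derivative at the first one. -/
def confluentEval (x : Fin (l * 2) → ℂ) (y : Fin M → ℂ) (i : (Fin l ⊕ Fin M) × Fin 2)
    (φ : Polynomial ℂ) : ℂ :=
  Sum.elim (fun k => φ.eval (x (finProdFinEquiv (k, i.2))))
    (fun k => if i.2 = 0 then φ.eval (y k) else φ.derivative.eval (y k)) i.1

/-- The confluent Vandermonde determinant. -/
theorem det_confluentEval (q : ℕ → Polynomial ℂ) (hq : ∀ j < 2 * (l + M), (q j).Monic)
    (hd : ∀ j < 2 * (l + M), (q j).natDegree = j) (x : Fin (l * 2) → ℂ) (y : Fin M → ℂ) :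
    pfSum (fun k a b => confluentEval x y (k, 0) (q (pairIndex l M a)) *
      confluentEval x y (k, 1) (q (pairIndex l M b))) =
      (∏ i, ∏ j ∈ Finset.Ioi i, (x j - x i)) * (∏ j, ∏ k ∈ Finset.Ioi j, (y k - y j) ^ 4) *
        ∏ i, ∏ k, (x i - y k) ^ 2 := by
  -- Each double point is split into `y k` and `y k + t`, with the second evaluation replaced by a
  -- divided difference that tends to the derivative as `t → 0`.
  set s : ℂ → (Fin l ⊕ Fin M) × Fin 2 → Polynomial ℂ → ℂ := fun t i φ =>
    Sum.elim (fun k => φ.eval (x (finProdFinEquiv (k, i.2))))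
      (fun k => if i.2 = 0 then φ.eval (y k) else t⁻¹ * (φ.eval (y k + t) - φ.eval (y k))) i.1 with hs
  have key : ∀ t : ℂ, t ≠ 0 →
      pfSum (fun k a b => s t (k, 0) (q (pairIndex l M a)) * s t (k, 1) (q (pairIndex l M b))) =
      (∏ i, ∏ j ∈ Finset.Ioi i, (x j - x i)) *
        (∏ j, ∏ k ∈ Finset.Ioi j, ((y k - y j) ^ 2 * (y k - y j + t) * (y k - y j - t))) *
        ∏ i, ∏ k, ((x i - y k) * (x i - y k - t)) := by
    intro t ht
    have h1 := det_eval_split_pairs q hq hd x y t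
    rw [det_eq_pfSum (fun i j => (q (pairIndex l M j)).eval
      (Sum.elim (fun k => x (finProdFinEquiv (k, i.2))) (fun k => y k + (i.2 : ℕ) * t) i.1))] at h1
    apply mul_left_cancel₀ (pow_ne_zero M ht)
    rw [← h1]
    have h2 : t ^ M = ∏ k : Fin l ⊕ Fin M, Sum.elim (fun _ => 1) (fun _ => t) k := by
      simp
    rw [h2, ← pfSum_smul]
    -- After antisymmetrisation the term `φ(y) ψ(y)`, by which `φ(y) (ψ(y+t) - ψ(y))` differs from
    -- `φ(y) ψ(y+t)`, drops out by symmetry.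
    apply mul_left_cancel₀ (pow_ne_zero (Fintype.card (Fin l ⊕ Fin M)) (two_ne_zero (α := ℂ)))
    rw [← pfSum_sub_swap, ← pfSum_sub_swap]
    congr 1
    funext k a b
    rcases k with k | k
    · simp [hs]
    · simp [hs]
      field_simp
      ring
  have hlim : Filter.Tendsto (fun t => pfSum (fun k a b => s t (k, 0) (q (pairIndex l M a)) *
      s t (k, 1) (q (pairIndex l M b)))) (nhdsWithin 0 {0}ᶜ)
      (nhds (pfSum (fun k a b => confluentEval x y (k, 0) (q (pairIndex l M a)) *
      confluentEval x y (k, 1) (q (pairIndex l M b))))) := by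
    have hs_lim : ∀ i φ, Filter.Tendsto (fun t => s t i φ) (nhdsWithin 0 {0}ᶜ)
        (nhds (confluentEval x y i φ)) := by
      rintro ⟨k | k, e⟩ φ
      · exact tendsto_const_nhds
      · fin_cases e
        · exact tendsto_const_nhds
        · have := (φ.hasDerivAt (y k)).tendsto_slope_zero
          simpa [hs, confluentEval] using this
    unfold pfSum
    refine tendsto_finsetSum _ fun σ _ => Filter.Tendsto.const_mul _ ?_
    exact tendsto_finsetProd _ fun k _ => (hs_lim _ _).mul (hs_lim _ _)
  have hc : Continuous fun t : ℂ => (∏ i, ∏ j ∈ Finset.Ioi i, (x j - x i)) *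
        (∏ j, ∏ k ∈ Finset.Ioi j, ((y k - y j) ^ 2 * (y k - y j + t) * (y k - y j - t))) *
        ∏ i, ∏ k, ((x i - y k) * (x i - y k - t)) := by fun_prop
  have h0 := (hc.tendsto 0).mono_left (nhdsWithin_le_nhds (s := {0}ᶜ))
  have h1 := hlim.congr' (by filter_upwards [self_mem_nhdsWithin] with t ht using key t ht)
  rw [tendsto_nhds_unique h1 h0]
  congr 1
  · congr 1
    refine Finset.prod_congr rfl fun j _ => Finset.prod_congr rfl fun k _ => ?_
    ring
  · refine Finset.prod_congr rfl fun j _ => Finset.prod_congr rfl fun k _ => ?_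
    ring

end ConfluentVandermonde

/-! ### Integrating the Boltzmann factor -/

section Integration

set_option linter.unusedSectionVars false

variable {l M : ℕ} {μ : Measure ℝ} [SigmaFinite μ]

/-- Grouping the coordinates of `Fin (l * 2) → ℝ` in consecutive pairs preserves the product
measure. -/
lemma exists_measurePreserving_pairs (μ : Measure ℝ) [SigmaFinite μ] (l : ℕ) :
    ∃ Φ : (Fin l → ℝ × ℝ) ≃ᵐ (Fin (l * 2) → ℝ),
      MeasurePreserving Φ (Measure.pi fun _ => μ.prod μ) (Measure.pi fun _ => μ) ∧
      ∀ z i, Φ z (finProdFinEquiv (i, 0)) = (z i).1 ∧ Φ z (finProdFinEquiv (i, 1)) = (z i).2 := by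
  let e : Fin l ⊕ Fin l ≃ Fin (l * 2) :=
    ((Equiv.boolProdEquivSum (Fin l)).symm.trans (Equiv.prodComm _ _)).trans
      ((Equiv.prodCongr (Equiv.refl _) finTwoEquiv.symm).trans finProdFinEquiv)
  have h1 := measurePreserving_arrowProdEquivProdArrow ℝ ℝ (Fin l) (fun _ => μ) (fun _ => μ)
  have h2 := measurePreserving_sumPiEquivProdPi_symm (X := fun _ : Fin l ⊕ Fin l => ℝ)
    (fun _ => μ)
  have h3 := measurePreserving_piCongrLeft (α := fun _ : Fin (l * 2) => ℝ) (fun _ => μ) e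
  refine ⟨((MeasurableEquiv.arrowProdEquivProdArrow ℝ ℝ (Fin l)).trans
    (MeasurableEquiv.sumPiEquivProdPi fun _ => ℝ).symm).trans
    (MeasurableEquiv.piCongrLeft (fun _ => ℝ) e), (h1.trans h2).trans h3, fun z i => ⟨?_, ?_⟩⟩
  · have h : finProdFinEquiv (i, (0 : Fin 2)) = e (Sum.inl i) := rfl
    rw [h]
    exact Equiv.piCongrLeft_apply_apply (fun _ => ℝ) e _ (Sum.inl i)
  · have h : finProdFinEquiv (i, (1 : Fin 2)) = e (Sum.inr i) := rfl
    rw [h]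
    exact Equiv.piCongrLeft_apply_apply (fun _ => ℝ) e _ (Sum.inr i)

lemma integrable_prod_pairs {g : Fin l → ℝ × ℝ → ℂ} {h : Fin M → ℝ → ℂ}
    (hg : ∀ i, Integrable (g i) (μ.prod μ)) (hh : ∀ k, Integrable (h k) μ) :
    Integrable (fun x : (Fin (l * 2) → ℝ) × (Fin M → ℝ) =>
      (∏ i, g i (x.1 (finProdFinEquiv (i, 0)), x.1 (finProdFinEquiv (i, 1)))) * ∏ k, h k (x.2 k))
      ((Measure.pi fun _ => μ).prod (Measure.pi fun _ => μ)) := by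
  obtain ⟨Φ, hΦ, hΦ'⟩ := exists_measurePreserving_pairs μ l
  have h1 : Integrable (fun x : Fin (l * 2) → ℝ =>
      ∏ i, g i (x (finProdFinEquiv (i, 0)), x (finProdFinEquiv (i, 1)))) (Measure.pi fun _ => μ) := by
    rw [← hΦ.integrable_comp_emb Φ.measurableEmbedding]
    have : ((fun x : Fin (l * 2) → ℝ =>
      ∏ i, g i (x (finProdFinEquiv (i, 0)), x (finProdFinEquiv (i, 1)))) ∘ Φ) =
      fun z => ∏ i, g i (z i) := by
      funext z
      simp only [Function.comp_apply, (hΦ' z _).1, (hΦ' z _).2]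
    rw [this]
    exact Integrable.fintype_prod hg
  exact h1.mul_prod (Integrable.fintype_prod hh)

lemma integral_prod_pairs (g : Fin l → ℝ × ℝ → ℂ) (h : Fin M → ℝ → ℂ) :
    ∫ x : (Fin (l * 2) → ℝ) × (Fin M → ℝ),
      (∏ i, g i (x.1 (finProdFinEquiv (i, 0)), x.1 (finProdFinEquiv (i, 1)))) * ∏ k, h k (x.2 k)
      ∂((Measure.pi fun _ => μ).prod (Measure.pi fun _ => μ)) =
      (∏ i, ∫ z, g i z ∂(μ.prod μ)) * ∏ k, ∫ y, h k y ∂μ := by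
  obtain ⟨Φ, hΦ, hΦ'⟩ := exists_measurePreserving_pairs μ l
  rw [integral_prod_mul (fun x : Fin (l * 2) → ℝ =>
      ∏ i, g i (x (finProdFinEquiv (i, 0)), x (finProdFinEquiv (i, 1))))
      (fun x : Fin M → ℝ => ∏ k, h k (x k)), integral_fintype_prod_eq_prod,
    ← hΦ.integral_comp Φ.measurableEmbedding]
  simp only [(hΦ' _ _).1, (hΦ' _ _).2]
  rw [integral_fintype_prod_eq_prod]

/-- The Boltzmann factor without the absolute values on the differences of the first species. -/
def signedBoltzmann (V₁ V₂ : ℝ → ℝ) (L M : ℕ) (α : Fin L → ℝ) (β : Fin M → ℝ) : ℝ :=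
  (Matrix.vandermonde α).det *
  (∏ j : Fin M, ∏ k ∈ Finset.Ioi j, (β k - β j) ^ 4) *
  (∏ j : Fin L, ∏ k : Fin M, (α j - β k) ^ 2) *
  (∏ j : Fin L, Real.exp (-V₁ (α j))) * (∏ k : Fin M, Real.exp (-2 * V₂ (β k)))

lemma real_sign_mul_self (r : ℝ) : Real.sign r * r = |r| := by
  rcases lt_trichotomy r 0 with h | rfl | h
  · rw [Real.sign_of_neg h, abs_of_neg h]; ring
  · simp
  · rw [Real.sign_of_pos h, abs_of_pos h]; ring

/-- All differences except those among the `α` carry even exponents, so one sign correction for the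
Vandermonde determinant suffices. -/
lemma boltzmann_eq (V₁ V₂ : ℝ → ℝ) (L M : ℕ) (α : Fin L → ℝ) (β : Fin M → ℝ) :
    boltzmann V₁ V₂ L M α β = signProd α * signedBoltzmann V₁ V₂ L M α β := by
  unfold boltzmann signedBoltzmann signProd
  simp only [← mul_assoc]
  rw [real_sign_mul_self, Matrix.det_vandermonde, Finset.abs_prod]
  simp only [Finset.abs_prod]
  have h4 : ∀ x : ℝ, |x| ^ 4 = x ^ 4 := fun x => Even.pow_abs (by decide) x
  simp only [sq_abs, h4]

lemma signedBoltzmann_comp_perm (V₁ V₂ : ℝ → ℝ) (L M : ℕ) (α : Fin L → ℝ) (β : Fin M → ℝ)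
    (π : Equiv.Perm (Fin L)) :
    signedBoltzmann V₁ V₂ L M (α ∘ π) β =
      ((Equiv.Perm.sign π : ℤ) : ℝ) * signedBoltzmann V₁ V₂ L M α β := by
  have h : (Matrix.vandermonde (α ∘ π)).det =
      ((Equiv.Perm.sign π : ℤ) : ℝ) * (Matrix.vandermonde α).det := by
    rw [← Matrix.det_permute]; rfl
  unfold signedBoltzmann
  rw [h]
  simp only [Function.comp_apply]
  rw [Equiv.prod_comp π (fun j => Real.exp (-V₁ (α j))),
    Equiv.prod_comp π (fun j => ∏ k : Fin M, (α j - β k) ^ 2)]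
  ring

/-- The weighted one-pair factors in the expansion of the Boltzmann factor. -/
def pairWeight (V : ℝ → ℝ) (φ ψ : Polynomial ℂ) (z : ℝ × ℝ) : ℂ :=
  φ.eval (z.1 : ℂ) * ψ.eval (z.2 : ℂ) * (Real.exp (-V z.1 - V z.2) : ℂ)

/-- The weighted one-point factors in the expansion of the Boltzmann factor. -/
def pointWeight (V : ℝ → ℝ) (φ ψ : Polynomial ℂ) (y : ℝ) : ℂ :=
  φ.eval (y : ℂ) * ψ.derivative.eval (y : ℂ) * (Real.exp (-2 * V y) : ℂ)

/-- Expanding the confluent Vandermonde determinant separates the variables: each term is a product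
of functions of disjoint pairs of `α`'s and of single `β`'s, as Fubini's theorem requires. -/
lemma signedBoltzmann_expand (V₁ V₂ : ℝ → ℝ) (q : ℕ → Polynomial ℂ)
    (hq : ∀ j < 2 * (l + M), (q j).Monic) (hd : ∀ j < 2 * (l + M), (q j).natDegree = j)
    (α : Fin (l * 2) → ℝ) (β : Fin M → ℝ) :
    (signedBoltzmann V₁ V₂ (l * 2) M α β : ℂ) =
      ∑ σ : Equiv.Perm ((Fin l ⊕ Fin M) × Fin 2), ((Equiv.Perm.sign σ : ℤ) : ℂ) *
        ((∏ i, pairWeight V₁ (q (pairIndex l M (σ (Sum.inl i, 0))))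
            (q (pairIndex l M (σ (Sum.inl i, 1))))
            (α (finProdFinEquiv (i, 0)), α (finProdFinEquiv (i, 1)))) *
          ∏ k, pointWeight V₂ (q (pairIndex l M (σ (Sum.inr k, 0))))
            (q (pairIndex l M (σ (Sum.inr k, 1)))) (β k)) := by
  have h := det_confluentEval q hq hd (fun i => (α i : ℂ)) (fun k => (β k : ℂ))
  unfold signedBoltzmann
  rw [Matrix.det_vandermonde]
  push_cast
  rw [← h]
  have he : ∏ j : Fin (l * 2), Complex.exp (-(V₁ (α j) : ℂ)) =
      ∏ i : Fin l, Complex.exp (-(V₁ (α (finProdFinEquiv (i, 0))) : ℂ) -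
        (V₁ (α (finProdFinEquiv (i, 1))) : ℂ)) := by
    rw [← Equiv.prod_comp finProdFinEquiv, Fintype.prod_prod_type]
    refine Finset.prod_congr rfl fun i _ => ?_
    rw [Fin.prod_univ_two, ← Complex.exp_add]
    ring_nf
  rw [he]
  unfold pfSum
  rw [Finset.sum_mul, Finset.sum_mul]
  refine Finset.sum_congr rfl fun σ _ => ?_
  rw [mul_assoc, mul_assoc, Fintype.prod_sum_type]
  congr 1
  simp only [pairWeight, pointWeight, confluentEval, Sum.elim_inl, Sum.elim_inr,
    Finset.prod_mul_distrib, if_true, one_ne_zero, if_false]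
  push_cast
  ring

lemma integrable_eval_mul {w : ℝ → ℝ} {n : ℕ}
    (hw : ∀ k < n, Integrable (fun x => x ^ k * w x) μ) (φ : Polynomial ℂ)
    (hφ : φ.natDegree < n) : Integrable (fun x : ℝ => φ.eval (x : ℂ) * (w x : ℂ)) μ := by
  simp only [Polynomial.eval_eq_sum_range, Finset.sum_mul]
  refine integrable_finsetSum _ fun k hk => ?_
  have h1 := ((hw k (by have := Finset.mem_range.1 hk; omega)).ofReal (𝕜 := ℂ)).const_mul (φ.coeff k)
  refine h1.congr (Filter.Eventually.of_forall fun x => ?_)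
  simp
  ring

lemma integrable_pairWeight {V : ℝ → ℝ} {n : ℕ}
    (hV : ∀ k < n, Integrable (fun x => x ^ k * Real.exp (-V x)) μ) {φ ψ : Polynomial ℂ}
    (hφ : φ.natDegree < n) (hψ : ψ.natDegree < n) : Integrable (pairWeight V φ ψ) (μ.prod μ) := by
  refine ((integrable_eval_mul hV φ hφ).mul_prod (integrable_eval_mul hV ψ hψ)).congr
    (Filter.Eventually.of_forall fun z => ?_)
  simp only [pairWeight, sub_eq_add_neg, Real.exp_add]
  push_cast
  ring

lemma integrable_pointWeight {V : ℝ → ℝ} {n : ℕ}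
    (hV : ∀ k < n, Integrable (fun x => x ^ k * Real.exp (-2 * V x)) μ) {φ ψ : Polynomial ℂ}
    (h : (φ * ψ.derivative).natDegree < n) : Integrable (pointWeight V φ ψ) μ := by
  refine (integrable_eval_mul hV (φ * ψ.derivative) h).congr (Filter.Eventually.of_forall fun z => ?_)
  simp [pointWeight]

lemma measurable_real_sign : Measurable Real.sign := by
  unfold Real.sign
  exact Measurable.ite measurableSet_Iio measurable_const
    (Measurable.ite measurableSet_Ioi measurable_const measurable_const)

lemma norm_real_sign_le (r : ℝ) : ‖(Real.sign r : ℂ)‖ ≤ 1 := by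
  rcases Real.sign_apply_eq r with h | h | h <;> simp [h]

lemma integrable_pairWeight_sign {V : ℝ → ℝ} {φ ψ : Polynomial ℂ}
    (h : Integrable (pairWeight V φ ψ) (μ.prod μ)) :
    Integrable (fun z : ℝ × ℝ => (Real.sign (z.2 - z.1) : ℂ) * pairWeight V φ ψ z) (μ.prod μ) := by
  refine h.bdd_mul (c := 1) ?_ (Filter.Eventually.of_forall fun z => norm_real_sign_le _)
  exact (Complex.measurable_ofReal.comp
    (measurable_real_sign.comp (measurable_snd.sub measurable_fst))).aestronglyMeasurable

lemma skewOne_eq (V : ℝ → ℝ) (φ ψ : Polynomial ℂ) :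
    2 * skewOne μ V φ ψ =
      ∫ z : ℝ × ℝ, (Real.sign (z.2 - z.1) : ℂ) * pairWeight V φ ψ z ∂(μ.prod μ) := by
  unfold skewOne
  rw [← mul_assoc, mul_one_div_cancel two_ne_zero, one_mul]
  congr 1
  funext z
  simp only [pairWeight]
  push_cast
  ring

lemma skewOne_swap (V : ℝ → ℝ) (φ ψ : Polynomial ℂ) :
    skewOne μ V ψ φ = -skewOne μ V φ ψ := by
  have h : 2 * skewOne μ V ψ φ = -(2 * skewOne μ V φ ψ) := by
    rw [skewOne_eq, skewOne_eq, ← integral_prod_swap, ← integral_neg]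
    congr 1
    funext z
    simp only [pairWeight, Prod.fst_swap, Prod.snd_swap]
    rw [← neg_sub, Real.sign_neg, show -V z.2 - V z.1 = -V z.1 - V z.2 by ring]
    push_cast
    ring
  linear_combination h / 2

/-- A permutation never places one index twice in a pair. The diagonal entries must indeed be
avoided: with `q` of top degree, `∫ q q' e^{-2V₂}` involves a moment that is not assumed to exist.
-/
lemma pfSum_congr {K : Type*} [Fintype K] [DecidableEq K]
    {A B : K → K × Fin 2 → K × Fin 2 → ℂ} (h : ∀ k a b, a ≠ b → A k a b = B k a b) :
    pfSum A = pfSum B := by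
  unfold pfSum
  refine Finset.sum_congr rfl fun σ _ => ?_
  congr 1
  refine Finset.prod_congr rfl fun k _ => h _ _ _ ?_
  simp

variable {V₁ V₂ : ℝ → ℝ} {q : ℕ → Polynomial ℂ}

/-- Two distinct degrees below `2N` add up to at most `4N - 3`, and the derivative lowers this to
`4N - 4`: the last moment of `e^{-2V₂}` that is assumed. -/
lemma natDegree_mul_derivative_lt {N : ℕ} (hd : ∀ j < 2 * N, (q j).natDegree = j) {a b : ℕ}
    (ha : a < 2 * N) (hb : b < 2 * N) (hab : a ≠ b) :
    (q a * (q b).derivative).natDegree < 4 * N - 3 := by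
  rcases Nat.eq_zero_or_pos b with rfl | hb0
  · rw [Polynomial.derivative_of_natDegree_zero (hd 0 hb), mul_zero, Polynomial.natDegree_zero]
    omega
  refine Polynomial.natDegree_mul_le.trans_lt ?_
  have h := Polynomial.natDegree_derivative_le (q b)
  rw [hd b hb] at h
  rw [hd a ha]
  omega

/-- The expansion of the signed Boltzmann factor is a sum of integrable functions. -/
lemma integrable_expansion_term
    (hV₁ : ∀ k < 2 * (l + M), Integrable (fun x => x ^ k * Real.exp (-V₁ x)) μ)
    (hV₂ : ∀ k, k + 4 ≤ 4 * (l + M) → Integrable (fun x => x ^ k * Real.exp (-2 * V₂ x)) μ)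
    (hd : ∀ j < 2 * (l + M), (q j).natDegree = j)
    (σ : Equiv.Perm ((Fin l ⊕ Fin M) × Fin 2)) :
    (∀ i, Integrable (pairWeight V₁ (q (pairIndex l M (σ (Sum.inl i, 0))))
            (q (pairIndex l M (σ (Sum.inl i, 1))))) (μ.prod μ)) ∧
    ∀ k, Integrable (pointWeight V₂ (q (pairIndex l M (σ (Sum.inr k, 0))))
            (q (pairIndex l M (σ (Sum.inr k, 1))))) μ := by
  have hlt : ∀ a, (pairIndex l M a : ℕ) < 2 * (l + M) := fun a => by
    have := (pairIndex l M a).2; omega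
  refine ⟨fun i => integrable_pairWeight hV₁ ?_ ?_, fun k => integrable_pointWeight
    (n := 4 * (l + M) - 3) (fun k hk => hV₂ k (by omega)) ?_⟩
  · rw [hd _ (hlt _)]; exact hlt _
  · rw [hd _ (hlt _)]; exact hlt _
  · refine natDegree_mul_derivative_lt hd (hlt _) (hlt _) fun h => ?_
    have := σ.injective ((pairIndex l M).injective (Fin.ext h))
    simp at this

lemma integrable_signedBoltzmann
    (hV₁ : ∀ k < 2 * (l + M), Integrable (fun x => x ^ k * Real.exp (-V₁ x)) μ)
    (hV₂ : ∀ k, k + 4 ≤ 4 * (l + M) → Integrable (fun x => x ^ k * Real.exp (-2 * V₂ x)) μ) :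
    Integrable (fun x : (Fin (l * 2) → ℝ) × (Fin M → ℝ) =>
      (signedBoltzmann V₁ V₂ (l * 2) M x.1 x.2 : ℂ))
      ((Measure.pi fun _ => μ).prod (Measure.pi fun _ => μ)) := by
  -- The integrand does not depend on the basis, so monomials serve.
  have hd : ∀ j < 2 * (l + M), ((Polynomial.X : Polynomial ℂ) ^ j).natDegree = j := by simp
  have hm : ∀ j < 2 * (l + M), ((Polynomial.X : Polynomial ℂ) ^ j).Monic := fun j _ =>
    Polynomial.monic_X_pow j
  simp only [signedBoltzmann_expand V₁ V₂ (fun j => Polynomial.X ^ j) hm hd]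
  refine integrable_finsetSum _ fun σ _ => Integrable.const_mul ?_ _
  obtain ⟨h1, h2⟩ := integrable_expansion_term hV₁ hV₂ hd σ
  exact integrable_prod_pairs h1 h2

lemma measurable_signProd {n : ℕ} : Measurable (signProd : (Fin n → ℝ) → ℝ) := by
  unfold signProd
  refine measurable_real_sign.comp ?_
  simp only [Matrix.det_vandermonde]
  fun_prop

lemma measurable_signMatrix (a b : Fin l × Fin 2) :
    Measurable fun α : Fin (l * 2) → ℝ => signMatrix α a b := by
  have h : Measurable fun α : Fin (l * 2) → ℝ => α (finProdFinEquiv b) - α (finProdFinEquiv a) := by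
    fun_prop
  exact Complex.measurable_ofReal.comp (measurable_real_sign.comp h)

lemma integrable_boltzmann
    (hV₁ : ∀ k < 2 * (l + M), Integrable (fun x => x ^ k * Real.exp (-V₁ x)) μ)
    (hV₂ : ∀ k, k + 4 ≤ 4 * (l + M) → Integrable (fun x => x ^ k * Real.exp (-2 * V₂ x)) μ) :
    Integrable (fun x : (Fin (l * 2) → ℝ) × (Fin M → ℝ) => boltzmann V₁ V₂ (l * 2) M x.1 x.2)
      ((Measure.pi fun _ => μ).prod (Measure.pi fun _ => μ)) := by
  have hm : Measurable fun x : (Fin (l * 2) → ℝ) × (Fin M → ℝ) => (signProd x.1 : ℂ) :=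
    Complex.measurable_ofReal.comp (measurable_signProd.comp measurable_fst)
  have hb : ∀ x : (Fin (l * 2) → ℝ) × (Fin M → ℝ), ‖(signProd x.1 : ℂ)‖ ≤ 1 := fun x =>
    norm_real_sign_le _
  have h := (integrable_signedBoltzmann hV₁ hV₂).bdd_mul hm.aestronglyMeasurable
    (Filter.Eventually.of_forall hb)
  refine h.re.congr (Filter.Eventually.of_forall fun x => ?_)
  simp only [boltzmann_eq, RCLike.re_to_complex]
  rw [← Complex.ofReal_mul, Complex.ofReal_re]

theorem partitionConverges_of_integrable {N : ℕ}
    (hV₁ : ∀ k < 2 * N, Integrable (fun x => x ^ k * Real.exp (-V₁ x)) μ)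
    (hV₂ : ∀ k, k + 4 ≤ 4 * N → Integrable (fun x => x ^ k * Real.exp (-2 * V₂ x)) μ) :
    PartitionConverges μ V₁ V₂ N := by
  intro L M h
  -- Charge conservation forces `L` to be even, so the charges `+1` can be paired.
  obtain ⟨l, rfl⟩ : ∃ l, L = l * 2 := ⟨N - M, by omega⟩
  obtain rfl : N = l + M := by omega
  exact integrable_boltzmann hV₁ hV₂

/-- Integrating out the signs: every term in the Pfaffian of signs contributes equally. -/
lemma integral_boltzmann_symm
    (hV₁ : ∀ k < 2 * (l + M), Integrable (fun x => x ^ k * Real.exp (-V₁ x)) μ)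
    (hV₂ : ∀ k, k + 4 ≤ 4 * (l + M) → Integrable (fun x => x ^ k * Real.exp (-2 * V₂ x)) μ) :
    2 ^ l * (l.factorial : ℂ) * ∫ x : (Fin (l * 2) → ℝ) × (Fin M → ℝ),
      (boltzmann V₁ V₂ (l * 2) M x.1 x.2 : ℂ)
        ∂((Measure.pi fun _ => μ).prod (Measure.pi fun _ => μ)) =
    ((l * 2).factorial : ℂ) * ∫ x : (Fin (l * 2) → ℝ) × (Fin M → ℝ),
      (∏ i, signMatrix x.1 (i, 0) (i, 1)) * (signedBoltzmann V₁ V₂ (l * 2) M x.1 x.2 : ℂ)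
        ∂((Measure.pi fun _ => μ).prod (Measure.pi fun _ => μ)) := by
  have hint : ∀ π : Equiv.Perm (Fin l × Fin 2), Integrable
      (fun x : (Fin (l * 2) → ℝ) × (Fin M → ℝ) => (∏ i, signMatrix x.1 (π (i, 0)) (π (i, 1))) *
        (signedBoltzmann V₁ V₂ (l * 2) M x.1 x.2 : ℂ))
      ((Measure.pi fun _ => μ).prod (Measure.pi fun _ => μ)) := fun π => by
    have hm : Measurable fun x : (Fin (l * 2) → ℝ) × (Fin M → ℝ) =>
        ∏ i, signMatrix x.1 (π (i, 0)) (π (i, 1)) :=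
      Finset.measurable_prod _ fun i _ => (measurable_signMatrix _ _).comp measurable_fst
    have hb : ∀ x : (Fin (l * 2) → ℝ) × (Fin M → ℝ),
        ‖∏ i, signMatrix x.1 (π (i, 0)) (π (i, 1))‖ ≤ 1 := fun x => by
      rw [norm_prod]
      exact Finset.prod_le_one (fun i _ => norm_nonneg _) fun i _ => norm_real_sign_le _
    exact (integrable_signedBoltzmann hV₁ hV₂).bdd_mul hm.aestronglyMeasurable
      (Filter.Eventually.of_forall hb)
  -- Relabelling the `α`'s by `π` reduces the term of `π` to that of the identity. The antisymmetry
  -- of the signed Boltzmann factor produces `sign π`, which cancels the sign in the Pfaffian, so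
  -- all `(2l)!` terms agree.
  have hperm : ∀ π : Equiv.Perm (Fin l × Fin 2),
      ∫ x : (Fin (l * 2) → ℝ) × (Fin M → ℝ), (∏ i, signMatrix x.1 (π (i, 0)) (π (i, 1))) *
        (signedBoltzmann V₁ V₂ (l * 2) M x.1 x.2 : ℂ)
        ∂((Measure.pi fun _ => μ).prod (Measure.pi fun _ => μ)) =
      ((Equiv.Perm.sign π : ℤ) : ℂ) * ∫ x : (Fin (l * 2) → ℝ) × (Fin M → ℝ),
        (∏ i, signMatrix x.1 (i, 0) (i, 1)) * (signedBoltzmann V₁ V₂ (l * 2) M x.1 x.2 : ℂ)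
        ∂((Measure.pi fun _ => μ).prod (Measure.pi fun _ => μ)) := fun π => by
    set p : Equiv.Perm (Fin (l * 2)) := finProdFinEquiv.permCongr π with hp
    have hmp := (measurePreserving_piCongrLeft (α := fun _ : Fin (l * 2) => ℝ)
      (fun _ => μ) p).prod (MeasurePreserving.id (Measure.pi fun _ : Fin M => μ))
    have hemb : MeasurableEmbedding (Prod.map (MeasurableEquiv.piCongrLeft
        (fun _ : Fin (l * 2) => ℝ) p) (id : (Fin M → ℝ) → (Fin M → ℝ))) :=
      ((MeasurableEquiv.piCongrLeft (fun _ : Fin (l * 2) => ℝ) p).prodCongr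
        (MeasurableEquiv.refl _)).measurableEmbedding
    rw [← hmp.integral_comp hemb, ← integral_const_mul]
    congr 1
    funext x
    have hx : MeasurableEquiv.piCongrLeft (fun _ : Fin (l * 2) => ℝ) p x.1 = x.1 ∘ ⇑(p⁻¹) := by
      funext i
      obtain ⟨j, rfl⟩ := p.surjective i
      have hj : (⇑(p⁻¹)) (p j) = j := p.symm_apply_apply j
      rw [Function.comp_apply, hj]
      exact Equiv.piCongrLeft_apply_apply (fun _ : Fin (l * 2) => ℝ) p x.1 j
    simp only [Prod.map_fst, Prod.map_snd, hx, id]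
    rw [signedBoltzmann_comp_perm, Equiv.Perm.sign_inv]
    have hs : Equiv.Perm.sign p = Equiv.Perm.sign π := Equiv.Perm.sign_permCongr _ _
    have hS : ∀ a b, signMatrix (x.1 ∘ ⇑(p⁻¹)) (π a) (π b) = signMatrix x.1 a b := by
      intro a b
      have : ∀ c, p⁻¹ (finProdFinEquiv (π c)) = finProdFinEquiv c := fun c => by
        rw [Equiv.Perm.inv_eq_iff_eq, hp, Equiv.permCongr_apply, Equiv.symm_apply_apply]
      simp only [signMatrix, Function.comp_apply, this]
    simp only [hS, hs]
    push_cast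
    ring
  have h1 : ∀ x : (Fin (l * 2) → ℝ) × (Fin M → ℝ),
      2 ^ l * (l.factorial : ℂ) * (boltzmann V₁ V₂ (l * 2) M x.1 x.2 : ℂ) =
      ∑ π : Equiv.Perm (Fin l × Fin 2), ((Equiv.Perm.sign π : ℤ) : ℂ) *
        ((∏ i, signMatrix x.1 (π (i, 0)) (π (i, 1))) *
          (signedBoltzmann V₁ V₂ (l * 2) M x.1 x.2 : ℂ)) := by
    intro x
    rw [boltzmann_eq]
    push_cast
    rw [← mul_assoc, ← pfSum_signMatrix]
    unfold pfSum
    rw [Finset.sum_mul]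
    exact Finset.sum_congr rfl fun π _ => by ring
  rw [← integral_const_mul]
  simp_rw [h1]
  rw [integral_finsetSum _ fun π _ => (hint π).const_mul _]
  simp_rw [integral_const_mul, hperm]
  have h2 : ∀ π : Equiv.Perm (Fin l × Fin 2), ∀ c : ℂ,
      ((Equiv.Perm.sign π : ℤ) : ℂ) * (((Equiv.Perm.sign π : ℤ) : ℂ) * c) = c := by
    intro π c
    rw [← mul_assoc, ← Int.cast_mul, ← Units.val_mul, Int.units_mul_self]; simp
  simp_rw [h2]
  rw [Finset.sum_const, Finset.card_univ, Fintype.card_perm]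
  simp

/-- The partition function of the two species as a polarised Pfaffian. -/
theorem fixedPartition_eq_pfSum
    (hV₁ : ∀ k < 2 * (l + M), Integrable (fun x => x ^ k * Real.exp (-V₁ x)) μ)
    (hV₂ : ∀ k, k + 4 ≤ 4 * (l + M) → Integrable (fun x => x ^ k * Real.exp (-2 * V₂ x)) μ)
    (hq : ∀ j < 2 * (l + M), (q j).Monic) (hd : ∀ j < 2 * (l + M), (q j).natDegree = j) :
    (l.factorial * M.factorial : ℂ) * (fixedPartition μ V₁ V₂ (l * 2) M : ℂ) =
      pfSum (fun (k : Fin l ⊕ Fin M) a b => Sum.elim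
        (fun _ => skewOne μ V₁ (q (pairIndex l M a)) (q (pairIndex l M b)))
        (fun _ => skewFour μ V₂ (q (pairIndex l M a)) (q (pairIndex l M b))) k) := by
  have h1 := integral_boltzmann_symm hV₁ hV₂
  set H : Fin l ⊕ Fin M → (Fin l ⊕ Fin M) × Fin 2 → (Fin l ⊕ Fin M) × Fin 2 → ℂ :=
    fun k a b => Sum.elim
        (fun _ => 2 * skewOne μ V₁ (q (pairIndex l M a)) (q (pairIndex l M b)))
        (fun _ => ∫ y, pointWeight V₂ (q (pairIndex l M a)) (q (pairIndex l M b)) y ∂μ) k with hH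
  have h2 : ∫ x : (Fin (l * 2) → ℝ) × (Fin M → ℝ),
      (∏ i, signMatrix x.1 (i, 0) (i, 1)) * (signedBoltzmann V₁ V₂ (l * 2) M x.1 x.2 : ℂ)
        ∂((Measure.pi fun _ => μ).prod (Measure.pi fun _ => μ)) = pfSum H := by
    have h3 : ∀ x : (Fin (l * 2) → ℝ) × (Fin M → ℝ),
        (∏ i, signMatrix x.1 (i, 0) (i, 1)) * (signedBoltzmann V₁ V₂ (l * 2) M x.1 x.2 : ℂ) =
        ∑ σ : Equiv.Perm ((Fin l ⊕ Fin M) × Fin 2), ((Equiv.Perm.sign σ : ℤ) : ℂ) *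
        ((∏ i, (fun z : ℝ × ℝ => (Real.sign (z.2 - z.1) : ℂ) *
            pairWeight V₁ (q (pairIndex l M (σ (Sum.inl i, 0))))
            (q (pairIndex l M (σ (Sum.inl i, 1)))) z)
            (x.1 (finProdFinEquiv (i, 0)), x.1 (finProdFinEquiv (i, 1)))) *
          ∏ k, pointWeight V₂ (q (pairIndex l M (σ (Sum.inr k, 0))))
            (q (pairIndex l M (σ (Sum.inr k, 1)))) (x.2 k)) := by
      intro x
      rw [signedBoltzmann_expand V₁ V₂ q hq hd, Finset.mul_sum]
      refine Finset.sum_congr rfl fun σ _ => ?_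
      rw [Finset.prod_mul_distrib]
      simp only [signMatrix]
      ring
    rw [integral_congr_ae (Filter.Eventually.of_forall h3), integral_finsetSum]
    · unfold pfSum
      refine Finset.sum_congr rfl fun σ _ => ?_
      rw [integral_const_mul, Fintype.prod_sum_type]
      simp only [hH, Sum.elim_inl, Sum.elim_inr, skewOne_eq]
      rw [← integral_prod_pairs (fun i z => (Real.sign (z.2 - z.1) : ℂ) *
            pairWeight V₁ (q (pairIndex l M (σ (Sum.inl i, 0))))
            (q (pairIndex l M (σ (Sum.inl i, 1)))) z)]
    · intro σ _
      obtain ⟨i1, i2⟩ := integrable_expansion_term hV₁ hV₂ hd σ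
      exact (integrable_prod_pairs (fun i => integrable_pairWeight_sign (i1 i)) i2).const_mul _
  rw [h2] at h1
  -- Antisymmetrising all factors costs `2 ^ (l + M)`. It turns `2 ⟨·,·⟩₁` into `4 ⟨·,·⟩₁` on the
  -- first `l` factors and `∫ φ ψ'` into `2 ⟨·,·⟩₄` on the others.
  have h4 : (2 : ℂ) ^ (l + M) * pfSum H = 2 ^ l * 2 ^ (l + M) *
      pfSum (fun (k : Fin l ⊕ Fin M) a b => Sum.elim
        (fun _ => skewOne μ V₁ (q (pairIndex l M a)) (q (pairIndex l M b)))
        (fun _ => skewFour μ V₂ (q (pairIndex l M a)) (q (pairIndex l M b))) k) := by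
    have h5 := pfSum_sub_swap H
    rw [Fintype.card_sum, Fintype.card_fin, Fintype.card_fin] at h5
    rw [← h5]
    have h6 : (2 : ℂ) ^ l * 2 ^ (l + M) =
        ∏ k : Fin l ⊕ Fin M, Sum.elim (fun _ => 4) (fun _ => 2) k := by
      simp only [Fintype.prod_sum_type, Sum.elim_inl, Sum.elim_inr, Finset.prod_const,
        Finset.card_univ, Fintype.card_fin]
      rw [pow_add, ← mul_assoc, ← mul_pow]
      norm_num
    rw [h6, ← pfSum_smul]
    refine pfSum_congr fun k a b hab => ?_
    rcases k with k | k
    · simp only [hH, Sum.elim_inl]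
      rw [skewOne_swap V₁ (q (pairIndex l M a)) (q (pairIndex l M b))]
      ring
    · simp only [hH, Sum.elim_inr]
      have hlt : ∀ a, (pairIndex l M a : ℕ) < 2 * (l + M) := fun a => by
        have := (pairIndex l M a).2; omega
      have hi : ∀ a b, a ≠ b → Integrable
          (pointWeight V₂ (q (pairIndex l M a)) (q (pairIndex l M b))) μ := fun a b hab =>
        integrable_pointWeight (n := 4 * (l + M) - 3) (fun k hk => hV₂ k (by omega))
          (natDegree_mul_derivative_lt hd (hlt a) (hlt b) fun h => hab
            ((pairIndex l M).injective (Fin.ext h)))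
      rw [← integral_sub (hi a b hab) (hi b a hab.symm), skewFour, ← mul_assoc,
        mul_one_div_cancel two_ne_zero, one_mul]
      congr 1
      funext y
      simp only [pointWeight]
      ring
  have h7 : (fixedPartition μ V₁ V₂ (l * 2) M : ℂ) = 1 / (((l * 2).factorial : ℂ) * M.factorial) *
      ∫ x : (Fin (l * 2) → ℝ) × (Fin M → ℝ), (boltzmann V₁ V₂ (l * 2) M x.1 x.2 : ℂ)
        ∂((Measure.pi fun _ => μ).prod (Measure.pi fun _ => μ)) := by
    unfold fixedPartition
    rw [integral_complex_ofReal]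
    push_cast
    rfl
  rw [h7]
  have hp : pfSum H = 2 ^ l * pfSum (fun (k : Fin l ⊕ Fin M) a b => Sum.elim
        (fun _ => skewOne μ V₁ (q (pairIndex l M a)) (q (pairIndex l M b)))
        (fun _ => skewFour μ V₂ (q (pairIndex l M a)) (q (pairIndex l M b))) k) := by
    apply mul_left_cancel₀ (pow_ne_zero (l + M) (two_ne_zero (α := ℂ)))
    rw [h4]; ring
  rw [hp] at h1
  have n1 : ((l * 2).factorial : ℂ) ≠ 0 := Nat.cast_ne_zero.2 (Nat.factorial_ne_zero _)
  have n2 : (M.factorial : ℂ) ≠ 0 := Nat.cast_ne_zero.2 (Nat.factorial_ne_zero _)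
  have n3 : (2 : ℂ) ^ l ≠ 0 := pow_ne_zero _ two_ne_zero
  have aux : ∀ I P : ℂ, 2 ^ l * (l.factorial : ℂ) * I = ((l * 2).factorial : ℂ) * (2 ^ l * P) →
      (l.factorial * M.factorial : ℂ) * (1 / (((l * 2).factorial : ℂ) * M.factorial) * I) = P := by
    intro I P h
    have h8 : (l.factorial : ℂ) * I = ((l * 2).factorial : ℂ) * P :=
      mul_left_cancel₀ n3 (by linear_combination h)
    field_simp
    linear_combination h8
  exact aux _ _ h1

end Integration

/-! ### The grand canonical sum: Pfaffian, determinant, continuant -/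

section GrandPartition

set_option linter.unusedSectionVars false

/-- The signed sum of a product of entries of `A` at the pairs in `S` and of `B` elsewhere. -/
def mixedPfSum {N : ℕ} (A B : ℕ → ℕ → ℂ) (S : Finset (Fin N)) : ℂ :=
  pfSum fun (k : Fin N) a b => if k ∈ S then A (finProdFinEquiv a) (finProdFinEquiv b)
    else B (finProdFinEquiv a) (finProdFinEquiv b)

/-- A permutation of the pairs moves `S` onto the first `l` of them, so only the cardinality of `S`
counts. -/
lemma mixedPfSum_eq {l M : ℕ} (A B : ℕ → ℕ → ℂ) (S : Finset (Fin (l + M))) (hS : S.card = l) :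
    mixedPfSum A B S = pfSum (fun (k : Fin l ⊕ Fin M) a b => Sum.elim
        (fun _ => A (pairIndex l M a) (pairIndex l M b))
        (fun _ => B (pairIndex l M a) (pairIndex l M b)) k) := by
  have hSc : Sᶜ.card = M := by rw [Finset.card_compl, hS, Fintype.card_fin]; omega
  set e := finSumEquivOfFinset hS hSc with he
  rw [mixedPfSum, ← pfSum_perm_index (finSumFinEquiv.symm.trans e), ← pfSum_reindex finSumFinEquiv]
  refine pfSum_congr fun k a b _ => ?_
  rcases k with k | k
  · have h : (finSumFinEquiv.symm.trans e) (finSumFinEquiv (Sum.inl k : Fin l ⊕ Fin M)) ∈ S := by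
      simp [he]
    rw [if_pos h]
    rfl
  · have h : (finSumFinEquiv.symm.trans e) (finSumFinEquiv (Sum.inr k : Fin l ⊕ Fin M)) ∉ S := by
      rw [Equiv.trans_apply, Equiv.symm_apply_apply, he, finSumEquivOfFinset_inr,
        ← Finset.mem_compl]
      exact Finset.orderEmbOfFin_mem _ _ _
    rw [if_neg h]
    rfl

/-- Multilinearity in the factors: `S` collects the factors from which `c * A` is chosen. -/
lemma pfSum_add_eq_sum_mixed {N : ℕ} (c : ℂ) (A B : ℕ → ℕ → ℂ) :
    pfSum (fun (_ : Fin N) a b => c * A (finProdFinEquiv a) (finProdFinEquiv b) +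
      B (finProdFinEquiv a) (finProdFinEquiv b)) =
    ∑ S ∈ (Finset.univ : Finset (Fin N)).powerset, c ^ S.card * mixedPfSum A B S := by
  unfold mixedPfSum pfSum
  simp_rw [Finset.mul_sum]
  rw [Finset.sum_comm]
  refine Finset.sum_congr rfl fun σ _ => ?_
  rw [Finset.prod_add, Finset.mul_sum]
  refine Finset.sum_congr rfl fun S hS => ?_
  rw [Finset.prod_mul_distrib, Finset.prod_const, Finset.prod_ite, Finset.filter_mem_eq_inter,
    Finset.univ_inter]
  have : Finset.univ.filter (fun k => k ∉ S) = Finset.univ \ S := by ext; simp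
  rw [this]
  ring

lemma pfSum_add_eq_sum_range {N : ℕ} (c : ℂ) (A B : ℕ → ℕ → ℂ) (G : ℕ → ℂ)
    (hG : ∀ S : Finset (Fin N), mixedPfSum A B S = G S.card) :
    pfSum (fun (_ : Fin N) a b => c * A (finProdFinEquiv a) (finProdFinEquiv b) +
      B (finProdFinEquiv a) (finProdFinEquiv b)) =
    ∑ l ∈ Finset.range (N + 1), (N.choose l : ℂ) * (c ^ l * G l) := by
  rw [pfSum_add_eq_sum_mixed]
  simp_rw [hG]
  rw [Finset.sum_powerset_apply_card (fun l => c ^ l * G l)]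
  simp

variable {μ : Measure ℝ} [SigmaFinite μ] {V₁ V₂ : ℝ → ℝ} {q : ℕ → Polynomial ℂ}

lemma grandPartition_eq_sum_range (μ : Measure ℝ) (V₁ V₂ : ℝ → ℝ) (N : ℕ) (X : ℂ) :
    grandPartition μ V₁ V₂ N X = ∑ l ∈ Finset.range (N + 1),
      X ^ (l * 2) * (fixedPartition μ V₁ V₂ (l * 2) (N - l) : ℂ) := by
  unfold grandPartition
  symm
  refine Finset.sum_bij (fun l _ => (l * 2, N - l)) ?_ ?_ ?_ ?_
  · intro l hl
    have := Finset.mem_range.1 hl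
    simp only [Finset.mem_filter, Finset.mem_product, Finset.mem_range]
    omega
  · intro l _ l' _ h
    have := congrArg Prod.fst h
    simp only at this
    omega
  · rintro ⟨L, M⟩ h
    simp only [Finset.mem_filter, Finset.mem_product, Finset.mem_range] at h
    refine ⟨N - M, Finset.mem_range.2 (by omega), ?_⟩
    ext <;> simp only <;> omega
  · intro l _
    rfl

/-- The grand canonical partition function as a Pfaffian. -/
theorem grandPartition_eq_pfSum {N : ℕ} (X : ℂ)
    (hV₁ : ∀ k < 2 * N, Integrable (fun x => x ^ k * Real.exp (-V₁ x)) μ)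
    (hV₂ : ∀ k, k + 4 ≤ 4 * N → Integrable (fun x => x ^ k * Real.exp (-2 * V₂ x)) μ)
    (hq : ∀ j < 2 * N, (q j).Monic) (hd : ∀ j < 2 * N, (q j).natDegree = j) :
    (N.factorial : ℂ) * grandPartition μ V₁ V₂ N X =
      pfSum (fun (_ : Fin N) a b =>
        X ^ 2 * skewOne μ V₁ (q (finProdFinEquiv a)) (q (finProdFinEquiv b)) +
          skewFour μ V₂ (q (finProdFinEquiv a)) (q (finProdFinEquiv b))) := by
  set A : ℕ → ℕ → ℂ := fun a b => skewOne μ V₁ (q a) (q b)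
  set B : ℕ → ℕ → ℂ := fun a b => skewFour μ V₂ (q a) (q b)
  have hG : ∀ S : Finset (Fin N), mixedPfSum A B S =
      (S.card.factorial * (N - S.card).factorial : ℂ) *
        (fixedPartition μ V₁ V₂ (S.card * 2) (N - S.card) : ℂ) := by
    intro S
    obtain ⟨M, hM⟩ : ∃ M, N = S.card + M := by
      have := S.card_le_univ
      rw [Fintype.card_fin] at this
      exact ⟨N - S.card, by omega⟩
    have h1 : N - S.card = M := by omega
    rw [h1]
    generalize hl : S.card = l at *
    subst hM
    rw [mixedPfSum_eq A B S hl, fixedPartition_eq_pfSum hV₁ hV₂ hq hd]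
  have h2 := pfSum_add_eq_sum_range (N := N) (X ^ 2) A B (fun l => (l.factorial * (N - l).factorial : ℂ) *
        (fixedPartition μ V₁ V₂ (l * 2) (N - l) : ℂ)) hG
  refine Eq.trans ?_ h2.symm
  rw [grandPartition_eq_sum_range, Finset.mul_sum]
  refine Finset.sum_congr rfl fun l hl => ?_
  -- The number of subsets with `l` elements combines with the factorials of
  -- `fixedPartition_eq_pfSum` to `N!`, independent of `l`.
  have h3 : (N.choose l : ℂ) * l.factorial * (N - l).factorial = N.factorial := by
    exact_mod_cast Nat.choose_mul_factorial_mul_factorial (Nat.lt_succ_iff.1 (Finset.mem_range.1 hl))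
  rw [← h3, pow_mul']
  ring

lemma skewFour_swap (φ ψ : Polynomial ℂ) (V : ℝ → ℝ) :
    skewFour μ V ψ φ = -skewFour μ V φ ψ := by
  unfold skewFour
  rw [← mul_neg, ← integral_neg]
  congr 2
  funext z
  ring

lemma skewFour_self (φ : Polynomial ℂ) (V : ℝ → ℝ) : skewFour μ V φ φ = 0 := by
  have := skewFour_swap (μ := μ) φ φ V
  linear_combination this / 2

/-- If the even-even and odd-odd entries vanish, the Pfaffian is a determinant. -/
theorem grandPartition_eq_det {N : ℕ} (X : ℂ)
    (hV₁ : ∀ k < 2 * N, Integrable (fun x => x ^ k * Real.exp (-V₁ x)) μ)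
    (hV₂ : ∀ k, k + 4 ≤ 4 * N → Integrable (fun x => x ^ k * Real.exp (-2 * V₂ x)) μ)
    (hq : ∀ j < 2 * N, (q j).Monic) (hd : ∀ j < 2 * N, (q j).natDegree = j)
    (h1e : ∀ m < N, ∀ n < N, skewOne μ V₁ (q (2 * m)) (q (2 * n)) = 0)
    (h1o : ∀ m < N, ∀ n < N, skewOne μ V₁ (q (2 * m + 1)) (q (2 * n + 1)) = 0)
    (h4e : ∀ m < N, ∀ n < N, skewFour μ V₂ (q (2 * m)) (q (2 * n)) = 0)
    (h4o : ∀ m < N, ∀ n < N, skewFour μ V₂ (q (2 * m + 1)) (q (2 * n + 1)) = 0) :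
    grandPartition μ V₁ V₂ N X = 2 ^ N * (Matrix.of fun m n : Fin N =>
      X ^ 2 * skewOne μ V₁ (q (2 * m)) (q (2 * n + 1)) +
        skewFour μ V₂ (q (2 * m)) (q (2 * n + 1))).det := by
  have h := grandPartition_eq_pfSum X hV₁ hV₂ hq hd
  have e0 : ∀ i : Fin N, (finProdFinEquiv (i, (0 : Fin 2)) : ℕ) = 2 * i := fun i => by simp
  have e1 : ∀ i : Fin N, (finProdFinEquiv (i, (1 : Fin 2)) : ℕ) = 2 * i + 1 := fun i => by
    simp [add_comm]
  rw [pfSum_of_alternating_blocks (fun a b : Fin N × Fin 2 =>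
        X ^ 2 * skewOne μ V₁ (q (finProdFinEquiv a)) (q (finProdFinEquiv b)) +
          skewFour μ V₂ (q (finProdFinEquiv a)) (q (finProdFinEquiv b)))] at h
  · have hN : (N.factorial : ℂ) ≠ 0 := Nat.cast_ne_zero.2 (Nat.factorial_ne_zero _)
    apply mul_left_cancel₀ hN
    rw [h, Fintype.card_fin]
    simp only [e0, e1]
    ring
  · intro i j
    rw [e0, e0, h1e _ i.2 _ j.2, h4e _ i.2 _ j.2]; ring
  · intro i j
    rw [e1, e1, h1o _ i.2 _ j.2, h4o _ i.2 _ j.2]; ring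
  · intro i j
    rw [e0, e1, skewOne_swap V₁ (q (2 * j)) (q (2 * i + 1)), skewFour_swap (q (2 * j)) (q (2 * i + 1))]
    ring

/-- The determinant of a tridiagonal matrix satisfies the continuant recurrence. -/
lemma det_tridiagonal_succ (T : ℕ → ℕ → ℂ) (hT : ∀ m n, m + 1 < n ∨ n + 1 < m → T m n = 0) (n : ℕ) :
    (Matrix.of fun i j : Fin (n + 2) => T i j).det =
      T (n + 1) (n + 1) * (Matrix.of fun i j : Fin (n + 1) => T i j).det -
        T (n + 1) n * T n (n + 1) * (Matrix.of fun i j : Fin n => T i j).det := by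
  -- In the last row only the last two entries survive. The minor of the off-diagonal one has a
  -- single nonzero entry in its last column.
  rw [Matrix.det_succ_row _ (Fin.last (n + 1)), Fin.sum_univ_castSucc, Fin.sum_univ_castSucc,
    Finset.sum_eq_zero]
  · have h1 : ((Matrix.of fun i j : Fin (n + 2) => T i j).submatrix (Fin.last (n + 1)).succAbove
        (Fin.last (n + 1)).succAbove) = Matrix.of fun i j : Fin (n + 1) => T i j := by
      ext i j
      simp
    have h2 : ((Matrix.of fun i j : Fin (n + 2) => T i j).submatrix (Fin.last (n + 1)).succAbove
        (Fin.last n).castSucc.succAbove).det =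
        T n (n + 1) * (Matrix.of fun i j : Fin n => T i j).det := by
      rw [Matrix.det_succ_column _ (Fin.last n), Fin.sum_univ_castSucc, Finset.sum_eq_zero]
      · have h3 : (((Matrix.of fun i j : Fin (n + 2) => T i j).submatrix
            (Fin.last (n + 1)).succAbove (Fin.last n).castSucc.succAbove).submatrix
            (Fin.last n).succAbove (Fin.last n).succAbove) = Matrix.of fun i j : Fin n => T i j := by
          ext i j
          simp only [Matrix.submatrix_apply, Fin.succAbove_last, Matrix.of_apply]
          rw [Fin.succAbove_of_castSucc_lt _ _ (by simp [Fin.lt_def])]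
          simp
        rw [h3]
        simp [Fin.succAbove_of_le_castSucc]
      · intro i _
        have : T i.castSucc (n + 1) = 0 := hT _ _ (Or.inl (by have := i.2; simp))
        simp [Fin.succAbove_of_le_castSucc] at this ⊢
        simp [this]
    rw [h1, h2]
    have s1 : (-1 : ℂ) ^ (((Fin.last (n + 1) : Fin (n + 2)) : ℕ) + ((Fin.last n).castSucc : ℕ)) = -1 := by
      simp only [Fin.val_last, Fin.val_castSucc]
      exact Odd.neg_one_pow ⟨n, by ring⟩
    have s2 : (-1 : ℂ) ^ (((Fin.last (n + 1) : Fin (n + 2)) : ℕ) + (Fin.last (n + 1) : ℕ)) = 1 :=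
      Even.neg_one_pow ⟨_, rfl⟩
    rw [s1, s2]
    simp only [Matrix.of_apply, Fin.val_last, Fin.val_castSucc]
    ring
  · intro i _
    have : T (n + 1) i = 0 := hT _ _ (Or.inr (by have := i.2; omega))
    simp [this]

variable {N : ℕ} {p : ℕ → Polynomial ℂ} {ζ h₁ h₄ : ℕ → ℂ}

/-- The basis consisting of the `p_{2n}` and of the odd combinations. -/
def adaptedBasis (p : ℕ → Polynomial ℂ) (ζ : ℕ → ℂ) (j : ℕ) : Polynomial ℂ :=
  if Even j then p j else oddCombination p ζ (j / 2)

lemma adaptedBasis_even (p : ℕ → Polynomial ℂ) (ζ : ℕ → ℂ) (n : ℕ) :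
    adaptedBasis p ζ (2 * n) = p (2 * n) := by
  simp [adaptedBasis]

lemma adaptedBasis_odd (p : ℕ → Polynomial ℂ) (ζ : ℕ → ℂ) (n : ℕ) :
    adaptedBasis p ζ (2 * n + 1) = oddCombination p ζ n := by
  rw [adaptedBasis, if_neg (by simp), show (2 * n + 1) / 2 = n by omega]

lemma adaptedBasis_monic_natDegree (hm : ∀ j < 2 * N, (p j).Monic)
    (hd : ∀ j < 2 * N, (p j).natDegree = j) (ζ : ℕ → ℂ) (j : ℕ) (hj : j < 2 * N) :
    (adaptedBasis p ζ j).Monic ∧ (adaptedBasis p ζ j).natDegree = j := by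
  rcases Nat.even_or_odd' j with ⟨n, rfl | rfl⟩
  · rw [adaptedBasis_even]
    exact ⟨hm _ hj, hd _ hj⟩
  · rw [adaptedBasis_odd]
    cases n with
    | zero => exact ⟨hm _ hj, hd _ hj⟩
    | succ n =>
      have h1 := hd (2 * n + 1) (by omega)
      have h3 : (p (2 * n + 3)).natDegree = 2 * n + 3 := hd (2 * n + 3) (by omega)
      have hlt : (Polynomial.C (ζ (n + 1)) * p (2 * n + 1)).degree < (p (2 * n + 3)).degree := by
        refine (Polynomial.degree_le_of_natDegree_le (n := 2 * n + 1) ?_).trans_lt ?_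
        · exact (Polynomial.natDegree_C_mul_le _ _).trans h1.le
        · rw [Polynomial.degree_eq_natDegree (hm (2 * n + 3) (by omega)).ne_zero, h3]
          exact_mod_cast (by omega : 2 * n + 1 < 2 * n + 3)
      refine ⟨(hm (2 * n + 3) (by omega)).sub_of_left hlt, ?_⟩
      rw [oddCombination, Polynomial.natDegree_sub_eq_left_of_natDegree_lt
        ((Polynomial.natDegree_C_mul_le _ _).trans_lt (by omega)), h3]
      ring

/-- Each of `φ ψ'` and `φ' ψ` may have degree `4N - 3`, one more than the moments allow, but their
coefficients in that degree agree and cancel in the difference. -/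
lemma integrable_skewFour_integrand
    (hV₂ : ∀ k, k + 4 ≤ 4 * N → Integrable (fun x => x ^ k * Real.exp (-2 * V₂ x)) μ)
    {φ ψ : Polynomial ℂ} (hφ : φ.natDegree < 2 * N) (hψ : ψ.natDegree < 2 * N) :
    Integrable (fun z : ℝ => (φ.eval (z : ℂ) * ψ.derivative.eval (z : ℂ) -
      φ.derivative.eval (z : ℂ) * ψ.eval (z : ℂ)) * (Real.exp (-2 * V₂ z) : ℂ)) μ := by
  obtain ⟨d, hd⟩ : ∃ d, 2 * N = d + 2 := ⟨2 * N - 2, by omega⟩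
  have hφ' := (Polynomial.natDegree_derivative_le φ).trans (by omega : φ.natDegree - 1 ≤ d)
  have hψ' := (Polynomial.natDegree_derivative_le ψ).trans (by omega : ψ.natDegree - 1 ≤ d)
  have hφ1 : φ.natDegree ≤ d + 1 := by omega
  have hψ1 : ψ.natDegree ≤ d + 1 := by omega
  have h1 : (φ * ψ.derivative - φ.derivative * ψ).natDegree ≤ d + 1 + d := by
    refine (Polynomial.natDegree_sub_le _ _).trans (max_le ?_ ?_)
    · exact Polynomial.natDegree_mul_le_of_le hφ1 hψ'
    · exact (Polynomial.natDegree_mul_le_of_le hφ' hψ1).trans (by omega)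
  have h2 : (φ * ψ.derivative - φ.derivative * ψ).coeff (d + 1 + d) = 0 := by
    rw [Polynomial.coeff_sub, Polynomial.coeff_mul_add_eq_of_natDegree_le hφ1 hψ', add_comm (d + 1) d,
      Polynomial.coeff_mul_add_eq_of_natDegree_le hφ' hψ1, Polynomial.coeff_derivative,
      Polynomial.coeff_derivative]
    ring
  have h3 := Polynomial.natDegree_le_pred h1 h2
  refine (integrable_eval_mul (w := fun x => Real.exp (-2 * V₂ x)) (n := 4 * N - 3)
    (fun k hk => hV₂ k (by omega)) _ (by omega :
      (φ * ψ.derivative - φ.derivative * ψ).natDegree < 4 * N - 3)).congr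
    (Filter.Eventually.of_forall fun z => ?_)
  simp

lemma skewFour_sub_C_mul
    (hV₂ : ∀ k, k + 4 ≤ 4 * N → Integrable (fun x => x ^ k * Real.exp (-2 * V₂ x)) μ)
    {φ ψ₁ ψ₂ : Polynomial ℂ} (c : ℂ) (hφ : φ.natDegree < 2 * N) (h1 : ψ₁.natDegree < 2 * N)
    (h2 : ψ₂.natDegree < 2 * N) :
    skewFour μ V₂ φ (ψ₁ - Polynomial.C c * ψ₂) = skewFour μ V₂ φ ψ₁ - c * skewFour μ V₂ φ ψ₂ := by
  unfold skewFour
  rw [mul_left_comm c, ← mul_sub (1 / 2 : ℂ), ← integral_const_mul c, ← integral_sub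
    (integrable_skewFour_integrand hV₂ hφ h1) ((integrable_skewFour_integrand hV₂ hφ h2).const_mul c)]
  congr 2
  funext z
  simp
  ring

/-- Determinantal form of the solution: the partition function is given by the continuants of the
tridiagonal matrix of the two skew inner products. -/
theorem grandPartition_eq_continuant (X : ℂ)
    (hV₁ : ∀ k < 2 * N, Integrable (fun x => x ^ k * Real.exp (-V₁ x)) μ)
    (hV₂ : ∀ k, k + 4 ≤ 4 * N → Integrable (fun x => x ^ k * Real.exp (-2 * V₂ x)) μ)
    (hp : SkewRelations μ V₁ V₂ N p ζ h₁ h₄) (D : ℕ → ℂ) (D0 : D 0 = 1)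
    (D1 : 0 < N → D 1 = X ^ 2 * h₁ 0 + h₄ 0)
    (Ds : ∀ i, i + 1 < N → D (i + 2) =
      (X ^ 2 * h₁ (i + 1) + h₄ (2 * i + 2) + ζ (i + 1) * h₄ (2 * i + 1)) * D (i + 1) -
        ζ (i + 1) * h₄ (2 * i) * h₄ (2 * i + 1) * D i) :
    grandPartition μ V₁ V₂ N X = 2 ^ N * D N := by
  have hb := adaptedBasis_monic_natDegree hp.monic hp.natDegree ζ
  have hpd : ∀ j < 2 * N, (p j).natDegree < 2 * N := fun j hj => by rwa [hp.natDegree j hj]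
  -- Subtracting `ζ_n p_{2n-1}` adds `ζ_n h₄(2n-1)` to the diagonal and creates the superdiagonal.
  -- Nothing is added for `n = 0`; the inner `if` is needed because `2 * n - 1` truncates to `0`
  -- there.
  have hodd : ∀ m < N, ∀ n < N, skewFour μ V₂ (p (2 * m)) (oddCombination p ζ n) =
      (if n = m then h₄ (2 * n) + (if n = 0 then 0 else ζ n * h₄ (2 * n - 1)) else 0) -
        (if m = n + 1 then h₄ (2 * n + 1) else 0) -
        (if n = m + 1 then ζ n * h₄ (2 * m) else 0) := by
    intro m hm n hn
    cases n with
    | zero =>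
      have := hp.four_even_odd m hm 0 hn
      simp only [mul_zero, zero_add] at this
      simp only [oddCombination, this, mul_zero, zero_add]
      simp
    | succ n =>
      rw [oddCombination, skewFour_sub_C_mul hV₂ _ (hpd _ (by omega)) (hpd _ (by omega))
        (hpd _ (by omega))]
      have h3 := hp.four_even_odd m hm (n + 1) hn
      have h1 := hp.four_even_odd m hm n (by omega)
      rw [show 2 * (n + 1) + 1 = 2 * n + 3 by ring] at h3 ⊢
      rw [h1, h3]
      rcases lt_trichotomy m n with h | rfl | h
      · simp [show n + 1 ≠ m by omega, show m ≠ n + 1 + 1 by omega, show n ≠ m by omega,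
          show m ≠ n + 1 by omega]
      · simp
      · rcases Nat.eq_or_lt_of_le h with rfl | h
        · simp [show 2 * (n + 1) - 1 = 2 * n + 1 by omega]
        · simp [show n + 1 ≠ m by omega, show n ≠ m by omega, show m ≠ n + 1 by omega]
  have hoo : ∀ m < N, ∀ n < N,
      skewFour μ V₂ (oddCombination p ζ m) (oddCombination p ζ n) = 0 := by
    have hod : ∀ n < N, (oddCombination p ζ n).natDegree < 2 * N := fun n hn => by
      rw [← adaptedBasis_odd, (hb _ (by omega)).2]; omega
    have h1 : ∀ m < N, ∀ n < N, skewFour μ V₂ (p (2 * m + 1)) (oddCombination p ζ n) = 0 := by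
      intro m hm n hn
      cases n with
      | zero => exact hp.four_odd_odd m hm 0 hn
      | succ n =>
        have h3 := hp.four_odd_odd m hm (n + 1) hn
        rw [show 2 * (n + 1) + 1 = 2 * n + 3 by ring] at h3
        rw [oddCombination, skewFour_sub_C_mul hV₂ _ (hpd _ (by omega)) (hpd _ (by omega))
          (hpd _ (by omega)), hp.four_odd_odd m hm n (by omega), h3]
        ring
    intro m hm n hn
    cases m with
    | zero => exact h1 0 hm n hn
    | succ m =>
      have h3 := h1 (m + 1) hm n hn
      rw [show 2 * (m + 1) + 1 = 2 * m + 3 by ring] at h3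
      rw [skewFour_swap, oddCombination, skewFour_sub_C_mul hV₂ _ (hod n hn) (hpd _ (by omega))
        (hpd _ (by omega)), skewFour_swap (p (2 * m + 3)), skewFour_swap (p (2 * m + 1)),
        h1 m (by omega) n hn, h3]
      ring
  rw [grandPartition_eq_det X hV₁ hV₂ (fun j hj => (hb j hj).1) (fun j hj => (hb j hj).2)]
  · congr 1
    set T : ℕ → ℕ → ℂ := fun m n => X ^ 2 * (if n = m then h₁ n else 0) +
      ((if n = m then h₄ (2 * n) + (if n = 0 then 0 else ζ n * h₄ (2 * n - 1)) else 0) -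
        (if m = n + 1 then h₄ (2 * n + 1) else 0) -
        (if n = m + 1 then ζ n * h₄ (2 * m) else 0)) with hT
    have hmat : (Matrix.of fun m n : Fin N =>
        X ^ 2 * skewOne μ V₁ (adaptedBasis p ζ (2 * m)) (adaptedBasis p ζ (2 * n + 1)) +
        skewFour μ V₂ (adaptedBasis p ζ (2 * m)) (adaptedBasis p ζ (2 * n + 1))) =
        Matrix.of fun m n : Fin N => T m n := by
      ext m n
      simp only [Matrix.of_apply, adaptedBasis_even, adaptedBasis_odd, hT]
      rw [hp.one_even_odd m m.2 n n.2, hodd m m.2 n n.2]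
    rw [hmat]
    have htri : ∀ m n, m + 1 < n ∨ n + 1 < m → T m n = 0 := by
      intro m n h
      simp only [hT]
      rw [if_neg (by omega), if_neg (by omega), if_neg (by omega), if_neg (by omega)]
      ring
    -- The continuant recurrence reaches back two steps, so two consecutive sizes are carried
    -- through the induction.
    have hdet : ∀ n, (n ≤ N → (Matrix.of fun i j : Fin n => T i j).det = D n) ∧
        (n + 1 ≤ N → (Matrix.of fun i j : Fin (n + 1) => T i j).det = D (n + 1)) := by
      intro n
      induction n with
      | zero =>
        refine ⟨fun _ => by simp [D0], fun h => ?_⟩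
        rw [zero_add, D1 h]
        simp [hT]
      | succ n ih =>
        refine ⟨ih.2, fun h => ?_⟩
        rw [det_tridiagonal_succ T htri, ih.1 (by omega), ih.2 (by omega), Ds n (by omega)]
        have t1 : T (n + 1) (n + 1) =
            X ^ 2 * h₁ (n + 1) + (h₄ (2 * n + 2) + ζ (n + 1) * h₄ (2 * n + 1)) := by
          simp [hT, show 2 * (n + 1) = 2 * n + 2 by ring]
        have t2 : T (n + 1) n = -h₄ (2 * n + 1) := by simp [hT, show n ≠ n + 1 + 1 by omega]
        have t3 : T n (n + 1) = -(ζ (n + 1) * h₄ (2 * n)) := by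
          simp [hT, show n ≠ n + 1 + 1 by omega]
        rw [t1, t2, t3]
        ring
    exact (hdet N).1 le_rfl
  · intro m hm n hn
    rw [adaptedBasis_even, adaptedBasis_even]
    exact hp.one_even_even m hm n hn
  · intro m hm n hn
    rw [adaptedBasis_odd, adaptedBasis_odd]
    exact hp.one_odd_odd n hn m hm
  · intro m hm n hn
    rw [adaptedBasis_even, adaptedBasis_even]
    exact hp.four_even_even m hm n hn
  · intro m hm n hn
    rw [adaptedBasis_odd, adaptedBasis_odd]
    exact hoo m hm n hn

/-- The general formula in terms of the solution of the three-term recurrence. -/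
theorem grandPartition_eq_of_alphaRecurrence (X : ℂ)
    (hV₁ : ∀ k < 2 * N, Integrable (fun x => x ^ k * Real.exp (-V₁ x)) μ)
    (hV₂ : ∀ k, k + 4 ≤ 4 * N → Integrable (fun x => x ^ k * Real.exp (-2 * V₂ x)) μ)
    (hp : SkewRelations μ V₁ V₂ N p ζ h₁ h₄) {α : ℕ → ℂ}
    (hα : AlphaRecurrence X ζ h₁ h₄ N α) :
    grandPartition μ V₁ V₂ N X = 2 ^ N * α N * ∏ j ∈ Finset.range N, h₄ (2 * j + 1) := by
  -- The continuant is `α n` times the product of the `h₄ (2j+1)`. The recurrence for `α` is only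
  -- multiplied by such products, never divided, so none of the `h₄` need be nonzero.
  rw [grandPartition_eq_continuant X hV₁ hV₂ hp
    (fun n => α n * ∏ j ∈ Finset.range n, h₄ (2 * j + 1)), mul_assoc]
  · simp [hα.init]
  · intro h
    have := hα.first h
    rw [hα.init] at this
    simp
    linear_combination this
  · intro i hi
    have := hα.step i hi
    simp only [Finset.prod_range_succ, show 2 * (i + 1) + 1 = 2 * i + 3 by ring]
    linear_combination (∏ j ∈ Finset.range i, h₄ (2 * j + 1)) * h₄ (2 * i + 1) * this

end GrandPartition

/-! ### Pearson functionals, Rodrigues' formula and the antisymmetric operator -/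

section PearsonFunctional

open Polynomial

/-- A linear functional on polynomials that satisfies the weak Pearson equation
`(F Λ)' = τ Λ` on polynomials of degree less than `d`. -/
structure IsPearson (F τ : ℂ[X]) (Λ : ℂ[X] →ₗ[ℂ] ℂ) (d : ℕ) : Prop where
  natDegree_F : F.natDegree ≤ 2
  natDegree_τ : τ.natDegree ≤ 1
  pearson : ∀ χ : ℂ[X], χ.natDegree + 1 ≤ d → Λ (F * derivative χ + τ * χ) = 0

variable {F τ : ℂ[X]} {Λ : ℂ[X] →ₗ[ℂ] ℂ} {d : ℕ}

/-- The raising operator `φ ↦ F φ' + (τ + m F') φ`. -/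
def raiseOp (F τ : ℂ[X]) (m : ℕ) (φ : ℂ[X]) : ℂ[X] :=
  F * derivative φ + (τ + C (m : ℂ) * derivative F) * φ

/-- The polynomials given by the Rodrigues formula. -/
def rodrigues (F τ : ℂ[X]) : ℕ → ℕ → ℂ[X]
  | _, 0 => 1
  | m, i + 1 => raiseOp F τ m (rodrigues F τ (m + 1) i)

lemma natDegree_raiseOp_le (hF : F.natDegree ≤ 2) (hτ : τ.natDegree ≤ 1) (m : ℕ) {φ : ℂ[X]} {i : ℕ}
    (hφ : φ.natDegree ≤ i) : (raiseOp F τ m φ).natDegree ≤ i + 1 := by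
  unfold raiseOp
  have h1 : (F * derivative φ).natDegree ≤ i + 1 := by
    rcases Nat.eq_zero_or_pos φ.natDegree with h0 | h0
    · rw [derivative_of_natDegree_zero h0]; simp
    · have := natDegree_derivative_le φ
      exact (natDegree_mul_le_of_le hF this).trans (by omega)
  have h2 : (τ + C (m : ℂ) * derivative F).natDegree ≤ 1 := by
    refine natDegree_add_le_of_degree_le hτ ((natDegree_C_mul_le _ _).trans ?_)
    exact (natDegree_derivative_le F).trans (by omega)
  exact natDegree_add_le_of_degree_le h1 ((natDegree_mul_le_of_le h2 hφ).trans (by omega))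

lemma coeff_raiseOp (hF : F.natDegree ≤ 2) (hτ : τ.natDegree ≤ 1) (m : ℕ) {φ : ℂ[X]} {i : ℕ}
    (hφ : φ.natDegree ≤ i) :
    (raiseOp F τ m φ).coeff (i + 1) =
      (τ.coeff 1 + (2 * m + i) * F.coeff 2) * φ.coeff i := by
  unfold raiseOp
  have h1 : (F * derivative φ).coeff (i + 1) = i * F.coeff 2 * φ.coeff i := by
    cases i with
    | zero =>
      rw [derivative_of_natDegree_zero (Nat.le_zero.1 hφ)]
      simp
    | succ i =>
      have := (natDegree_derivative_le φ).trans (by omega : φ.natDegree - 1 ≤ i)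
      rw [show i + 1 + 1 = 2 + i by ring, coeff_mul_add_eq_of_natDegree_le hF this,
        coeff_derivative]
      push_cast
      ring
  have h2 : (τ + C (m : ℂ) * derivative F).natDegree ≤ 1 := by
    refine natDegree_add_le_of_degree_le hτ ((natDegree_C_mul_le _ _).trans ?_)
    exact (natDegree_derivative_le F).trans (by omega)
  rw [coeff_add, h1, add_comm i 1, coeff_mul_add_eq_of_natDegree_le h2 hφ, coeff_add, coeff_C_mul,
    coeff_derivative]
  push_cast
  ring

lemma natDegree_rodrigues_le (hF : F.natDegree ≤ 2) (hτ : τ.natDegree ≤ 1) (i : ℕ) :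
    ∀ m, (rodrigues F τ m i).natDegree ≤ i := by
  induction i with
  | zero => intro m; simp [rodrigues]
  | succ i ih => intro m; exact natDegree_raiseOp_le hF hτ m (ih (m + 1))

lemma coeff_rodrigues (hF : F.natDegree ≤ 2) (hτ : τ.natDegree ≤ 1) (i : ℕ) :
    ∀ m, (rodrigues F τ m i).coeff i =
      ∏ s ∈ Finset.range i, (τ.coeff 1 + (2 * m + i + s - 1) * F.coeff 2) := by
  induction i with
  | zero => intro m; simp [rodrigues]
  | succ i ih =>
    intro m
    rw [rodrigues, coeff_raiseOp hF hτ m (natDegree_rodrigues_le hF hτ i (m + 1)), ih,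
      Finset.prod_range_succ', mul_comm]
    push_cast
    congr 1
    · refine Finset.prod_congr rfl fun s _ => ?_
      ring
    · ring

/-- Repeated integration by parts. For a weight `w` one has `(F^{m+1} w φ)' = F^m w · raiseOp m φ`,
so that `F^m w` times the Rodrigues polynomial is the `i`-th derivative of `F^{m+i} w`. The degree
bound keeps every use of the Pearson equation in its range of validity. -/
lemma IsPearson.rodrigues_mul (h : IsPearson F τ Λ d) (i : ℕ) : ∀ (m : ℕ) (φ : ℂ[X]),
    2 * m + i + φ.natDegree ≤ d →
      Λ (F ^ m * rodrigues F τ m i * φ) = (-1) ^ i * Λ (F ^ (m + i) * derivative^[i] φ) := by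
  induction i with
  | zero => intro m φ _; simp [rodrigues]
  | succ i ih =>
    intro m φ hd
    have hQ := natDegree_rodrigues_le h.natDegree_F h.natDegree_τ i (m + 1)
    set Q := rodrigues F τ (m + 1) i with hQdef
    have hdeg : (F ^ m * Q * φ).natDegree + 1 ≤ d := by
      have h1 : (F ^ m).natDegree ≤ m * 2 := natDegree_pow_le_of_le m h.natDegree_F
      have h2 := natDegree_mul_le_of_le (natDegree_mul_le_of_le h1 hQ) (le_refl φ.natDegree)
      omega
    have h1 := h.pearson _ hdeg
    have h2 : F * derivative (F ^ m * Q * φ) + τ * (F ^ m * Q * φ) =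
        F ^ m * raiseOp F τ m Q * φ + F ^ (m + 1) * Q * derivative φ := by
      unfold raiseOp
      simp only [derivative_mul, derivative_pow]
      rcases m with _ | m
      · simp; ring
      · simp only [Nat.add_sub_cancel]
        push_cast
        simp only [map_add, map_natCast, map_one]
        ring
    rw [h2, map_add] at h1
    rw [rodrigues, ← hQdef]
    have h3 : Λ (F ^ (m + 1) * Q * derivative φ) =
        (-1) ^ i * Λ (F ^ (m + 1 + i) * derivative^[i] (derivative φ)) := by
      -- For constant `φ` differentiation does not lower the degree and the bound for the induction
      -- hypothesis may fail; both sides are then zero.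
      rcases Nat.eq_zero_or_pos φ.natDegree with h0 | h0
      · rw [derivative_of_natDegree_zero h0]
        simp
      · refine ih (m + 1) _ ?_
        have := natDegree_derivative_le φ
        omega
    rw [h3] at h1
    rw [Function.iterate_succ_apply, show m + (i + 1) = m + 1 + i by ring, pow_succ]
    linear_combination h1

/-- The leading coefficient of the Rodrigues polynomial. -/
def rodriguesLead (F τ : ℂ[X]) (j : ℕ) : ℂ :=
  ∏ s ∈ Finset.range j, (τ.coeff 1 + (j + s - 1) * F.coeff 2)

/-- The monic orthogonal polynomials. -/
def orthoPoly (F τ : ℂ[X]) (j : ℕ) : ℂ[X] :=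
  C (rodriguesLead F τ j)⁻¹ * rodrigues F τ 0 j

/-- The squared norms of the monic orthogonal polynomials. -/
def orthoNorm (F τ : ℂ[X]) (Λ : ℂ[X] →ₗ[ℂ] ℂ) (j : ℕ) : ℂ :=
  (rodriguesLead F τ j)⁻¹ * ((-1) ^ j * (j.factorial * Λ (F ^ j)))

lemma natDegree_orthoPoly_le (hF : F.natDegree ≤ 2) (hτ : τ.natDegree ≤ 1) (j : ℕ) :
    (orthoPoly F τ j).natDegree ≤ j :=
  (natDegree_C_mul_le _ _).trans (natDegree_rodrigues_le hF hτ j 0)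

lemma coeff_orthoPoly (hF : F.natDegree ≤ 2) (hτ : τ.natDegree ≤ 1) {j : ℕ}
    (hj : rodriguesLead F τ j ≠ 0) : (orthoPoly F τ j).coeff j = 1 := by
  rw [orthoPoly, coeff_C_mul, coeff_rodrigues hF hτ]
  simp only [Nat.cast_zero, mul_zero, zero_add]
  exact inv_mul_cancel₀ hj

lemma monic_orthoPoly (hF : F.natDegree ≤ 2) (hτ : τ.natDegree ≤ 1) {j : ℕ}
    (hj : rodriguesLead F τ j ≠ 0) : (orthoPoly F τ j).Monic :=
  monic_of_natDegree_le_of_coeff_eq_one j (natDegree_orthoPoly_le hF hτ j) (coeff_orthoPoly hF hτ hj)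

lemma natDegree_orthoPoly (hF : F.natDegree ≤ 2) (hτ : τ.natDegree ≤ 1) {j : ℕ}
    (hj : rodriguesLead F τ j ≠ 0) : (orthoPoly F τ j).natDegree = j :=
  natDegree_eq_of_le_of_coeff_ne_zero (natDegree_orthoPoly_le hF hτ j)
    (by rw [coeff_orthoPoly hF hτ hj]; exact one_ne_zero)

/-- After `j` integrations by parts only the `j`-th derivative of `φ` is left, the constant `j!`
times its coefficient in degree `j`. This gives orthogonality and the norm at once. -/
lemma IsPearson.orthoPoly_mul (h : IsPearson F τ Λ d) {j : ℕ} (hj : 2 * j ≤ d) {φ : ℂ[X]}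
    (hφ : φ.natDegree ≤ j) :
    Λ (orthoPoly F τ j * φ) = φ.coeff j * orthoNorm F τ Λ j := by
  have h1 := h.rodrigues_mul j 0 φ (by omega)
  have h2 : derivative^[j] φ = C (φ.coeff j * (j.factorial : ℂ)) := by
    ext n
    rw [coeff_iterate_derivative, coeff_C]
    rcases Nat.eq_zero_or_pos n with rfl | hn
    · rw [if_pos rfl, zero_add, Nat.descFactorial_self, nsmul_eq_mul, mul_comm]
    · rw [if_neg hn.ne', coeff_eq_zero_of_natDegree_lt (by omega), smul_zero]
  rw [h2, zero_add, pow_zero, one_mul] at h1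
  have h3 : orthoPoly F τ j * φ = (rodriguesLead F τ j)⁻¹ • (rodrigues F τ 0 j * φ) := by
    rw [orthoPoly, smul_eq_C_mul, mul_assoc]
  rw [h3, map_smul, h1, mul_comm (F ^ j), ← smul_eq_C_mul, map_smul, orthoNorm]
  simp only [smul_eq_mul]
  ring

/-- The first-order operator `φ ↦ F φ' + τ φ / 2`, which is antisymmetric for `Λ`. -/
def skewOp (F τ : ℂ[X]) (φ : ℂ[X]) : ℂ[X] := F * derivative φ + C (1 / 2) * τ * φ

lemma skewOp_C_mul (φ : ℂ[X]) (c : ℂ) : skewOp F τ (C c * φ) = C c * skewOp F τ φ := by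
  unfold skewOp
  simp
  ring

lemma natDegree_skewOp_le (hF : F.natDegree ≤ 2) (hτ : τ.natDegree ≤ 1) {φ : ℂ[X]} {i : ℕ}
    (hφ : φ.natDegree ≤ i) : (skewOp F τ φ).natDegree ≤ i + 1 := by
  have h := natDegree_raiseOp_le hF ((natDegree_C_mul_le (1 / 2) τ).trans hτ) 0 hφ
  simpa [raiseOp, skewOp] using h

lemma coeff_skewOp (hF : F.natDegree ≤ 2) (hτ : τ.natDegree ≤ 1) {φ : ℂ[X]} {i : ℕ}
    (hφ : φ.natDegree ≤ i) :
    (skewOp F τ φ).coeff (i + 1) = (i * F.coeff 2 + τ.coeff 1 / 2) * φ.coeff i := by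
  have h := coeff_raiseOp hF ((natDegree_C_mul_le (1 / 2) τ).trans hτ) 0 hφ
  have h2 : raiseOp F (C (1 / 2) * τ) 0 φ = skewOp F τ φ := by simp [raiseOp, skewOp]
  rw [h2, coeff_C_mul] at h
  rw [h]
  push_cast
  ring

/-- With the factor `1/2` in front of `τ`, the sum `φ D ψ + ψ D φ` equals `F (φ ψ)' + τ φ ψ`, which
the Pearson equation annihilates. -/
lemma IsPearson.skewOp_antisymm (h : IsPearson F τ Λ d) {φ ψ : ℂ[X]}
    (hd : φ.natDegree + ψ.natDegree + 1 ≤ d) : Λ (φ * skewOp F τ ψ) = -Λ (ψ * skewOp F τ φ) := by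
  have h1 := h.pearson (φ * ψ) (by have := natDegree_mul_le (p := φ) (q := ψ); omega)
  have h2 : F * derivative (φ * ψ) + τ * (φ * ψ) =
      φ * skewOp F τ ψ + ψ * skewOp F τ φ := by
    unfold skewOp
    have : (C (1 / 2) : ℂ[X]) * 2 = 1 := by
      rw [← C_ofNat, ← C_mul]; norm_num
    rw [derivative_mul]
    linear_combination -(τ * φ * ψ) * this
  rw [h2, map_add] at h1
  linear_combination h1

/-- The leading coefficients of `skewOp` on the orthogonal polynomials. -/
def skewLead (F τ : ℂ[X]) (j : ℕ) : ℂ := j * F.coeff 2 + τ.coeff 1 / 2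

variable {N : ℕ}

lemma rodriguesLead_ne_zero (hlead : ∀ i, i + 4 ≤ 4 * N → τ.coeff 1 + i * F.coeff 2 ≠ 0) {j : ℕ}
    (hj : j < 2 * N) : rodriguesLead F τ j ≠ 0 := by
  refine Finset.prod_ne_zero_iff.2 fun s hs => ?_
  have hs' := Finset.mem_range.1 hs
  have := hlead (j + s - 1) (by omega)
  rwa [Nat.cast_sub (by omega), Nat.cast_add, Nat.cast_one] at this

lemma skewLead_ne_zero (hlead : ∀ i, i + 4 ≤ 4 * N → τ.coeff 1 + i * F.coeff 2 ≠ 0) {j : ℕ}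
    (hj : j + 1 < 2 * N) : skewLead F τ j ≠ 0 := by
  have := hlead (2 * j) (by omega)
  intro h
  apply this
  unfold skewLead at h
  push_cast
  linear_combination 2 * h

/-- Orthogonality disposes of `i > j + 1`, as the operator raises the degree by at most one, and
antisymmetry of the rest: only neighbours are coupled. The bound on `i + j` excludes just the
diagonal entry `i = j = 2N - 1`. -/
lemma IsPearson.orthoPoly_mul_skewOp (h : IsPearson F τ Λ (4 * N - 2))
    (hlead : ∀ i, i + 4 ≤ 4 * N → τ.coeff 1 + i * F.coeff 2 ≠ 0) {i j : ℕ} (hi : i < 2 * N)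
    (hj : j < 2 * N) (hij : i + j + 1 ≤ 4 * N - 2) :
    Λ (orthoPoly F τ i * skewOp F τ (orthoPoly F τ j)) =
      if i = j + 1 then skewLead F τ j * orthoNorm F τ Λ i
      else if j = i + 1 then -(skewLead F τ i * orthoNorm F τ Λ j) else 0 := by
  have key : ∀ a b, a < 2 * N → b < a → Λ (orthoPoly F τ a * skewOp F τ (orthoPoly F τ b)) =
      if a = b + 1 then skewLead F τ b * orthoNorm F τ Λ a else 0 := by
    intro a b ha hb
    have hdb := natDegree_orthoPoly_le h.natDegree_F h.natDegree_τ b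
    have hds := natDegree_skewOp_le h.natDegree_F h.natDegree_τ hdb
    rw [h.orthoPoly_mul (by omega) (hds.trans hb)]
    split_ifs with hab
    · rw [hab, coeff_skewOp h.natDegree_F h.natDegree_τ hdb,
        coeff_orthoPoly h.natDegree_F h.natDegree_τ (rodriguesLead_ne_zero hlead (hb.trans ha)),
        skewLead, mul_one]
    · rw [coeff_eq_zero_of_natDegree_lt (by omega), zero_mul]
  have hdeg : (orthoPoly F τ i).natDegree + (orthoPoly F τ j).natDegree + 1 ≤ 4 * N - 2 := by
    have h1 := natDegree_orthoPoly_le h.natDegree_F h.natDegree_τ i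
    have h2 := natDegree_orthoPoly_le h.natDegree_F h.natDegree_τ j
    omega
  rcases lt_trichotomy i j with hlt | rfl | hlt
  · rw [h.skewOp_antisymm hdeg, key j i hj hlt, if_neg (by omega : ¬ i = j + 1)]
    split_ifs <;> simp
  · rw [if_neg (by omega), if_neg (by omega)]
    have := h.skewOp_antisymm hdeg
    linear_combination this / 2
  · rw [key i j hi hlt, if_neg (by omega : ¬ j = i + 1)]

/-- Testing against the polynomial of top degree removes the leading coefficient, and the degree
descends. -/
lemma IsPearson.eq_zero_of_orthogonal (h : IsPearson F τ Λ (4 * N - 2))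
    (hr : ∀ j < 2 * N, orthoNorm F τ Λ j ≠ 0) (n : ℕ) (hn : n < 2 * N) : ∀ ψ : ℂ[X],
    ψ.natDegree ≤ n → (∀ i ≤ n, Λ (orthoPoly F τ i * ψ) = 0) → ψ = 0 := by
  induction n with
  | zero =>
    intro ψ hψ h0
    have h1 := h0 0 le_rfl
    rw [h.orthoPoly_mul (by omega) hψ] at h1
    rw [eq_C_of_natDegree_le_zero hψ, (mul_eq_zero.1 h1).resolve_right (hr 0 hn), C_0]
  | succ n ih =>
    intro ψ hψ h0
    have h1 := h0 (n + 1) le_rfl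
    rw [h.orthoPoly_mul (by omega) hψ] at h1
    have h2 := natDegree_le_pred hψ ((mul_eq_zero.1 h1).resolve_right (hr _ hn))
    exact ih (by omega) ψ h2 fun i hi => h0 i (by omega)

/-- The structure relation of the orthogonal polynomials. -/
lemma IsPearson.skewOp_orthoPoly_succ (h : IsPearson F τ Λ (4 * N - 2))
    (hlead : ∀ i, i + 4 ≤ 4 * N → τ.coeff 1 + i * F.coeff 2 ≠ 0)
    (hr : ∀ j < 2 * N, orthoNorm F τ Λ j ≠ 0) {j : ℕ} (hj : j + 2 < 2 * N) :
    skewOp F τ (orthoPoly F τ (j + 1)) = C (skewLead F τ (j + 1)) * orthoPoly F τ (j + 2) -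
      C (skewLead F τ j * orthoNorm F τ Λ (j + 1) / orthoNorm F τ Λ j) * orthoPoly F τ j := by
  have hd := natDegree_orthoPoly_le h.natDegree_F h.natDegree_τ
  have hpp : ∀ a b, a < 2 * N → b < 2 * N → Λ (orthoPoly F τ a * orthoPoly F τ b) =
      if a = b then orthoNorm F τ Λ a else 0 := by
    have hle : ∀ a b, a < 2 * N → b ≤ a → Λ (orthoPoly F τ a * orthoPoly F τ b) =
        if a = b then orthoNorm F τ Λ a else 0 := by
      intro a b ha hab
      rw [h.orthoPoly_mul (by omega) ((hd b).trans hab)]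
      split_ifs with he
      · subst he
        rw [coeff_orthoPoly h.natDegree_F h.natDegree_τ (rodriguesLead_ne_zero hlead ha), one_mul]
      · rw [coeff_eq_zero_of_natDegree_lt (by have := hd b; omega), zero_mul]
    intro a b ha hb
    rcases le_total b a with hab | hab
    · exact hle a b ha hab
    · rw [mul_comm, hle b a hb hab]
      by_cases he : a = b
      · rw [if_pos he, if_pos he.symm, he]
      · rw [if_neg he, if_neg (Ne.symm he)]
  rw [← sub_eq_zero]
  refine h.eq_zero_of_orthogonal hr (j + 2) hj _ ?_ ?_
  · refine (natDegree_sub_le _ _).trans (max_le (natDegree_skewOp_le h.natDegree_F h.natDegree_τ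
      (hd _)) ((natDegree_sub_le _ _).trans (max_le ?_ ?_)))
    · exact (natDegree_C_mul_le _ _).trans (hd _)
    · exact (natDegree_C_mul_le _ _).trans ((hd _).trans (by omega))
  · intro i hi
    rw [mul_sub, mul_sub, map_sub, map_sub, mul_left_comm, mul_left_comm (orthoPoly F τ i),
      ← smul_eq_C_mul, ← smul_eq_C_mul, map_smul, map_smul, hpp i _ (by omega) hj,
      hpp i _ (by omega) (by omega), h.orthoPoly_mul_skewOp hlead (by omega) (by omega) (by omega)]
    have hrj := hr j (by omega)
    rcases eq_or_ne i (j + 2) with rfl | h2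
    · simp
    rcases eq_or_ne i j with rfl | h0
    · simp only [h2, if_false, if_true, smul_eq_mul]
      field_simp
      ring
    · simp [h2, h0, Ne.symm h0]

lemma IsPearson.skewOp_orthoPoly_zero (h : IsPearson F τ Λ (4 * N - 2))
    (hlead : ∀ i, i + 4 ≤ 4 * N → τ.coeff 1 + i * F.coeff 2 ≠ 0)
    (hr : ∀ j < 2 * N, orthoNorm F τ Λ j ≠ 0) (hN : 1 < 2 * N) :
    skewOp F τ (orthoPoly F τ 0) = C (skewLead F τ 0) * orthoPoly F τ 1 := by
  have hd := natDegree_orthoPoly_le h.natDegree_F h.natDegree_τ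
  rw [← sub_eq_zero]
  refine h.eq_zero_of_orthogonal hr 1 hN _ ?_ ?_
  · refine (natDegree_sub_le _ _).trans (max_le (natDegree_skewOp_le h.natDegree_F h.natDegree_τ
      (hd _)) ((natDegree_C_mul_le _ _).trans (hd _)))
  · intro i hi
    rw [mul_sub, map_sub, mul_left_comm, ← smul_eq_C_mul, map_smul,
      h.orthoPoly_mul_skewOp hlead (by omega) (by omega) (by omega)]
    rcases Nat.le_one_iff_eq_zero_or_eq_one.1 hi with rfl | rfl
    · rw [mul_comm (orthoPoly F τ 0), h.orthoPoly_mul (by omega) ((hd 0).trans (by omega)),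
        coeff_eq_zero_of_natDegree_lt (by have := hd 0; omega)]
      simp
    · rw [h.orthoPoly_mul (by omega) (hd 1),
        coeff_orthoPoly h.natDegree_F h.natDegree_τ (rodriguesLead_ne_zero hlead hN)]
      simp

end PearsonFunctional

/-! ### Skew relations and the normalised continuant recurrence for classical weights -/

section ClassicalRelations

open Polynomial

variable {μ : Measure ℝ} [SigmaFinite μ] {V₁ V₂ : ℝ → ℝ} {N : ℕ}

lemma skewOne_sub_C_mul (hV₁ : ∀ k < 2 * N, Integrable (fun x => x ^ k * Real.exp (-V₁ x)) μ)
    {φ ψ₁ ψ₂ : ℂ[X]} (c : ℂ) (hφ : φ.natDegree < 2 * N) (h1 : ψ₁.natDegree < 2 * N)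
    (h2 : ψ₂.natDegree < 2 * N) :
    skewOne μ V₁ φ (ψ₁ - C c * ψ₂) = skewOne μ V₁ φ ψ₁ - c * skewOne μ V₁ φ ψ₂ := by
  have i1 := integrable_pairWeight_sign (integrable_pairWeight hV₁ hφ h1)
  have i2 := integrable_pairWeight_sign (integrable_pairWeight hV₁ hφ h2)
  have h : 2 * skewOne μ V₁ φ (ψ₁ - C c * ψ₂) =
      2 * skewOne μ V₁ φ ψ₁ - c * (2 * skewOne μ V₁ φ ψ₂) := by
    rw [skewOne_eq, skewOne_eq, skewOne_eq, ← integral_const_mul c,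
      ← integral_sub i1 (i2.const_mul c)]
    congr 1
    funext z
    simp [pairWeight]
    ring
  linear_combination h / 2

variable {F τ : ℂ[X]} {Λ : ℂ[X] →ₗ[ℂ] ℂ}

/-- `h⁽¹⁾_n` in terms of the norms. -/
def classicalH1 (F τ : ℂ[X]) (Λ : ℂ[X] →ₗ[ℂ] ℂ) (n : ℕ) : ℂ :=
  -(orthoNorm F τ Λ (2 * n) / skewLead F τ (2 * n))

/-- `h⁽⁴⁾_j` in terms of the norms. -/
def classicalH4 (F τ : ℂ[X]) (Λ : ℂ[X] →ₗ[ℂ] ℂ) (j : ℕ) : ℂ :=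
  -(skewLead F τ j * orthoNorm F τ Λ (j + 1))

/-- `ζ_n` in terms of the norms. -/
def classicalZeta (F τ : ℂ[X]) (Λ : ℂ[X] →ₗ[ℂ] ℂ) (n : ℕ) : ℂ :=
  skewLead F τ (2 * n - 1) * orthoNorm F τ Λ (2 * n) /
    (orthoNorm F τ Λ (2 * n - 1) * skewLead F τ (2 * n))

/-- The orthogonal polynomials of a classical weight satisfy the skew relations. -/
theorem IsPearson.skewRelations (h : IsPearson F τ Λ (4 * N - 2))
    (hlead : ∀ i, i + 4 ≤ 4 * N → τ.coeff 1 + i * F.coeff 2 ≠ 0)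
    (hr : ∀ j < 2 * N, orthoNorm F τ Λ j ≠ 0)
    (hV₁ : ∀ k < 2 * N, Integrable (fun x => x ^ k * Real.exp (-V₁ x)) μ)
    (hone : ∀ φ χ : ℂ[X], φ.natDegree < 2 * N → χ.natDegree + 1 < 2 * N →
      skewOne μ V₁ φ (skewOp F τ χ) = -Λ (φ * χ))
    (hfour : ∀ φ ψ : ℂ[X], φ.natDegree + ψ.natDegree + 1 ≤ 4 * N - 2 →
      skewFour μ V₂ φ ψ = Λ (φ * skewOp F τ ψ)) :
    SkewRelations μ V₁ V₂ N (orthoPoly F τ) (classicalZeta F τ Λ) (classicalH1 F τ Λ)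
      (classicalH4 F τ Λ) := by
  have hF := h.natDegree_F
  have hτ := h.natDegree_τ
  have hd := natDegree_orthoPoly_le hF hτ
  have hdlt : ∀ j < 2 * N, (orthoPoly F τ j).natDegree < 2 * N := fun j hj => (hd j).trans_lt hj
  -- `ζ_n` is the ratio of the two coefficients of `D p_{2n}` in the structure relation, so the odd
  -- combinations lie in the image of `D`, where the first form is explicit.
  have hodd : ∀ n < N, oddCombination (orthoPoly F τ) (classicalZeta F τ Λ) n =
      skewOp F τ (C (skewLead F τ (2 * n))⁻¹ * orthoPoly F τ (2 * n)) := by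
    intro n hn
    rw [skewOp_C_mul]
    have hk := skewLead_ne_zero hlead (j := 2 * n) (by omega)
    cases n with
    | zero =>
      rw [mul_zero] at hk ⊢
      rw [h.skewOp_orthoPoly_zero hlead hr (by omega), ← mul_assoc, ← C_mul,
        inv_mul_cancel₀ hk, C_1, one_mul]
      rfl
    | succ n =>
      rw [show 2 * (n + 1) = 2 * n + 1 + 1 by ring] at hk ⊢
      rw [h.skewOp_orthoPoly_succ hlead hr (by omega), mul_sub, ← mul_assoc, ← C_mul,
        inv_mul_cancel₀ hk, C_1, one_mul, ← mul_assoc, ← C_mul, oddCombination]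
      congr 3
      rw [classicalZeta, show 2 * (n + 1) - 1 = 2 * n + 1 by omega,
        show 2 * (n + 1) = 2 * n + 1 + 1 by ring]
      have hrn := hr (2 * n + 1) (by omega)
      field_simp
  have hodd_deg : ∀ n < N,
      (oddCombination (orthoPoly F τ) (classicalZeta F τ Λ) n).natDegree < 2 * N := by
    intro n hn
    have hle := natDegree_skewOp_le hF hτ ((natDegree_C_mul_le (skewLead F τ (2 * n))⁻¹ _).trans
      (hd (2 * n)))
    rw [hodd n hn]
    omega
  have hfour' : ∀ i j, i < 2 * N → j < 2 * N → i + j + 1 ≤ 4 * N - 2 →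
      skewFour μ V₂ (orthoPoly F τ i) (orthoPoly F τ j) =
      if i = j + 1 then skewLead F τ j * orthoNorm F τ Λ i
      else if j = i + 1 then -(skewLead F τ i * orthoNorm F τ Λ j) else 0 := by
    intro i j hi hj hij
    rw [hfour _ _ (by have := hd i; have := hd j; omega), h.orthoPoly_mul_skewOp hlead hi hj hij]
  have hpone : ∀ m < N, ∀ n < N, skewOne μ V₁ (orthoPoly F τ (2 * m))
      (oddCombination (orthoPoly F τ) (classicalZeta F τ Λ) n) =
        if n = m then classicalH1 F τ Λ n else 0 := by
    intro m hm n hn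
    rw [hodd n hn, hone _ _ (hdlt _ (by omega))
      (by have := natDegree_C_mul_le (skewLead F τ (2 * n))⁻¹ (orthoPoly F τ (2 * n))
          have := hd (2 * n); omega), mul_left_comm, ← smul_eq_C_mul, map_smul, smul_eq_mul]
    have hle : ∀ a b, a < 2 * N → b < a → Λ (orthoPoly F τ a * orthoPoly F τ b) = 0 := by
      intro a b ha hab
      rw [h.orthoPoly_mul (by omega) ((hd b).trans hab.le),
        coeff_eq_zero_of_natDegree_lt (by have := hd b; omega), zero_mul]
    rcases lt_trichotomy m n with hlt | rfl | hlt
    · rw [if_neg hlt.ne', mul_comm (orthoPoly F τ (2 * m)), hle _ _ (by omega) (by omega)]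
      simp
    · rw [if_pos rfl, h.orthoPoly_mul (by omega) (hd _),
        coeff_orthoPoly hF hτ (rodriguesLead_ne_zero hlead (by omega)), classicalH1]
      ring
    · rw [if_neg hlt.ne, hle _ _ (by omega) (by omega)]
      simp
  refine ⟨fun j hj => monic_orthoPoly hF hτ (rodriguesLead_ne_zero hlead hj),
    fun j hj => natDegree_orthoPoly hF hτ (rodriguesLead_ne_zero hlead hj), hpone, ?_, ?_, ?_, ?_, ?_⟩
  -- `p_{2n+2} - c p_{2n}` is `D` of a multiple of `p_{2n+1}`, which is orthogonal to all even
  -- members. Hence the even-even entries reduce index by index, using antisymmetry, to `⟨p_0, p_0⟩₁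
  -- = 0`.
  · have hstep : ∀ n, n + 1 < N → ∃ c : ℂ, ∀ m < N,
        skewOne μ V₁ (orthoPoly F τ (2 * m)) (orthoPoly F τ (2 * (n + 1))) =
        c * skewOne μ V₁ (orthoPoly F τ (2 * m)) (orthoPoly F τ (2 * n)) := by
      intro n hn
      have hk := skewLead_ne_zero hlead (j := 2 * n + 1) (by omega)
      set c := skewLead F τ (2 * n) * orthoNorm F τ Λ (2 * n + 1) / orthoNorm F τ Λ (2 * n) with hc
      have h1 : skewOp F τ (C (skewLead F τ (2 * n + 1))⁻¹ * orthoPoly F τ (2 * n + 1)) =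
          orthoPoly F τ (2 * (n + 1)) -
            C ((skewLead F τ (2 * n + 1))⁻¹ * c) * orthoPoly F τ (2 * n) := by
        rw [skewOp_C_mul, h.skewOp_orthoPoly_succ hlead hr (by omega), mul_sub, ← mul_assoc, ← C_mul,
          inv_mul_cancel₀ hk, C_1, one_mul, ← mul_assoc, ← C_mul]
        rfl
      refine ⟨(skewLead F τ (2 * n + 1))⁻¹ * c, fun m hm => ?_⟩
      have h2 := skewOne_sub_C_mul hV₁ ((skewLead F τ (2 * n + 1))⁻¹ * c)
        (hdlt (2 * m) (by omega)) (hdlt (2 * (n + 1)) (by omega)) (hdlt (2 * n) (by omega))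
      rw [← h1, hone _ _ (hdlt _ (by omega))
        (by have := natDegree_C_mul_le (skewLead F τ (2 * n + 1))⁻¹ (orthoPoly F τ (2 * n + 1))
            have := hd (2 * n + 1); omega), mul_left_comm, ← smul_eq_C_mul, map_smul] at h2
      have h3 : Λ (orthoPoly F τ (2 * m) * orthoPoly F τ (2 * n + 1)) = 0 := by
        rcases lt_or_ge (2 * m) (2 * n + 1) with hlt | hge
        · rw [mul_comm, h.orthoPoly_mul (by omega) ((hd _).trans hlt.le),
            coeff_eq_zero_of_natDegree_lt (by have := hd (2 * m); omega), zero_mul]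
        · rw [h.orthoPoly_mul (by omega) ((hd _).trans hge),
            coeff_eq_zero_of_natDegree_lt (by have := hd (2 * n + 1); omega), zero_mul]
      rw [h3, smul_zero, neg_zero] at h2
      linear_combination -h2
    have h00 : skewOne μ V₁ (orthoPoly F τ (2 * 0)) (orthoPoly F τ (2 * 0)) = 0 := by
      have := skewOne_swap (μ := μ) V₁ (orthoPoly F τ (2 * 0)) (orthoPoly F τ (2 * 0))
      linear_combination this / 2
    have hzero : ∀ n < N, skewOne μ V₁ (orthoPoly F τ (2 * 0)) (orthoPoly F τ (2 * n)) = 0 := by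
      intro n
      induction n with
      | zero => intro _; exact h00
      | succ n ih =>
        intro hn
        obtain ⟨c, hc⟩ := hstep n hn
        rw [hc 0 (by omega), ih (by omega), mul_zero]
    intro m hm n
    induction n with
    | zero => intro _; rw [skewOne_swap, hzero m hm, neg_zero]
    | succ n ih =>
      intro hn
      obtain ⟨c, hc⟩ := hstep n hn
      rw [hc m hm, ih (by omega), mul_zero]
  · intro m hm n hn
    rw [hodd m hm, hone _ _ (hodd_deg n hn)
      (by have := natDegree_C_mul_le (skewLead F τ (2 * m))⁻¹ (orthoPoly F τ (2 * m))
          have := hd (2 * m); omega), hodd n hn, skewOp_C_mul, mul_comm, mul_assoc,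
      mul_left_comm (orthoPoly F τ (2 * m)), ← smul_eq_C_mul, ← smul_eq_C_mul, map_smul, map_smul,
      h.orthoPoly_mul_skewOp hlead (by omega) (by omega) (by omega), if_neg (by omega),
      if_neg (by omega)]
    simp
  · intro m hm n hn
    rw [hfour' _ _ (by omega) (by omega) (by omega)]
    by_cases h1 : n = m
    · subst h1
      rw [if_neg (by omega), if_pos rfl, if_pos rfl, if_neg (by omega), classicalH4, sub_zero]
    · by_cases h2 : m = n + 1
      · subst h2
        simp [classicalH4, show 2 * (n + 1) = 2 * n + 1 + 1 by ring]
      · rw [if_neg (by omega), if_neg (by omega), if_neg h1, if_neg h2, sub_zero]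
  · intro m hm n hn
    rw [hfour' _ _ (by omega) (by omega) (by omega), if_neg (by omega), if_neg (by omega)]
  · intro m hm n hn
    -- The entry with both degrees equal to `2N - 1` is out of reach of `hfour'`, so the diagonal is
    -- settled by antisymmetry.
    rcases eq_or_ne m n with rfl | hne
    · exact skewFour_self _ _
    · rw [hfour' _ _ (by omega) (by omega) (by omega), if_neg (by omega), if_neg (by omega)]

/-- The coefficients of the recurrence of the normalised continuants. -/
def classicalGamma (F τ : ℂ[X]) (Λ : ℂ[X] →ₗ[ℂ] ℂ) (j : ℕ) : ℂ :=
  skewLead F τ j ^ 2 * (orthoNorm F τ Λ (j + 1) / orthoNorm F τ Λ j)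

/-- The partition function of a classical weight in terms of the monic solution of a three-term
recurrence. -/
theorem IsPearson.grandPartition_eq (h : IsPearson F τ Λ (4 * N - 2))
    (hlead : ∀ i, i + 4 ≤ 4 * N → τ.coeff 1 + i * F.coeff 2 ≠ 0)
    (hr : ∀ j < 2 * N, orthoNorm F τ Λ j ≠ 0)
    (hV₁ : ∀ k < 2 * N, Integrable (fun x => x ^ k * Real.exp (-V₁ x)) μ)
    (hV₂ : ∀ k, k + 4 ≤ 4 * N → Integrable (fun x => x ^ k * Real.exp (-2 * V₂ x)) μ)
    (hone : ∀ φ χ : ℂ[X], φ.natDegree < 2 * N → χ.natDegree + 1 < 2 * N →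
      skewOne μ V₁ φ (skewOp F τ χ) = -Λ (φ * χ))
    (hfour : ∀ φ ψ : ℂ[X], φ.natDegree + ψ.natDegree + 1 ≤ 4 * N - 2 →
      skewFour μ V₂ φ ψ = Λ (φ * skewOp F τ ψ)) (X : ℂ)
    (γ E : ℕ → ℂ) (hγ : ∀ j, j + 1 < 2 * N → classicalGamma F τ Λ j = γ j) (E0 : E 0 = 1)
    (E1 : 0 < N → E 1 = X ^ 2 + γ 0)
    (Es : ∀ i, i + 1 < N → E (i + 2) = (X ^ 2 + γ (2 * i + 2) + γ (2 * i + 1)) * E (i + 1) -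
      γ (2 * i + 1) * γ (2 * i) * E i) :
    grandPartition μ V₁ V₂ N X =
      2 ^ N * ((∏ j ∈ Finset.range N, classicalH1 F τ Λ j) * E N) := by
  -- Splitting off the product of the `h₁` normalises the continuants, since `h₄(2n) / h₁(n) =
  -- γ_{2n}` and `ζ_n h₄(2n-1) / h₁(n) = γ_{2n-1}`.
  refine grandPartition_eq_continuant X hV₁ hV₂ (h.skewRelations hlead hr hV₁ hone hfour)
    (fun n => (∏ j ∈ Finset.range n, classicalH1 F τ Λ j) * E n) (by simp [E0]) ?_ ?_
  · intro hN
    have hk := skewLead_ne_zero hlead (j := 0) (by omega)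
    have hr0 := hr 0 (by omega)
    simp only [Finset.prod_range_one]
    rw [E1 hN, ← hγ 0 (by omega), classicalGamma, classicalH1, classicalH4]
    simp only [mul_zero, zero_add]
    field_simp
    ring
  · intro i hi
    have hk0 := skewLead_ne_zero hlead (j := 2 * i) (by omega)
    have hk2 := skewLead_ne_zero hlead (j := 2 * i + 2) (by omega)
    have hr0 := hr (2 * i) (by omega)
    have hr1 := hr (2 * i + 1) (by omega)
    have hr2 := hr (2 * i + 2) (by omega)
    rw [Es i hi, ← hγ _ (by omega), ← hγ _ (by omega), ← hγ _ (by omega)]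
    simp only [Finset.prod_range_succ]
    simp only [classicalGamma, classicalH1, classicalH4, classicalZeta,
      show 2 * (i + 1) = 2 * i + 2 by ring, show 2 * i + 2 - 1 = 2 * i + 1 by omega,
      show 2 * i + 1 + 1 = 2 * i + 2 by ring]
    field_simp
    ring

end ClassicalRelations

/-! ### From a classical weight to its Pearson functional -/

section ClassicalWeights

open Polynomial Filter Topology

/-- The functional `φ ↦ ∫ φ w dμ`, extended linearly from the moments. -/
def momentFunctional (μ : Measure ℝ) (w : ℝ → ℝ) : ℂ[X] →ₗ[ℂ] ℂ :=
  Polynomial.lsum fun k => (((∫ x, x ^ k * w x ∂μ : ℝ) : ℂ)) • (LinearMap.id : ℂ →ₗ[ℂ] ℂ)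

/-- The Cauchy weight has finitely many moments, so the functional is defined on all polynomials
formally and is a genuine integral only in the degrees whose moments exist. -/
lemma momentFunctional_apply {μ : Measure ℝ} {w : ℝ → ℝ} {n : ℕ}
    (hw : ∀ k < n, Integrable (fun x => x ^ k * w x) μ) (φ : ℂ[X]) (hφ : φ.natDegree < n) :
    momentFunctional μ w φ = ∫ x : ℝ, φ.eval (x : ℂ) * (w x : ℂ) ∂μ := by
  have h1 : ∀ k ∈ Finset.range (φ.natDegree + 1),
      Integrable (fun x : ℝ => φ.coeff k * (((x ^ k * w x : ℝ)) : ℂ)) μ := fun k hk =>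
    ((hw k (by have := Finset.mem_range.1 hk; omega)).ofReal (𝕜 := ℂ)).const_mul (φ.coeff k)
  have h2 : ∀ x : ℝ, φ.eval (x : ℂ) * (w x : ℂ) =
      ∑ k ∈ Finset.range (φ.natDegree + 1), φ.coeff k * (((x ^ k * w x : ℝ)) : ℂ) := fun x => by
    rw [eval_eq_sum_range, Finset.sum_mul]
    refine Finset.sum_congr rfl fun k _ => ?_
    push_cast
    ring
  simp_rw [h2]
  rw [integral_finsetSum _ h1, momentFunctional, lsum_apply, sum_over_range]
  · refine Finset.sum_congr rfl fun k _ => ?_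
    rw [integral_const_mul, integral_complex_ofReal]
    simp [mul_comm]
  · simp

/-- The fundamental theorem of calculus on `I` for functions that vanish along `l`, the filter of
neighbourhoods of the two ends of `I`. -/
def VanishingFTC (I : Set ℝ) (l : Filter ℝ) : Prop :=
  ∀ u u' : ℝ → ℂ, (∀ x ∈ I, HasDerivAt u (u' x) x) → IntegrableOn u' I → Tendsto u l (𝓝 0) →
    ∀ z ∈ I, (∫ x in I ∩ Set.Iio z, u' x = u z) ∧ ∫ x in I ∩ Set.Ioi z, u' x = -u z

/-- Cut at any point `z` of `I`: the two pieces contribute `u z` and `-u z`. -/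
lemma VanishingFTC.integral_eq_zero {I : Set ℝ} {l : Filter ℝ} (h : VanishingFTC I l)
    (hI : I.Nonempty) {u u' : ℝ → ℂ} (hu : ∀ x ∈ I, HasDerivAt u (u' x) x) (hi : IntegrableOn u' I)
    (hl : Tendsto u l (𝓝 0)) : ∫ x in I, u' x = 0 := by
  obtain ⟨z, hz⟩ := hI
  obtain ⟨h1, h2⟩ := h u u' hu hi hl z hz
  have h3 := integral_inter_add_sdiff (μ := volume) (f := u') (s := I) (measurableSet_Iio (a := z)) hi
  have h4 : ∫ x in I \ Set.Iio z, u' x = ∫ x in I ∩ Set.Ioi z, u' x := by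
    have : I \ Set.Iio z = I ∩ Set.Ici z := by ext; simp
    rw [this]
    refine setIntegral_congr_set ?_
    exact (Filter.EventuallyEq.refl _ I).inter Ioi_ae_eq_Ici.symm
  rw [← h3, h4, h1, h2, add_neg_cancel]

/-- The conditions under which the weight `exp (-2 V)` on the interval `I` is classical, with
`F` and `τ` the polynomials of the Pearson equation `(f exp (-2 V))' = τ exp (-2 V)`, and under which
all integrals for `2 N` particles converge. -/
structure IsClassicalWeight (I : Set ℝ) (l : Filter ℝ) (V f g : ℝ → ℝ) (F τ : ℂ[X]) (N : ℕ) :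
    Prop where
  measurableSet : MeasurableSet I
  nonempty : I.Nonempty
  ftc : VanishingFTC I l
  pos : ∀ x ∈ I, 0 < f x
  natDegree_F : F.natDegree ≤ 2
  natDegree_τ : τ.natDegree ≤ 1
  eval_F : ∀ x ∈ I, F.eval (x : ℂ) = f x
  eval_τ : ∀ x ∈ I, τ.eval (x : ℂ) = g x
  hasDerivAt : ∀ x ∈ I, HasDerivAt (potentialTwo V f) (-(g x / (2 * f x))) x
  integrable_weight : ∀ k, k + 2 ≤ 4 * N → IntegrableOn (fun x => x ^ k * Real.exp (-2 * V x)) I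
  integrable_one : ∀ k < 2 * N, IntegrableOn (fun x => x ^ k * Real.exp (-potentialOne V f x)) I
  tendsto_one : ∀ k, k + 1 < 2 * N →
    Tendsto (fun x => x ^ k * Real.exp (-potentialTwo V f x)) l (𝓝 0)
  tendsto_two : ∀ k, k + 3 ≤ 4 * N →
    Tendsto (fun x => x ^ k * Real.exp (-2 * potentialTwo V f x)) l (𝓝 0)

lemma tendsto_eval_mul {l : Filter ℝ} {w : ℝ → ℝ} {n : ℕ}
    (h : ∀ k < n, Tendsto (fun x => x ^ k * w x) l (𝓝 0)) (φ : ℂ[X]) (hφ : φ.natDegree < n) :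
    Tendsto (fun x : ℝ => φ.eval (x : ℂ) * (w x : ℂ)) l (𝓝 0) := by
  have h2 : ∀ x : ℝ, φ.eval (x : ℂ) * (w x : ℂ) =
      ∑ k ∈ Finset.range (φ.natDegree + 1), φ.coeff k * (((x ^ k * w x : ℝ)) : ℂ) := fun x => by
    rw [eval_eq_sum_range, Finset.sum_mul]
    refine Finset.sum_congr rfl fun k _ => ?_
    push_cast
    ring
  simp_rw [h2]
  rw [← Finset.sum_const_zero (s := Finset.range (φ.natDegree + 1))]
  refine tendsto_finsetSum _ fun k hk => ?_
  have h3 := (Complex.continuous_ofReal.tendsto 0).comp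
    (h k (by have := Finset.mem_range.1 hk; omega))
  simpa using h3.const_mul (φ.coeff k)

namespace IsClassicalWeight

variable {I : Set ℝ} {l : Filter ℝ} {V f g : ℝ → ℝ} {F τ : ℂ[X]} {N : ℕ}
  (hw : IsClassicalWeight I l V f g F τ N)

include hw

lemma exp_potentialTwo {x : ℝ} (hx : x ∈ I) :
    Real.exp (-potentialTwo V f x) = f x * Real.exp (-potentialOne V f x) := by
  conv_rhs => rw [← Real.exp_log (hw.pos x hx), ← Real.exp_add]
  congr 1
  unfold potentialOne potentialTwo
  ring

lemma exp_two_potentialTwo {x : ℝ} (hx : x ∈ I) :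
    Real.exp (-2 * potentialTwo V f x) = f x * Real.exp (-2 * V x) := by
  conv_rhs => rw [← Real.exp_log (hw.pos x hx), ← Real.exp_add]
  congr 1
  unfold potentialTwo
  ring

lemma integrable_two (k : ℕ) (hk : k + 4 ≤ 4 * N) :
    IntegrableOn (fun x => x ^ k * Real.exp (-2 * potentialTwo V f x)) I := by
  -- Since `e^{-2V₂} = f e^{-2V}` with `f` of degree at most two, two moments of the original weight
  -- are spent.
  have h1 := integrable_eval_mul (n := 4 * N - 1) (μ := volume.restrict I)
    (w := fun x => Real.exp (-2 * V x)) (fun k hk => hw.integrable_weight k (by omega))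
    (X ^ k * F) (by
      have := natDegree_mul_le_of_le (natDegree_X_pow_le (R := ℂ) k) hw.natDegree_F
      omega)
  refine h1.re.congr ((ae_restrict_iff' hw.measurableSet).2 (Filter.Eventually.of_forall
    fun x hx => ?_))
  simp only [eval_mul, eval_pow, eval_X, hw.eval_F x hx, hw.exp_two_potentialTwo hx]
  rw [← Complex.ofReal_pow, ← Complex.ofReal_mul, ← Complex.ofReal_mul, RCLike.re_to_complex,
    Complex.ofReal_re]
  ring

lemma partitionConverges :
    PartitionConverges (volume.restrict I) (potentialOne V f) (potentialTwo V f) N :=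
  partitionConverges_of_integrable hw.integrable_one hw.integrable_two

/-- This is the reason for the choice of the two potentials: as `e^{-V₂} = f e^{-V₁}` and `V₂' = -τ
/ (2f)`, the operator `skewOp` is differentiation conjugated by the weights. -/
lemma hasDerivAt_one (χ : ℂ[X]) {x : ℝ} (hx : x ∈ I) :
    HasDerivAt (fun x : ℝ => χ.eval (x : ℂ) * (Real.exp (-potentialTwo V f x) : ℂ))
      ((skewOp F τ χ).eval (x : ℂ) * (Real.exp (-potentialOne V f x) : ℂ)) x := by
  have h1 := (χ.hasDerivAt (x : ℂ)).comp_ofReal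
  have h2 := ((hw.hasDerivAt x hx).fun_neg.exp).ofReal_comp
  refine (h1.mul h2).congr_deriv ?_
  have hf : (f x : ℂ) ≠ 0 := Complex.ofReal_ne_zero.2 (hw.pos x hx).ne'
  rw [hw.exp_potentialTwo hx]
  simp only [skewOp, eval_add, eval_mul, eval_C, hw.eval_F x hx, hw.eval_τ x hx]
  push_cast
  field_simp

lemma hasDerivAt_two (χ : ℂ[X]) {x : ℝ} (hx : x ∈ I) :
    HasDerivAt (fun x : ℝ => χ.eval (x : ℂ) * (Real.exp (-2 * potentialTwo V f x) : ℂ))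
      ((F * derivative χ + τ * χ).eval (x : ℂ) * (Real.exp (-2 * V x) : ℂ)) x := by
  have h1 := (χ.hasDerivAt (x : ℂ)).comp_ofReal
  have h2 := (((hw.hasDerivAt x hx).const_mul (-2)).exp).ofReal_comp
  refine (h1.mul h2).congr_deriv ?_
  have hf : (f x : ℂ) ≠ 0 := Complex.ofReal_ne_zero.2 (hw.pos x hx).ne'
  rw [hw.exp_two_potentialTwo hx]
  simp only [eval_add, eval_mul, hw.eval_F x hx, hw.eval_τ x hx]
  push_cast
  field_simp

lemma isPearson :
    IsPearson F τ (momentFunctional (volume.restrict I) fun x => Real.exp (-2 * V x)) (4 * N - 2) := by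
  refine ⟨hw.natDegree_F, hw.natDegree_τ, fun χ hχ => ?_⟩
  have hdeg : (F * derivative χ + τ * χ).natDegree < 4 * N - 1 := by
    have h := natDegree_raiseOp_le hw.natDegree_F hw.natDegree_τ 0 (le_refl χ.natDegree)
    simp only [raiseOp, Nat.cast_zero, C_0, zero_mul, add_zero] at h
    omega
  have hint := integrable_eval_mul (n := 4 * N - 1) (μ := volume.restrict I)
    (w := fun x => Real.exp (-2 * V x)) (fun k hk => hw.integrable_weight k (by omega)) _ hdeg
  rw [momentFunctional_apply (n := 4 * N - 1) (fun k hk => hw.integrable_weight k (by omega)) _ hdeg]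
  exact hw.ftc.integral_eq_zero hw.nonempty (fun x hx => hw.hasDerivAt_two χ hx) hint
    (tendsto_eval_mul (n := 4 * N - 2) (fun k hk => hw.tendsto_two k (by omega)) χ (by omega))

/-- The kernel `sgn (z - y) / 2` inverts differentiation up to sign: integrated in `z` against the
derivative of `u = χ e^{-V₂}`, which vanishes at both ends, it gives `-u(y)`. The remaining weight
is `e^{-V₁-V₂} = e^{-2V}`. -/
lemma skewOne_skewOp (φ χ : ℂ[X]) (hφ : φ.natDegree < 2 * N) (hχ : χ.natDegree + 1 < 2 * N) :
    skewOne (volume.restrict I) (potentialOne V f) φ (skewOp F τ χ) =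
      -momentFunctional (volume.restrict I) (fun x => Real.exp (-2 * V x)) (φ * χ) := by
  have hdeg : (skewOp F τ χ).natDegree < 2 * N :=
    (natDegree_skewOp_le hw.natDegree_F hw.natDegree_τ le_rfl).trans_lt hχ
  have hint := integrable_pairWeight_sign (integrable_pairWeight hw.integrable_one hφ hdeg)
  have hint1 := integrable_eval_mul hw.integrable_one _ hdeg
  have hlim := tendsto_eval_mul (n := 2 * N - 1) (fun k hk => hw.tendsto_one k (by omega)) χ
    (by omega)
  have hinner : ∀ y ∈ I, ∫ z in I, (Real.sign (z - y) : ℂ) *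
      ((skewOp F τ χ).eval (z : ℂ) * (Real.exp (-potentialOne V f z) : ℂ)) =
      -2 * (χ.eval (y : ℂ) * (Real.exp (-potentialTwo V f y) : ℂ)) := by
    intro y hy
    obtain ⟨h1, h2⟩ := hw.ftc _ _ (fun x hx => hw.hasDerivAt_one χ hx) hint1 hlim y hy
    set u' := fun z : ℝ => (skewOp F τ χ).eval (z : ℂ) * (Real.exp (-potentialOne V f z) : ℂ)
    have h3 : (fun z : ℝ => (Real.sign (z - y) : ℂ) * u' z) =
        fun z => (Set.Ioi y).indicator u' z - (Set.Iio y).indicator u' z := by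
      funext z
      rcases lt_trichotomy z y with h | rfl | h
      · simp [Real.sign_of_neg (sub_neg.2 h), h, h.not_gt]
      · simp
      · simp [Real.sign_of_pos (sub_pos.2 h), h, h.not_gt]
    change ∫ z in I, (Real.sign (z - y) : ℂ) * u' z = _
    rw [h3, integral_sub (hint1.indicator measurableSet_Ioi) (hint1.indicator measurableSet_Iio),
      integral_indicator measurableSet_Ioi, integral_indicator measurableSet_Iio,
      Measure.restrict_restrict measurableSet_Ioi, Measure.restrict_restrict measurableSet_Iio,
      Set.inter_comm, Set.inter_comm (Set.Iio y), h1, h2]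
    ring
  have h2 : 2 * skewOne (volume.restrict I) (potentialOne V f) φ (skewOp F τ χ) =
      ∫ y in I, -2 * ((φ * χ).eval (y : ℂ) * (Real.exp (-2 * V y) : ℂ)) := by
    rw [skewOne_eq, integral_prod _ hint]
    refine setIntegral_congr_fun hw.measurableSet fun y hy => ?_
    have h4 : ∀ z : ℝ, (Real.sign (z - y) : ℂ) *
        pairWeight (potentialOne V f) φ (skewOp F τ χ) (y, z) =
        (φ.eval (y : ℂ) * (Real.exp (-potentialOne V f y) : ℂ)) * ((Real.sign (z - y) : ℂ) *
        ((skewOp F τ χ).eval (z : ℂ) * (Real.exp (-potentialOne V f z) : ℂ))) := by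
      intro z
      simp only [pairWeight, sub_eq_add_neg, Real.exp_add]
      push_cast
      ring
    simp only [h4]
    rw [integral_const_mul, hinner y hy]
    have h5 : Real.exp (-2 * V y) =
        Real.exp (-potentialOne V f y) * Real.exp (-potentialTwo V f y) := by
      rw [← Real.exp_add]
      congr 1
      unfold potentialOne potentialTwo
      ring
    rw [h5, eval_mul]
    push_cast
    ring
  rw [integral_const_mul, ← momentFunctional_apply (n := 4 * N - 1)
    (fun k hk => hw.integrable_weight k (by omega)) (φ * χ)
    (by have := natDegree_mul_le (p := φ) (q := χ); omega)] at h2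
  linear_combination h2 / 2

/-- Since `e^{-2V₂} = f e^{-2V}` and `f (φ ψ' - φ' ψ) = φ D ψ - ψ D φ`, where the `τ` terms cancel,
antisymmetry makes the two halves equal. -/
lemma skewFour_eq (φ ψ : ℂ[X]) (hd : φ.natDegree + ψ.natDegree + 1 ≤ 4 * N - 2) :
    skewFour (volume.restrict I) (potentialTwo V f) φ ψ =
      momentFunctional (volume.restrict I) (fun x => Real.exp (-2 * V x)) (φ * skewOp F τ ψ) := by
  have h1 := hw.isPearson.skewOp_antisymm hd
  have hdeg1 : (φ * skewOp F τ ψ).natDegree < 4 * N - 1 := by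
    have := natDegree_mul_le_of_le (le_refl φ.natDegree)
      (natDegree_skewOp_le hw.natDegree_F hw.natDegree_τ (le_refl ψ.natDegree))
    omega
  have hdeg2 : (ψ * skewOp F τ φ).natDegree < 4 * N - 1 := by
    have := natDegree_mul_le_of_le (le_refl ψ.natDegree)
      (natDegree_skewOp_le hw.natDegree_F hw.natDegree_τ (le_refl φ.natDegree))
    omega
  have hi : ∀ k < 4 * N - 1, Integrable (fun x => x ^ k * Real.exp (-2 * V x))
      (volume.restrict I) := fun k hk => hw.integrable_weight k (by omega)
  have h2 : 2 * skewFour (volume.restrict I) (potentialTwo V f) φ ψ =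
      momentFunctional (volume.restrict I) (fun x => Real.exp (-2 * V x)) (φ * skewOp F τ ψ) -
      momentFunctional (volume.restrict I) (fun x => Real.exp (-2 * V x)) (ψ * skewOp F τ φ) := by
    rw [momentFunctional_apply hi _ hdeg1, momentFunctional_apply hi _ hdeg2,
      ← integral_sub (integrable_eval_mul hi _ hdeg1) (integrable_eval_mul hi _ hdeg2), skewFour,
      ← mul_assoc, mul_one_div_cancel two_ne_zero, one_mul]
    refine setIntegral_congr_fun hw.measurableSet fun x hx => ?_
    simp only [hw.exp_two_potentialTwo hx, skewOp, eval_add, eval_mul, hw.eval_F x hx]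
    push_cast
    ring
  linear_combination h2 / 2 - h1 / 2

/-- The partition function of a classical weight in terms of the monic solution of a three-term
recurrence. -/
theorem grandPartition_eq
    (hlead : ∀ i, i + 4 ≤ 4 * N → τ.coeff 1 + i * F.coeff 2 ≠ 0)
    (hr : ∀ j < 2 * N, orthoNorm F τ
      (momentFunctional (volume.restrict I) fun x => Real.exp (-2 * V x)) j ≠ 0) (X : ℂ)
    (γ E : ℕ → ℂ) (hγ : ∀ j, j + 1 < 2 * N → classicalGamma F τ
      (momentFunctional (volume.restrict I) fun x => Real.exp (-2 * V x)) j = γ j) (E0 : E 0 = 1)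
    (E1 : 0 < N → E 1 = X ^ 2 + γ 0)
    (Es : ∀ i, i + 1 < N → E (i + 2) = (X ^ 2 + γ (2 * i + 2) + γ (2 * i + 1)) * E (i + 1) -
      γ (2 * i + 1) * γ (2 * i) * E i) :
    grandPartition (volume.restrict I) (potentialOne V f) (potentialTwo V f) N X =
      2 ^ N * ((∏ j ∈ Finset.range N, classicalH1 F τ
        (momentFunctional (volume.restrict I) fun x => Real.exp (-2 * V x)) j) * E N) :=
  hw.isPearson.grandPartition_eq hlead hr hw.integrable_one hw.integrable_two hw.skewOne_skewOp
    hw.skewFour_eq X γ E hγ E0 E1 Es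

/-- The norms are determined by the total masses of the weights `f ^ j exp (-2 V)`. -/
lemma orthoNorm_eq (j : ℕ) (hj : j < 2 * N) : orthoNorm F τ
      (momentFunctional (volume.restrict I) fun x => Real.exp (-2 * V x)) j =
    (rodriguesLead F τ j)⁻¹ * ((-1) ^ j * (j.factorial *
      ((∫ x in I, f x ^ j * Real.exp (-2 * V x) : ℝ) : ℂ))) := by
  rw [orthoNorm, momentFunctional_apply (n := 4 * N - 1)
    (fun k hk => hw.integrable_weight k (by omega)) (F ^ j)
    ((natDegree_pow_le_of_le j hw.natDegree_F).trans_lt (by omega)), ← integral_complex_ofReal]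
  congr 3
  refine setIntegral_congr_fun hw.measurableSet fun x hx => ?_
  simp [hw.eval_F x hx]

end IsClassicalWeight

end ClassicalWeights

/-! ### The fundamental theorem of calculus on the three types of interval -/

section Intervals

open Filter Topology

lemma integral_Ioo_of_tendsto_zero_left {u u' : ℝ → ℂ} {a z : ℝ} (haz : a < z)
    (hu : ∀ x ∈ Set.Ioc a z, HasDerivAt u (u' x) x) (hi : IntegrableOn u' (Set.Ioo a z))
    (hl : Tendsto u (𝓝[>] a) (𝓝 0)) : ∫ x in Set.Ioo a z, u' x = u z := by
  rw [← integral_Ioc_eq_integral_Ioo, ← intervalIntegral.integral_of_le haz.le,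
    intervalIntegral.integral_eq_sub_of_hasDerivAt_of_tendsto haz
      (fun x hx => hu x ⟨hx.1, hx.2.le⟩)
      ((intervalIntegrable_iff_integrableOn_Ioo_of_le haz.le).2 hi) hl
      (hu z ⟨haz, le_rfl⟩).continuousAt.continuousWithinAt, sub_zero]

lemma integral_Ioo_of_tendsto_zero_right {u u' : ℝ → ℂ} {z b : ℝ} (hzb : z < b)
    (hu : ∀ x ∈ Set.Ico z b, HasDerivAt u (u' x) x) (hi : IntegrableOn u' (Set.Ioo z b))
    (hl : Tendsto u (𝓝[<] b) (𝓝 0)) : ∫ x in Set.Ioo z b, u' x = -u z := by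
  rw [← integral_Ioc_eq_integral_Ioo, ← intervalIntegral.integral_of_le hzb.le,
    intervalIntegral.integral_eq_sub_of_hasDerivAt_of_tendsto hzb
      (fun x hx => hu x ⟨hx.1.le, hx.2⟩)
      ((intervalIntegrable_iff_integrableOn_Ioo_of_le hzb.le).2 hi)
      (hu z ⟨le_rfl, hzb⟩).continuousAt.continuousWithinAt hl, zero_sub]

lemma vanishingFTC_univ : VanishingFTC Set.univ (atBot ⊔ atTop) := by
  intro u u' hu hi hl z _
  rw [Set.univ_inter, Set.univ_inter, ← integral_Iic_eq_integral_Iio,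
    integral_Iic_of_hasDerivAt_of_tendsto' (fun x _ => hu x trivial)
      (hi.mono_set (Set.subset_univ _)) (hl.mono_left le_sup_left),
    integral_Ioi_of_hasDerivAt_of_tendsto' (fun x _ => hu x trivial)
      (hi.mono_set (Set.subset_univ _)) (hl.mono_left le_sup_right), sub_zero, zero_sub]
  exact ⟨rfl, rfl⟩

lemma vanishingFTC_Ioi (a : ℝ) : VanishingFTC (Set.Ioi a) (𝓝[>] a ⊔ atTop) := by
  intro u u' hu hi hl z hz
  rw [Set.Ioi_inter_Iio, Set.Ioi_inter_Ioi, max_eq_right (le_of_lt hz)]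
  refine ⟨integral_Ioo_of_tendsto_zero_left hz (fun x hx => hu x hx.1)
    (hi.mono_set fun x hx => hx.1) (hl.mono_left le_sup_left), ?_⟩
  rw [integral_Ioi_of_hasDerivAt_of_tendsto' (fun x hx => hu x (Set.mem_Ioi.2 (lt_of_lt_of_le (Set.mem_Ioi.1 hz) hx)))
    (hi.mono_set (Set.Ioi_subset_Ioi (le_of_lt hz))) (hl.mono_left le_sup_right), zero_sub]

lemma vanishingFTC_Ioo (a b : ℝ) : VanishingFTC (Set.Ioo a b) (𝓝[>] a ⊔ 𝓝[<] b) := by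
  intro u u' hu hi hl z hz
  have h1 : Set.Ioo a b ∩ Set.Iio z = Set.Ioo a z := by
    ext x
    simp only [Set.mem_inter_iff, Set.mem_Ioo, Set.mem_Iio]
    exact ⟨fun h => ⟨h.1.1, h.2⟩, fun h => ⟨⟨h.1, h.2.trans hz.2⟩, h.2⟩⟩
  have h2 : Set.Ioo a b ∩ Set.Ioi z = Set.Ioo z b := by
    ext x
    simp only [Set.mem_inter_iff, Set.mem_Ioo, Set.mem_Ioi]
    exact ⟨fun h => ⟨h.2, h.1.2⟩, fun h => ⟨⟨hz.1.trans h.1, h.2⟩, h.1⟩⟩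
  rw [h1, h2]
  exact ⟨integral_Ioo_of_tendsto_zero_left hz.1 (fun x hx => hu x ⟨hx.1, hx.2.trans_lt hz.2⟩)
      (hi.mono_set fun x hx => ⟨hx.1, hx.2.trans hz.2⟩) (hl.mono_left le_sup_left),
    integral_Ioo_of_tendsto_zero_right hz.2 (fun x hx => hu x ⟨hz.1.trans_le hx.1, hx.2⟩)
      (hi.mono_set fun x hx => ⟨hz.1.trans hx.1, hx.2⟩) (hl.mono_left le_sup_right)⟩

end Intervals

/-! ### The Gaussian weight -/

section GaussWeight

open Polynomial Filter Topology

lemma tendsto_pow_mul_exp_neg_sq {b : ℝ} (hb : 0 < b) (k : ℕ) :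
    Tendsto (fun x : ℝ => x ^ k * Real.exp (-b * x ^ 2)) (atBot ⊔ atTop) (𝓝 0) := by
  have h := tendsto_rpow_abs_mul_exp_neg_mul_sq_cocompact (a := b) hb k
  rw [cocompact_eq_atBot_atTop] at h
  refine squeeze_zero_norm (fun x => le_of_eq ?_) h
  rw [norm_mul, norm_pow, Real.norm_eq_abs, Real.norm_eq_abs, Real.abs_exp, Real.rpow_natCast]

lemma integrable_pow_mul_exp_neg_sq {b : ℝ} (hb : 0 < b) (k : ℕ) :
    Integrable (fun x : ℝ => x ^ k * Real.exp (-b * x ^ 2)) := by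
  simpa using integrable_rpow_mul_exp_neg_mul_sq hb (s := k) (by linarith [k.cast_nonneg (α := ℝ)])

lemma gauss_isClassicalWeight (N : ℕ) : IsClassicalWeight Set.univ (atBot ⊔ atTop) gaussV gaussF
    (fun x => -2 * x) 1 (-(C 2 * X)) N := by
  have hone : potentialOne gaussV gaussF = fun x => x ^ 2 / 2 := by
    funext x
    simp [potentialOne, gaussV, gaussF]
  have htwo : potentialTwo gaussV gaussF = fun x => x ^ 2 / 2 := by
    funext x
    simp [potentialTwo, gaussV, gaussF]
  have e1 : ∀ x : ℝ, -(x ^ 2 / 2) = -(1 / 2) * x ^ 2 := fun x => by ring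
  have e2 : ∀ x : ℝ, -2 * (x ^ 2 / 2) = -1 * x ^ 2 := fun x => by ring
  refine ⟨MeasurableSet.univ, Set.univ_nonempty, vanishingFTC_univ, fun x _ => one_pos, by simp, ?_,
    fun x _ => by simp [gaussF], fun x _ => by simp, fun x _ => ?_, fun k _ => ?_, fun k _ => ?_,
    fun k _ => ?_, fun k _ => ?_⟩
  · rw [natDegree_neg]
    simp
  · rw [htwo]
    refine (((hasDerivAt_id x).pow 2).div_const 2).congr_deriv ?_
    simp [gaussF]
    ring
  · simp only [integrableOn_univ, gaussV, e2]
    exact integrable_pow_mul_exp_neg_sq one_pos k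
  · simp only [integrableOn_univ, hone, e1]
    exact integrable_pow_mul_exp_neg_sq one_half_pos k
  · simp only [htwo, e1]
    exact tendsto_pow_mul_exp_neg_sq one_half_pos k
  · simp only [htwo, e2]
    exact tendsto_pow_mul_exp_neg_sq one_pos k

lemma gauss_mass (j : ℕ) :
    ∫ x in Set.univ, gaussF x ^ j * Real.exp (-2 * gaussV x) = Real.sqrt Real.pi := by
  have e2 : ∀ x : ℝ, -2 * (x ^ 2 / 2) = -1 * x ^ 2 := fun x => by ring
  simp only [gaussF, gaussV, one_pow, one_mul, e2, Measure.restrict_univ, integral_gaussian]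
  simp

end GaussWeight

/-! ### The Laguerre weight -/

section LaguerreWeight

open Polynomial Filter Topology

lemma tendsto_rpow_mul_exp_neg_mul {s b : ℝ} (hs : 0 < s) (hb : 0 < b) :
    Tendsto (fun x : ℝ => x ^ s * Real.exp (-b * x)) (𝓝[>] 0 ⊔ atTop) (𝓝 0) := by
  refine tendsto_sup.2 ⟨tendsto_nhdsWithin_of_tendsto_nhds ?_,
    tendsto_rpow_mul_exp_neg_mul_atTop_nhds_zero s b hb⟩
  have h : Continuous fun x : ℝ => x ^ s * Real.exp (-b * x) :=
    (continuous_id.rpow_const fun _ => Or.inr hs.le).mul (by fun_prop)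
  simpa [Real.zero_rpow hs.ne'] using h.tendsto 0

lemma eventually_pos_nhdsGT_sup_atTop : ∀ᶠ x : ℝ in 𝓝[>] 0 ⊔ atTop, 0 < x :=
  eventually_sup.2 ⟨self_mem_nhdsWithin, eventually_gt_atTop 0⟩

lemma integrableOn_rpow_mul_exp_neg_mul {s b : ℝ} (hs : -1 < s) (hb : 0 < b) :
    IntegrableOn (fun x : ℝ => x ^ s * Real.exp (-b * x)) (Set.Ioi 0) := by
  simpa using integrableOn_rpow_mul_exp_neg_mul_rpow hs one_pos hb

lemma pow_mul_exp_log {x : ℝ} (hx : 0 < x) (k : ℕ) (s b : ℝ) :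
    x ^ k * Real.exp (s * Real.log x + -b * x) = x ^ (s + k) * Real.exp (-b * x) := by
  rw [Real.exp_add, ← mul_assoc, Real.rpow_add hx, Real.rpow_natCast, Real.rpow_def_of_pos hx,
    mul_comm s, mul_comm (x ^ k)]

lemma laguerre_isClassicalWeight {a : ℝ} (ha : -1 < a) (N : ℕ) :
    IsClassicalWeight (Set.Ioi 0) (𝓝[>] 0 ⊔ atTop) (laguerreV a) laguerreF
      (fun x => (a + 1) - x) X (C ((a : ℂ) + 1) - X) N := by
  have e1 : ∀ x : ℝ, -potentialOne (laguerreV a) laguerreF x =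
      (a - 1) / 2 * Real.log x + -(1 / 2) * x := fun x => by
    simp only [potentialOne, laguerreV, laguerreF]
    ring
  have e2 : ∀ x : ℝ, -potentialTwo (laguerreV a) laguerreF x =
      (a + 1) / 2 * Real.log x + -(1 / 2) * x := fun x => by
    simp only [potentialTwo, laguerreV, laguerreF]
    ring
  have e3 : ∀ x : ℝ, -2 * potentialTwo (laguerreV a) laguerreF x =
      (a + 1) * Real.log x + -1 * x := fun x => by
    simp only [potentialTwo, laguerreV, laguerreF]
    ring
  have e4 : ∀ x : ℝ, -2 * laguerreV a x = a * Real.log x + -1 * x := fun x => by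
    simp only [laguerreV]
    ring
  have hk : ∀ k : ℕ, (0 : ℝ) ≤ k := fun k => k.cast_nonneg
  refine ⟨measurableSet_Ioi, ⟨1, Set.mem_Ioi.2 one_pos⟩, vanishingFTC_Ioi 0, fun x hx => hx, by simp, ?_,
    fun x _ => by simp [laguerreF], fun x _ => by simp, fun x hx => ?_, fun k _ => ?_, fun k _ => ?_,
    fun k _ => ?_, fun k _ => ?_⟩
  · exact (natDegree_sub_le _ _).trans (by simp)
  · have hx0 : x ≠ 0 := (Set.mem_Ioi.1 hx).ne'
    have h := Real.hasDerivAt_log hx0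
    refine ((((hasDerivAt_id x).sub (h.const_mul a)).div_const 2).sub
      (h.div_const 2)).congr_deriv ?_
    simp only [laguerreF]
    field_simp
    ring
  · refine (integrableOn_rpow_mul_exp_neg_mul (s := a + k) (by linarith [hk k])
      one_pos).congr_fun (fun x hx => ?_) measurableSet_Ioi
    simp only [e4]
    rw [pow_mul_exp_log hx]
  · refine (integrableOn_rpow_mul_exp_neg_mul (s := (a - 1) / 2 + k) (by linarith [hk k])
      one_half_pos).congr_fun (fun x hx => ?_) measurableSet_Ioi
    simp only [e1]
    rw [pow_mul_exp_log hx]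
  · refine (tendsto_rpow_mul_exp_neg_mul (s := (a + 1) / 2 + k) (by linarith [hk k])
      one_half_pos).congr' (eventually_pos_nhdsGT_sup_atTop.mono fun x hx => ?_)
    simp only [e2]
    rw [pow_mul_exp_log hx]
  · refine (tendsto_rpow_mul_exp_neg_mul (s := (a + 1) + k) (by linarith [hk k])
      one_pos).congr' (eventually_pos_nhdsGT_sup_atTop.mono fun x hx => ?_)
    simp only [e3]
    rw [pow_mul_exp_log hx]

lemma laguerre_mass {a : ℝ} (ha : -1 < a) (j : ℕ) :
    ∫ x in Set.Ioi (0 : ℝ), laguerreF x ^ j * Real.exp (-2 * laguerreV a x) =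
      Real.Gamma (a + j + 1) := by
  rw [Real.Gamma_eq_integral (by linarith [j.cast_nonneg (α := ℝ)])]
  refine setIntegral_congr_fun measurableSet_Ioi fun x hx => ?_
  have h := pow_mul_exp_log hx j a 1
  simp only [laguerreF, laguerreV]
  rw [show -2 * ((x - a * Real.log x) / 2) = a * Real.log x + -1 * x by ring, h, mul_comm]
  simp

end LaguerreWeight

/-! ### The Jacobi weight -/

section JacobiWeight

open Polynomial Filter Topology

lemma integral_jacobi {s t : ℝ} (hs : -1 < s) (ht : -1 < t) :
    ∫ x in Set.Ioo (-1 : ℝ) 1, (1 - x) ^ s * (1 + x) ^ t =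
      2 ^ (s + t + 1) * (Real.Gamma (s + 1) * Real.Gamma (t + 1) / Real.Gamma (s + t + 2)) := by
  have h1 := Complex.betaIntegral_scaled (t + 1 : ℝ) (s + 1 : ℝ) (a := 2) two_pos
  have h2 := Complex.Gamma_mul_Gamma_eq_betaIntegral (s := (t + 1 : ℝ)) (t := (s + 1 : ℝ))
    (by rw [Complex.ofReal_re]; linarith) (by rw [Complex.ofReal_re]; linarith)
  have hG : Real.Gamma (s + t + 2) ≠ 0 := (Real.Gamma_pos_of_pos (by linarith)).ne'
  rw [← Complex.ofReal_inj, ← integral_complex_ofReal, ← integral_Ioc_eq_integral_Ioo,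
    ← intervalIntegral.integral_of_le (by norm_num)]
  -- The shift `x ↦ x + 1` produces the beta integral scaled to `(0, 2)`.
  have h3 := intervalIntegral.integral_comp_add_right (a := -1) (b := 1) (fun x : ℝ =>
    (x : ℂ) ^ (((t + 1 : ℝ) : ℂ) - 1) * (((2 : ℝ) : ℂ) - x) ^ (((s + 1 : ℝ) : ℂ) - 1)) 1
  rw [show (-1 : ℝ) + 1 = 0 by norm_num, show (1 : ℝ) + 1 = 2 by norm_num, h1] at h3
  have h4 : ∫ x in (-1 : ℝ)..1, (((1 - x) ^ s * (1 + x) ^ t : ℝ) : ℂ) =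
      ∫ x in (-1 : ℝ)..1, (((x + 1 : ℝ)) : ℂ) ^ (((t + 1 : ℝ) : ℂ) - 1) *
        (((2 : ℝ) : ℂ) - ((x + 1 : ℝ) : ℂ)) ^ (((s + 1 : ℝ) : ℂ) - 1) := by
    refine intervalIntegral.integral_congr fun x hx => ?_
    rw [Set.uIcc_of_le (by norm_num)] at hx
    have a1 : ((t + 1 : ℝ) : ℂ) - 1 = (t : ℝ) := by push_cast; ring
    have a2 : ((s + 1 : ℝ) : ℂ) - 1 = (s : ℝ) := by push_cast; ring
    have a3 : ((2 : ℝ) : ℂ) - ((x + 1 : ℝ) : ℂ) = ((1 - x : ℝ) : ℂ) := by push_cast; ring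
    simp only [a1, a2, a3]
    rw [← Complex.ofReal_cpow (by linarith [hx.1]), ← Complex.ofReal_cpow (by linarith [hx.2]),
      ← Complex.ofReal_mul, mul_comm, add_comm x]
  rw [h4, h3]
  rw [← Complex.ofReal_add, Complex.Gamma_ofReal, Complex.Gamma_ofReal, Complex.Gamma_ofReal,
    show t + 1 + (s + 1) = s + t + 2 by ring] at h2
  rw [← Complex.ofReal_add, ← Complex.ofReal_one, ← Complex.ofReal_sub,
    ← Complex.ofReal_cpow two_pos.le, show t + 1 + (s + 1) - 1 = s + t + 1 by ring]
  rw [Complex.ofReal_mul]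
  congr 1
  have hG' : (Real.Gamma (s + t + 2) : ℂ) ≠ 0 := Complex.ofReal_ne_zero.2 hG
  push_cast at h2 ⊢
  rw [eq_div_iff hG', mul_comm, ← h2, mul_comm]

lemma integrableOn_jacobi {s t : ℝ} (hs : -1 < s) (ht : -1 < t) (k : ℕ) :
    IntegrableOn (fun x : ℝ => x ^ k * ((1 - x) ^ s * (1 + x) ^ t)) (Set.Ioo (-1) 1) := by
  have h : IntegrableOn (fun x : ℝ => (1 - x) ^ s * (1 + x) ^ t) (Set.Ioo (-1) 1) := by
    -- A non-integrable function would have integral `0`, whereas the beta value is positive.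
    by_contra h
    have h1 := integral_jacobi hs ht
    have h2 := Real.Gamma_pos_of_pos (show 0 < s + 1 by linarith)
    have h3 := Real.Gamma_pos_of_pos (show 0 < t + 1 by linarith)
    have h4 := Real.Gamma_pos_of_pos (show 0 < s + t + 2 by linarith)
    rw [integral_undef h] at h1
    have : (0 : ℝ) < 2 ^ (s + t + 1) * (Real.Gamma (s + 1) * Real.Gamma (t + 1) /
      Real.Gamma (s + t + 2)) := by positivity
    exact this.ne h1
  refine h.bdd_mul (c := 1) (by fun_prop)
    ((ae_restrict_iff' measurableSet_Ioo).2 (Eventually.of_forall fun x hx => ?_))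
  rw [norm_pow, Real.norm_eq_abs]
  exact pow_le_one₀ (abs_nonneg x) (abs_le.2 ⟨hx.1.le, hx.2.le⟩)

lemma tendsto_jacobi {s t : ℝ} (hs : 0 < s) (ht : 0 < t) (k : ℕ) :
    Tendsto (fun x : ℝ => x ^ k * ((1 - x) ^ s * (1 + x) ^ t)) (𝓝[>] (-1) ⊔ 𝓝[<] 1) (𝓝 0) := by
  have h : Continuous fun x : ℝ => x ^ k * ((1 - x) ^ s * (1 + x) ^ t) := by
    refine (continuous_pow k).mul (Continuous.mul ?_ ?_)
    · exact (by fun_prop : Continuous fun x : ℝ => 1 - x).rpow_const fun _ => Or.inr hs.le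
    · exact (by fun_prop : Continuous fun x : ℝ => 1 + x).rpow_const fun _ => Or.inr ht.le
  refine tendsto_sup.2 ⟨tendsto_nhdsWithin_of_tendsto_nhds ?_,
    tendsto_nhdsWithin_of_tendsto_nhds ?_⟩
  · simpa [Real.zero_rpow ht.ne'] using h.tendsto (-1)
  · simpa [Real.zero_rpow hs.ne'] using h.tendsto 1

lemma exp_jacobi {x : ℝ} (hx : x ∈ Set.Ioo (-1 : ℝ) 1) (s t : ℝ) :
    Real.exp (s * Real.log (1 - x) + t * Real.log (1 + x)) = (1 - x) ^ s * (1 + x) ^ t := by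
  rw [Real.exp_add, Real.rpow_def_of_pos (sub_pos.2 hx.2),
    Real.rpow_def_of_pos (by linarith [hx.1] : 0 < 1 + x), mul_comm s, mul_comm t]

lemma log_jacobiF {x : ℝ} (hx : x ∈ Set.Ioo (-1 : ℝ) 1) :
    Real.log (jacobiF x) = Real.log (1 - x) + Real.log (1 + x) := by
  rw [← Real.log_mul (sub_pos.2 hx.2).ne' (by linarith [hx.1]), jacobiF]
  congr 1
  ring

lemma eventually_mem_Ioo_neg_one_one :
    ∀ᶠ x : ℝ in 𝓝[>] (-1) ⊔ 𝓝[<] 1, x ∈ Set.Ioo (-1 : ℝ) 1 :=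
  eventually_sup.2 ⟨Ioo_mem_nhdsGT (by norm_num), Ioo_mem_nhdsLT (by norm_num)⟩

lemma jacobi_isClassicalWeight {a b : ℝ} (ha : -1 < a) (hb : -1 < b) (N : ℕ) :
    IsClassicalWeight (Set.Ioo (-1) 1) (𝓝[>] (-1) ⊔ 𝓝[<] 1) (jacobiV a b) jacobiF
      (fun x => (b - a) - (a + b + 2) * x) (1 - X ^ 2)
      (C ((b : ℂ) - a) - C ((a : ℂ) + b + 2) * X) N := by
  have e1 : ∀ x ∈ Set.Ioo (-1 : ℝ) 1, Real.exp (-potentialOne (jacobiV a b) jacobiF x) =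
      (1 - x) ^ ((a - 1) / 2) * (1 + x) ^ ((b - 1) / 2) := fun x hx => by
    rw [← exp_jacobi hx, potentialOne, jacobiV, log_jacobiF hx]
    congr 1
    ring
  have e2 : ∀ x ∈ Set.Ioo (-1 : ℝ) 1, Real.exp (-potentialTwo (jacobiV a b) jacobiF x) =
      (1 - x) ^ ((a + 1) / 2) * (1 + x) ^ ((b + 1) / 2) := fun x hx => by
    rw [← exp_jacobi hx, potentialTwo, jacobiV, log_jacobiF hx]
    congr 1
    ring
  have e3 : ∀ x ∈ Set.Ioo (-1 : ℝ) 1, Real.exp (-2 * potentialTwo (jacobiV a b) jacobiF x) =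
      (1 - x) ^ (a + 1) * (1 + x) ^ (b + 1) := fun x hx => by
    rw [← exp_jacobi hx, potentialTwo, jacobiV, log_jacobiF hx]
    congr 1
    ring
  have e4 : ∀ x ∈ Set.Ioo (-1 : ℝ) 1, Real.exp (-2 * jacobiV a b x) =
      (1 - x) ^ a * (1 + x) ^ b := fun x hx => by
    rw [← exp_jacobi hx, jacobiV]
    congr 1
    ring
  refine ⟨measurableSet_Ioo, ⟨0, by norm_num⟩, vanishingFTC_Ioo _ _, fun x hx => ?_, ?_, ?_,
    fun x _ => by simp [jacobiF], fun x _ => by simp, fun x hx => ?_, fun k _ => ?_, fun k _ => ?_,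
    fun k _ => ?_, fun k _ => ?_⟩
  · simp only [jacobiF]
    nlinarith [hx.1, hx.2]
  · exact (natDegree_sub_le _ _).trans (by simp)
  · exact (natDegree_sub_le _ _).trans (max_le (by simp) (natDegree_C_mul_le _ _ |>.trans (by simp)))
  · have h1 : 1 - x ≠ 0 := (sub_pos.2 hx.2).ne'
    have h2 : 1 + x ≠ 0 := by linarith [hx.1]
    have h3 : jacobiF x ≠ 0 := by
      rw [jacobiF, show 1 - x ^ 2 = (1 - x) * (1 + x) by ring]
      exact mul_ne_zero h1 h2
    have d1 := ((hasDerivAt_id x).const_sub 1).log h1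
    have d2 := ((hasDerivAt_id x).const_add 1).log h2
    have d3 := ((hasDerivAt_pow 2 x).const_sub 1).log h3
    refine ((((d1.const_mul a).add (d2.const_mul b)).neg.div_const 2).sub
      (d3.div_const 2)).congr_deriv ?_
    simp only [id, jacobiF]
    rw [show 1 - x ^ 2 = (1 - x) * (1 + x) by ring]
    field_simp
    push_cast
    ring
  · refine (integrableOn_jacobi ha hb k).congr_fun (fun x hx => ?_) measurableSet_Ioo
    simp only [e4 x hx]
  · refine (integrableOn_jacobi (s := (a - 1) / 2) (t := (b - 1) / 2) (by linarith) (by linarith)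
      k).congr_fun (fun x hx => ?_) measurableSet_Ioo
    simp only [e1 x hx]
  · refine (tendsto_jacobi (s := (a + 1) / 2) (t := (b + 1) / 2) (by linarith) (by linarith)
      k).congr' (eventually_mem_Ioo_neg_one_one.mono fun x hx => ?_)
    simp only [e2 x hx]
  · refine (tendsto_jacobi (s := a + 1) (t := b + 1) (by linarith) (by linarith)
      k).congr' (eventually_mem_Ioo_neg_one_one.mono fun x hx => ?_)
    simp only [e3 x hx]

lemma jacobi_mass {a b : ℝ} (ha : -1 < a) (hb : -1 < b) (j : ℕ) :
    ∫ x in Set.Ioo (-1 : ℝ) 1, jacobiF x ^ j * Real.exp (-2 * jacobiV a b x) =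
      2 ^ (a + b + 2 * j + 1) * (Real.Gamma (a + j + 1) * Real.Gamma (b + j + 1) /
        Real.Gamma (a + b + 2 * j + 2)) := by
  have hj := j.cast_nonneg (α := ℝ)
  have h := integral_jacobi (s := a + j) (t := b + j) (by linarith) (by linarith)
  rw [show a + j + (b + j) = a + b + 2 * j by ring] at h
  rw [← h]
  refine setIntegral_congr_fun measurableSet_Ioo fun x hx => ?_
  have h1 : 0 < jacobiF x := by
    simp only [jacobiF]
    nlinarith [hx.1, hx.2]
  rw [← exp_jacobi hx, ← Real.exp_log (pow_pos h1 j), Real.log_pow, log_jacobiF hx, jacobiV,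
    ← Real.exp_add]
  congr 1
  ring

end JacobiWeight

/-! ### The generalised Cauchy weight and its total mass -/

section CauchyWeight

open Polynomial Filter Topology

/-- The weight `(1 + x²) ^ (-p) * exp (2 q arctan x)`. -/
def cauchyWeight (p q x : ℝ) : ℝ := Real.exp (2 * q * Real.arctan x - p * Real.log (1 + x ^ 2))

lemma cauchyWeight_pos (p q x : ℝ) : 0 < cauchyWeight p q x := Real.exp_pos _

lemma continuous_cauchyWeight (p q : ℝ) : Continuous (cauchyWeight p q) := by
  unfold cauchyWeight
  refine Real.continuous_exp.comp ((continuous_const.mul Real.continuous_arctan).sub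
    (continuous_const.mul (Continuous.log (by fun_prop) fun x => by positivity)))

lemma one_add_sq_pow_mul_cauchyWeight (p q x : ℝ) (j : ℕ) :
    (1 + x ^ 2) ^ j * cauchyWeight p q x = cauchyWeight (p - j) q x := by
  have h : 0 < 1 + x ^ 2 := by positivity
  rw [← Real.exp_log (pow_pos h j), Real.log_pow, cauchyWeight, cauchyWeight, ← Real.exp_add]
  congr 1
  ring

/-- The arctangent is bounded by `π / 2` and `|x| ^ k ≤ (1 + x²) ^ (k/2)`, so only a power of `1 +
x²` has to be controlled at infinity. -/
lemma norm_pow_mul_cauchyWeight_le (p q x : ℝ) (k : ℕ) :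
    ‖x ^ k * cauchyWeight p q x‖ ≤
      Real.exp (Real.pi * |q|) * (1 + ‖x‖ ^ 2) ^ (-(2 * p - k) / 2) := by
  have h : 0 < 1 + x ^ 2 := by positivity
  have h1 : |x| ^ k ≤ Real.exp ((k : ℝ) / 2 * Real.log (1 + x ^ 2)) := by
    have h2 : |x| ≤ Real.exp (1 / 2 * Real.log (1 + x ^ 2)) := by
      refine abs_le_of_sq_le_sq ?_ (Real.exp_pos _).le
      rw [← Real.exp_nat_mul]
      rw [show ((2 : ℕ) : ℝ) * (1 / 2 * Real.log (1 + x ^ 2)) = Real.log (1 + x ^ 2) by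
        push_cast; ring, Real.exp_log h]
      linarith
    refine (pow_le_pow_left₀ (abs_nonneg x) h2 k).trans (le_of_eq ?_)
    rw [← Real.exp_nat_mul]
    congr 1
    ring
  have h3 : 2 * q * Real.arctan x ≤ Real.pi * |q| := by
    have h4 : |Real.arctan x| ≤ Real.pi / 2 :=
      abs_le.2 ⟨(Real.neg_pi_div_two_lt_arctan x).le, (Real.arctan_lt_pi_div_two x).le⟩
    calc 2 * q * Real.arctan x ≤ |2 * q * Real.arctan x| := le_abs_self _
      _ = 2 * |q| * |Real.arctan x| := by rw [abs_mul, abs_mul, abs_two]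
      _ ≤ 2 * |q| * (Real.pi / 2) := by gcongr
      _ = Real.pi * |q| := by ring
  rw [norm_mul, norm_pow, Real.norm_eq_abs x, Real.norm_of_nonneg (cauchyWeight_pos p q x).le, sq_abs,
    Real.rpow_def_of_pos h, ← Real.exp_add, cauchyWeight]
  refine (mul_le_mul_of_nonneg_right h1 (Real.exp_pos _).le).trans ?_
  rw [← Real.exp_add]
  refine Real.exp_le_exp.2 ?_
  linarith

lemma integrable_cauchyWeight {p : ℝ} (q : ℝ) {k : ℕ} (h : k + 1 < 2 * p) :
    Integrable fun x : ℝ => x ^ k * cauchyWeight p q x :=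
  ((integrable_rpow_neg_one_add_norm_sq (E := ℝ) (r := 2 * p - k)
    (by simp; linarith)).const_mul (Real.exp (Real.pi * |q|))).mono'
    ((continuous_pow k).mul (continuous_cauchyWeight p q)).aestronglyMeasurable
    (Eventually.of_forall fun x => norm_pow_mul_cauchyWeight_le p q x k)

lemma integrable_cauchyWeight_zero {p : ℝ} (q : ℝ) (h : 1 / 2 < p) :
    Integrable (cauchyWeight p q) := by
  simpa using integrable_cauchyWeight (p := p) q (k := 0) (by norm_num; linarith)

lemma tendsto_cauchyWeight {p : ℝ} (q : ℝ) {k : ℕ} (h : k < 2 * p) :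
    Tendsto (fun x : ℝ => x ^ k * cauchyWeight p q x) (atBot ⊔ atTop) (𝓝 0) := by
  refine squeeze_zero_norm (fun x => norm_pow_mul_cauchyWeight_le p q x k) ?_
  have h1 : Tendsto (fun x : ℝ => 1 + ‖x‖ ^ 2) (atBot ⊔ atTop) atTop := by
    refine tendsto_atTop_add_const_left _ _ ((tendsto_pow_atTop two_ne_zero).comp ?_)
    exact tendsto_sup.2 ⟨tendsto_abs_atBot_atTop, tendsto_abs_atTop_atTop⟩
  have h2 := (tendsto_rpow_neg_atTop (y := (2 * p - k) / 2) (by linarith)).comp h1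
  simp only [neg_div]
  simpa using h2.const_mul (Real.exp (Real.pi * |q|))

/-- The condition on `p` is the integrability of `x ^ (4N-2)` against the weight; the other
integrals and limits need no more. -/
lemma cauchy_isClassicalWeight {p : ℝ} (q : ℝ) {N : ℕ} (hp : 2 * (N : ℝ) - 1 / 2 < p) :
    IsClassicalWeight Set.univ (atBot ⊔ atTop) (cauchyV p q) cauchyF
      (fun x => 2 * q + (2 - 2 * p) * x) (1 + X ^ 2)
      (C (2 * (q : ℂ)) + C (2 - 2 * (p : ℂ)) * X) N := by
  have e1 : ∀ x : ℝ, Real.exp (-potentialOne (cauchyV p q) cauchyF x) =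
      cauchyWeight ((p + 1) / 2) (q / 2) x := fun x => by
    rw [potentialOne, cauchyV, cauchyF, cauchyWeight]
    congr 1
    ring
  have e2 : ∀ x : ℝ, Real.exp (-potentialTwo (cauchyV p q) cauchyF x) =
      cauchyWeight ((p - 1) / 2) (q / 2) x := fun x => by
    rw [potentialTwo, cauchyV, cauchyF, cauchyWeight]
    congr 1
    ring
  have e3 : ∀ x : ℝ, Real.exp (-2 * potentialTwo (cauchyV p q) cauchyF x) =
      cauchyWeight (p - 1) q x := fun x => by
    rw [potentialTwo, cauchyV, cauchyF, cauchyWeight]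
    congr 1
    ring
  have e4 : ∀ x : ℝ, Real.exp (-2 * cauchyV p q x) = cauchyWeight p q x := fun x => by
    rw [cauchyV, cauchyWeight]
    congr 1
    ring
  refine ⟨MeasurableSet.univ, Set.univ_nonempty, vanishingFTC_univ, fun x _ => ?_, ?_, ?_,
    fun x _ => by simp [cauchyF], fun x _ => by simp, fun x _ => ?_, fun k hk => ?_,
    fun k hk => ?_, fun k hk => ?_, fun k hk => ?_⟩
  · simp only [cauchyF]
    positivity
  · exact (natDegree_add_le _ _).trans (by simp)
  · exact (natDegree_add_le _ _).trans (max_le ((natDegree_C _).le.trans zero_le_one)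
      (natDegree_C_mul_le _ _ |>.trans (by simp)))
  · have h1 : 1 + x ^ 2 ≠ 0 := by positivity
    have d1 := ((hasDerivAt_pow 2 x).const_add 1).log h1
    refine ((((d1.const_mul p).sub ((Real.hasDerivAt_arctan x).const_mul (2 * q))).div_const 2).sub
      (d1.div_const 2)).congr_deriv ?_
    simp only [cauchyF]
    field_simp
    push_cast
    ring
  · simp only [integrableOn_univ, e4]
    have : (k : ℝ) + 2 ≤ 4 * N := mod_cast hk
    exact integrable_cauchyWeight q (by linarith)
  · simp only [integrableOn_univ, e1]
    have : (k : ℝ) + 1 ≤ 2 * N := mod_cast hk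
    exact integrable_cauchyWeight _ (by linarith)
  · simp only [e2]
    have : (k : ℝ) + 1 + 1 ≤ 2 * N := mod_cast hk
    exact tendsto_cauchyWeight _ (by linarith)
  · simp only [e3]
    have : (k : ℝ) + 3 ≤ 4 * N := mod_cast hk
    exact tendsto_cauchyWeight _ (by linarith)

/-- The total mass of `cauchyWeight p q`. -/
def cauchyIntegral (p q : ℝ) : ℝ := ∫ x, cauchyWeight p q x

lemma cauchy_mass_eq (p q : ℝ) (j : ℕ) :
    ∫ x in Set.univ, cauchyF x ^ j * Real.exp (-2 * cauchyV p q x) = cauchyIntegral (p - j) q := by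
  rw [Measure.restrict_univ, cauchyIntegral]
  congr 1
  funext x
  rw [← one_add_sq_pow_mul_cauchyWeight, cauchyF, cauchyV, cauchyWeight]
  congr 2
  ring

lemma cauchyIntegral_pos {p : ℝ} (q : ℝ) (hp : 1 / 2 < p) : 0 < cauchyIntegral p q := by
  refine (integral_pos_iff_support_of_nonneg (fun x => (cauchyWeight_pos p q x).le)
    (integrable_cauchyWeight_zero q hp)).2 ?_
  have : Function.support (cauchyWeight p q) = Set.univ :=
    Set.eq_univ_of_forall fun x => (cauchyWeight_pos p q x).ne'
  rw [this]
  simp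

lemma hasDerivAt_cauchyWeight (p q x : ℝ) :
    HasDerivAt (cauchyWeight p q) ((2 * q - 2 * p * x) * cauchyWeight (p + 1) q x) x := by
  have h1 : 1 + x ^ 2 ≠ 0 := by positivity
  have h2 : (1 + x ^ 2) * cauchyWeight (p + 1) q x = cauchyWeight p q x := by
    simpa using one_add_sq_pow_mul_cauchyWeight (p + 1) q x 1
  have d1 := ((hasDerivAt_pow 2 x).const_add 1).log h1
  refine (((Real.hasDerivAt_arctan x).const_mul (2 * q)).sub (d1.const_mul p)).exp.congr_deriv ?_
  change cauchyWeight p q x * _ = _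
  rw [← h2]
  field_simp
  push_cast
  ring

/-- Integrate the derivative of `(p x + q) w_p`. The linear factor is chosen so that, after `(1 +
x²) w_{p+1} = w_p`, only multiples of `w_p` and `w_{p+1}` remain. -/
lemma cauchyIntegral_add_one {p : ℝ} (q : ℝ) (hp : 1 / 2 < p) :
    2 * (p ^ 2 + q ^ 2) * cauchyIntegral (p + 1) q = p * (2 * p - 1) * cauchyIntegral p q := by
  have i0 := integrable_cauchyWeight_zero q hp
  have i1 := integrable_cauchyWeight_zero (p := p + 1) q (by linarith)
  have hd : ∀ x, HasDerivAt (fun x => (p * x + q) * cauchyWeight p q x)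
      (2 * (p ^ 2 + q ^ 2) * cauchyWeight (p + 1) q x - p * (2 * p - 1) * cauchyWeight p q x) x := by
    intro x
    have h2 : (1 + x ^ 2) * cauchyWeight (p + 1) q x = cauchyWeight p q x := by
      simpa using one_add_sq_pow_mul_cauchyWeight (p + 1) q x 1
    refine ((((hasDerivAt_id x).const_mul p).add_const q).mul
      (hasDerivAt_cauchyWeight p q x)).congr_deriv ?_
    rw [← h2]
    simp only [id]
    ring
  have ht : Tendsto (fun x => (p * x + q) * cauchyWeight p q x) (atBot ⊔ atTop) (𝓝 0) := by
    have t1 := (tendsto_cauchyWeight (p := p) q (k := 1) (by norm_num; linarith)).const_mul p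
    have t0 := (tendsto_cauchyWeight (p := p) q (k := 0) (by norm_num; linarith)).const_mul q
    have := t1.add t0
    simp only [mul_zero, add_zero] at this
    refine this.congr fun x => ?_
    ring
  have h := integral_of_hasDerivAt_of_tendsto hd
    ((i1.const_mul _).sub (i0.const_mul _)) (ht.mono_left le_sup_left) (ht.mono_left le_sup_right)
  rw [integral_sub (i1.const_mul _) (i0.const_mul _), integral_const_mul, integral_const_mul,
    sub_zero] at h
  unfold cauchyIntegral
  linarith

lemma cauchyIntegral_neg (p q : ℝ) : cauchyIntegral p (-q) = cauchyIntegral p q := by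
  unfold cauchyIntegral
  rw [← integral_neg_eq_self]
  congr 1
  funext x
  rw [cauchyWeight, cauchyWeight, Real.arctan_neg]
  simp only [mul_neg, neg_mul, neg_neg, neg_sq]

/-- Jordan's inequality `sin θ ≥ 2θ/π` at `θ = |arctan x|`, where `sin² θ = 1 - 1/(1+x²)`.
Integrated against the weight, the right side becomes a difference of two total masses. -/
lemma arctan_sq_le (x : ℝ) : Real.arctan x ^ 2 ≤ (Real.pi / 2) ^ 2 * (1 - (1 + x ^ 2)⁻¹) := by
  have h1 : (2 / Real.pi * |Real.arctan x|) ≤ |Real.sin (Real.arctan x)| := by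
    have h2 : |Real.arctan x| ≤ Real.pi / 2 :=
      abs_le.2 ⟨(Real.neg_pi_div_two_lt_arctan x).le, (Real.arctan_lt_pi_div_two x).le⟩
    refine (Real.mul_le_sin (abs_nonneg _) h2).trans ?_
    rcases abs_choice (Real.arctan x) with h | h <;> rw [h]
    · exact le_abs_self _
    · rw [Real.sin_neg]
      exact neg_le_abs _
  have h3 := pow_le_pow_left₀ (by positivity) h1 2
  rw [sq_abs, Real.sin_sq, Real.cos_sq_arctan, mul_pow, sq_abs, one_div] at h3
  have hpi := Real.pi_pos
  calc Real.arctan x ^ 2 = (Real.pi / 2) ^ 2 * ((2 / Real.pi) ^ 2 * Real.arctan x ^ 2) := by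
        field_simp
    _ ≤ _ := by gcongr

lemma cosh_sub_one_le (t : ℝ) : Real.cosh t - 1 ≤ t ^ 2 / 2 * Real.exp (t ^ 2 / 2) := by
  have h1 := Real.cosh_le_exp_half_sq t
  have h2 := Real.add_one_le_exp (-(t ^ 2 / 2))
  have h3 : Real.exp (-(t ^ 2 / 2)) * Real.exp (t ^ 2 / 2) = 1 := by
    rw [← Real.exp_add, neg_add_cancel, Real.exp_zero]
  nlinarith [Real.exp_pos (t ^ 2 / 2)]

/-- The mass is even in `q`, so the exponential may be replaced by a hyperbolic cosine. Then `cosh -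
1` is dominated by a multiple of `1 - 1/(1+x²)`, whose mean for `q = 0` is `1/(2p)` by
`cauchyIntegral_add_one`: the mass concentrates at the origin as `p` grows. -/
lemma abs_cauchyIntegral_div_sub_one_le {p : ℝ} (q : ℝ) (hp : 1 / 2 < p) :
    |cauchyIntegral p q / cauchyIntegral p 0 - 1| ≤
      2 * q ^ 2 * (Real.pi / 2) ^ 2 * Real.exp (2 * q ^ 2 * (Real.pi / 2) ^ 2) / (2 * p) := by
  set K := 2 * q ^ 2 * (Real.pi / 2) ^ 2 with hK
  have hK0 : 0 ≤ K := by positivity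
  have i0 := integrable_cauchyWeight_zero 0 hp
  have i1 := integrable_cauchyWeight_zero (p := p + 1) 0 (by linarith)
  have iq := integrable_cauchyWeight_zero q hp
  have iq' := integrable_cauchyWeight_zero (-q) hp
  have h0 := cauchyIntegral_pos 0 hp
  have hsplit : ∀ x, (cauchyWeight p q x + cauchyWeight p (-q) x) / 2 - cauchyWeight p 0 x =
      cauchyWeight p 0 x * (Real.cosh (2 * q * Real.arctan x) - 1) := by
    intro x
    simp only [cauchyWeight, sub_eq_add_neg, Real.exp_add, Real.cosh_eq, mul_zero, zero_mul,
      Real.exp_zero, mul_neg, neg_mul]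
    ring
  have hdiff : cauchyIntegral p q - cauchyIntegral p 0 =
      ∫ x, cauchyWeight p 0 x * (Real.cosh (2 * q * Real.arctan x) - 1) := by
    simp_rw [← hsplit]
    have hsub := integral_sub ((iq.add iq').div_const 2) i0
    simp only [Pi.add_apply] at hsub
    rw [hsub, integral_div, integral_add iq iq']
    have := cauchyIntegral_neg p q
    unfold cauchyIntegral at *
    linarith
  have hint : Integrable fun x => cauchyWeight p 0 x * (Real.cosh (2 * q * Real.arctan x) - 1) := by
    simp_rw [← hsplit]
    exact ((iq.add iq').div_const 2).sub i0
  have hnn : 0 ≤ cauchyIntegral p q - cauchyIntegral p 0 := by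
    rw [hdiff]
    exact integral_nonneg fun x => mul_nonneg (cauchyWeight_pos _ _ _).le
      (sub_nonneg.2 (Real.one_le_cosh _))
  have hle : cauchyIntegral p q - cauchyIntegral p 0 ≤
      K * Real.exp K * (cauchyIntegral p 0 - cauchyIntegral (p + 1) 0) := by
    rw [hdiff, cauchyIntegral, cauchyIntegral, ← integral_sub i0 i1, ← integral_const_mul]
    refine integral_mono hint ((i0.sub i1).const_mul _) fun x => ?_
    have h2 : (1 + x ^ 2) * cauchyWeight (p + 1) 0 x = cauchyWeight p 0 x := by
      simpa using one_add_sq_pow_mul_cauchyWeight (p + 1) 0 x 1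
    have h3 : cauchyWeight (p + 1) 0 x = cauchyWeight p 0 x * (1 + x ^ 2)⁻¹ := by
      rw [← h2]
      field_simp
    have h4 : (2 * q * Real.arctan x) ^ 2 / 2 ≤ K * (1 - (1 + x ^ 2)⁻¹) := by
      have := mul_le_mul_of_nonneg_left (arctan_sq_le x) (by positivity : 0 ≤ 2 * q ^ 2)
      rw [hK]
      linarith
    have h6 : 0 ≤ 1 - (1 + x ^ 2)⁻¹ := by
      rw [sub_nonneg]
      exact inv_le_one_of_one_le₀ (by nlinarith [sq_nonneg x])
    have h5 : (2 * q * Real.arctan x) ^ 2 / 2 ≤ K := by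
      refine h4.trans (mul_le_of_le_one_right hK0 ?_)
      have : 0 < (1 + x ^ 2)⁻¹ := by positivity
      linarith
    calc cauchyWeight p 0 x * (Real.cosh (2 * q * Real.arctan x) - 1)
        ≤ cauchyWeight p 0 x * (K * (1 - (1 + x ^ 2)⁻¹) * Real.exp K) := by
          refine mul_le_mul_of_nonneg_left ((cosh_sub_one_le _).trans ?_) (cauchyWeight_pos _ _ _).le
          gcongr
      _ = K * Real.exp K * (cauchyWeight p 0 x - cauchyWeight (p + 1) 0 x) := by
          rw [h3]
          ring
  have hrec := cauchyIntegral_add_one 0 hp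
  have hrec' : cauchyIntegral p 0 - cauchyIntegral (p + 1) 0 = cauchyIntegral p 0 / (2 * p) := by
    have : p ≠ 0 := by linarith
    field_simp
    have h7 : p * (2 * p * cauchyIntegral (p + 1) 0) = p * ((2 * p - 1) * cauchyIntegral p 0) := by
      linarith
    have h8 := mul_left_cancel₀ this h7
    linarith
  rw [hrec'] at hle
  rw [div_sub_one h0.ne', abs_of_nonneg (div_nonneg hnn h0.le), div_le_iff₀ h0]
  refine hle.trans (le_of_eq ?_)
  ring

lemma tendsto_cauchyIntegral_div {p : ℝ} (q : ℝ) (hp : 1 / 2 < p) :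
    Tendsto (fun n : ℕ => cauchyIntegral (p + n) q / cauchyIntegral (p + n) 0) atTop (𝓝 1) := by
  rw [tendsto_iff_norm_sub_tendsto_zero]
  refine squeeze_zero (fun _ => norm_nonneg _) (fun n => abs_cauchyIntegral_div_sub_one_le q
    (by linarith [n.cast_nonneg (α := ℝ)])) ?_
  refine Tendsto.div_atTop tendsto_const_nhds ?_
  refine Tendsto.const_mul_atTop two_pos ?_
  exact tendsto_atTop_add_const_left _ _ tendsto_natCast_atTop_atTop

/-- The recurrences in `p` for `q` and for `0` are iterated and divided; the factors `2p - 1`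
cancel. -/
lemma cauchyIntegral_div_add_natCast {p : ℝ} (q : ℝ) (hp : 1 / 2 < p) (n : ℕ) :
    cauchyIntegral (p + n) q / cauchyIntegral (p + n) 0 =
      cauchyIntegral p q / cauchyIntegral p 0 *
        (∏ j ∈ Finset.range n, (p + j) / ‖(p + q * Complex.I + j : ℂ)‖) ^ 2 := by
  induction n with
  | zero => simp
  | succ n ih =>
    have hpn : 1 / 2 < p + n := by linarith [n.cast_nonneg (α := ℝ)]
    have h1 := cauchyIntegral_add_one q hpn
    have h2 := cauchyIntegral_add_one 0 hpn
    have h3 : ‖(p + q * Complex.I + n : ℂ)‖ ^ 2 = (p + n) ^ 2 + q ^ 2 := by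
      rw [← Complex.normSq_eq_norm_sq, show (p + q * Complex.I + n : ℂ) =
        ((p + n : ℝ) : ℂ) + (q : ℝ) * Complex.I by push_cast; ring, Complex.normSq_add_mul_I]
    have c0 := cauchyIntegral_pos 0 hpn
    have c1 := cauchyIntegral_pos (p := p + n + 1) 0 (by linarith)
    have hpos : 0 < (p + n) ^ 2 + q ^ 2 := by
      have : 0 < p + n := by linarith
      positivity
    rw [Finset.prod_range_succ, mul_pow, ← mul_assoc, ← ih, div_pow, h3, Nat.cast_succ, ← add_assoc,
      div_mul_div_comm, div_eq_div_iff c1.ne' (mul_pos c0 hpos).ne']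
    have h4 : (p + n) * (2 * (p + n) * cauchyIntegral (p + n + 1) 0) =
        (p + n) * ((2 * (p + n) - 1) * cauchyIntegral (p + n) 0) := by linarith
    have h5 := mul_left_cancel₀ (by linarith : p + n ≠ 0) h4
    linear_combination (cauchyIntegral (p + n) 0 / 2) * h1 -
      (p + n) * cauchyIntegral (p + n) q / 2 * h5

/-- The iterated ratio tends to `1`, while its product part is a quotient of Gauss's products for
the Gamma function at `p` and at `p + iq`. -/
lemma cauchyIntegral_div {p : ℝ} (q : ℝ) (hp : 1 / 2 < p) :
    cauchyIntegral p q / cauchyIntegral p 0 =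
      Real.Gamma p ^ 2 / ‖Complex.Gamma (p + q * Complex.I)‖ ^ 2 := by
  have hp0 : 0 < p := by linarith
  have hG : Complex.Gamma (p + q * Complex.I) ≠ 0 :=
    Complex.Gamma_ne_zero_of_re_pos (by simpa using hp0)
  have hG' := (Real.Gamma_pos_of_pos hp0).ne'
  have t1 := (Complex.GammaSeq_tendsto_Gamma (p + q * Complex.I)).norm
  have t2 := Real.GammaSeq_tendsto_Gamma p
  have t3 := ((t1.div t2 hG').pow 2).const_mul (cauchyIntegral p q / cauchyIntegral p 0)
  -- The index is shifted because the `n`-th Gauss product has `n + 1` factors in its denominator.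
  have t4 := (tendsto_add_atTop_iff_nat 1).2 (tendsto_cauchyIntegral_div q hp)
  have h : cauchyIntegral p q / cauchyIntegral p 0 *
      (‖Complex.Gamma (p + q * Complex.I)‖ / Real.Gamma p) ^ 2 = 1 := by
    refine tendsto_nhds_unique (t3.congr' ?_) t4
    filter_upwards [eventually_gt_atTop 0] with n hn
    rw [cauchyIntegral_div_add_natCast q hp]
    congr 2
    have hn' : ‖((n : ℂ)) ^ (p + q * Complex.I : ℂ)‖ = (n : ℝ) ^ p := by
      rw [Complex.norm_natCast_cpow_of_pos hn]
      simp
    simp only [Pi.div_apply, Complex.GammaSeq, Real.GammaSeq, norm_div, norm_mul, hn', norm_prod,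
      Finset.prod_div_distrib, Complex.norm_natCast]
    have a1 : (n : ℝ) ^ p ≠ 0 := (Real.rpow_pos_of_pos (mod_cast hn) p).ne'
    have a2 : (n.factorial : ℝ) ≠ 0 := mod_cast n.factorial_ne_zero
    have a3 : ∏ j ∈ Finset.range (n + 1), (p + j) ≠ 0 :=
      Finset.prod_ne_zero_iff.2 fun j _ => by linarith [j.cast_nonneg (α := ℝ)]
    rw [div_div_div_eq, mul_comm _ (∏ j ∈ Finset.range (n + 1), (p + j)), mul_div_mul_right _ _
      (mul_ne_zero a1 a2)]
  have hn := norm_ne_zero_iff.2 hG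
  rw [div_pow] at h
  field_simp at h ⊢
  linarith

/-- The substitution `y = sin (arctan x)` maps the line onto `(-1, 1)` and leads to the symmetric
beta integral with exponents `p - 3/2`. -/
lemma cauchyIntegral_zero {p : ℝ} (hp : 1 / 2 < p) :
    cauchyIntegral p 0 = 2 ^ (2 * p - 2) * (Real.Gamma (p - 1 / 2) ^ 2 / Real.Gamma (2 * p - 1)) := by
  have h1 := integral_jacobi (s := p - 3 / 2) (t := p - 3 / 2) (by linarith) (by linarith)
  rw [show p - 3 / 2 + (p - 3 / 2) + 1 = 2 * p - 2 by ring, show p - 3 / 2 + 1 = p - 1 / 2 by ring,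
    show p - 3 / 2 + (p - 3 / 2) + 2 = 2 * p - 1 by ring, ← sq] at h1
  rw [← h1]
  have hd : ∀ x ∈ Set.univ, HasDerivWithinAt (fun x => Real.sin (Real.arctan x))
      (Real.cos (Real.arctan x) * (1 / (1 + x ^ 2))) Set.univ x := fun x _ =>
    ((Real.hasDerivAt_sin _).comp x (Real.hasDerivAt_arctan x)).hasDerivWithinAt
  have hinj : Set.InjOn (fun x => Real.sin (Real.arctan x)) Set.univ := fun x _ y _ hxy =>
    Real.arctan_injective (Real.injOn_sin
      ⟨(Real.neg_pi_div_two_lt_arctan x).le, (Real.arctan_lt_pi_div_two x).le⟩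
      ⟨(Real.neg_pi_div_two_lt_arctan y).le, (Real.arctan_lt_pi_div_two y).le⟩ hxy)
  have himg : (fun x => Real.sin (Real.arctan x)) '' Set.univ = Set.Ioo (-1) 1 := by
    ext y
    simp only [Set.image_univ, Set.mem_range, Set.mem_Ioo]
    constructor
    · rintro ⟨x, rfl⟩
      have h2 := Real.sin_sq_add_cos_sq (Real.arctan x)
      have h3 := Real.cos_arctan_pos x
      exact abs_lt.1 (abs_lt_of_sq_lt_sq (by nlinarith) zero_le_one)
    · rintro ⟨hy1, hy2⟩
      refine ⟨Real.tan (Real.arcsin y), ?_⟩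
      rw [Real.arctan_tan (Real.neg_pi_div_two_lt_arcsin.2 hy1) (Real.arcsin_lt_pi_div_two.2 hy2),
        Real.sin_arcsin hy1.le hy2.le]
  have h2 := integral_image_eq_integral_abs_deriv_smul MeasurableSet.univ hd hinj
    (fun y : ℝ => (1 - y) ^ (p - 3 / 2) * (1 + y) ^ (p - 3 / 2))
  rw [himg] at h2
  rw [h2, Measure.restrict_univ, cauchyIntegral]
  congr 1
  funext x
  have hmem : Real.sin (Real.arctan x) ∈ Set.Ioo (-1 : ℝ) 1 := by
    rw [← himg]
    exact ⟨x, trivial, rfl⟩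
  have hx : 0 < 1 + x ^ 2 := by positivity
  have hc : Real.cos (Real.arctan x) = Real.exp (-(1 / 2) * Real.log (1 + x ^ 2)) := by
    rw [Real.cos_arctan, Real.sqrt_eq_rpow, Real.rpow_def_of_pos hx, one_div, ← Real.exp_neg]
    congr 1
    ring
  have h3 : (1 - Real.sin (Real.arctan x)) ^ (p - 3 / 2) *
      (1 + Real.sin (Real.arctan x)) ^ (p - 3 / 2) =
      Real.exp (-(p - 3 / 2) * Real.log (1 + x ^ 2)) := by
    rw [← Real.mul_rpow (by linarith [hmem.2]) (by linarith [hmem.1]),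
      show (1 - Real.sin (Real.arctan x)) * (1 + Real.sin (Real.arctan x)) =
        1 - Real.sin (Real.arctan x) ^ 2 by ring, ← Real.cos_sq', Real.cos_sq_arctan, one_div,
      Real.inv_rpow hx.le, Real.rpow_def_of_pos hx, ← Real.exp_neg]
    congr 1
    ring
  have hi : 1 / (1 + x ^ 2) = Real.exp (-Real.log (1 + x ^ 2)) := by
    rw [Real.exp_neg, Real.exp_log hx, one_div]
  rw [h3, smul_eq_mul, abs_of_pos (by have := Real.cos_arctan_pos x; positivity), hc, hi,
    ← Real.exp_add, ← Real.exp_add, cauchyWeight]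
  congr 1
  ring

/-- Legendre's duplication formula eliminates `Γ(p - 1/2)` and cancels `Γ(p)²`. -/
lemma cauchyIntegral_eq {p : ℝ} (q : ℝ) (hp : 1 / 2 < p) :
    cauchyIntegral p q = Real.pi * 2 ^ (2 - 2 * p) * Real.Gamma (2 * p - 1) /
      ‖Complex.Gamma (p + q * Complex.I)‖ ^ 2 := by
  have h1 := cauchyIntegral_div q hp
  have h2 := cauchyIntegral_zero hp
  have h3 := Real.Gamma_mul_Gamma_add_half (p - 1 / 2)
  have c0 := (cauchyIntegral_pos 0 hp).ne'
  have hG := (Real.Gamma_pos_of_pos (show 0 < 2 * p - 1 by linarith)).ne'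
  rw [show p - 1 / 2 + 1 / 2 = p by ring, show 2 * (p - 1 / 2) = 2 * p - 1 by ring] at h3
  rw [div_eq_iff c0, h2] at h1
  rw [h1]
  have h4 : (Real.Gamma (p - 1 / 2) * Real.Gamma p) ^ 2 =
      (Real.Gamma (2 * p - 1) * 2 ^ (1 - (2 * p - 1))) ^ 2 * Real.pi := by
    rw [h3, mul_pow, Real.sq_sqrt Real.pi_pos.le]
  have h5 : (2 : ℝ) ^ (2 * p - 2) * 2 ^ (1 - (2 * p - 1)) = 1 := by
    rw [← Real.rpow_add two_pos, show 2 * p - 2 + (1 - (2 * p - 1)) = 0 by ring, Real.rpow_zero]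
  rw [show 2 - 2 * p = 1 - (2 * p - 1) by ring]
  rw [div_mul_eq_mul_div]
  congr 1
  rw [mul_div_assoc', mul_div_assoc', div_eq_iff hG]
  linear_combination (2 : ℝ) ^ (2 * p - 2) * h4 + Real.Gamma (2 * p - 1) ^ 2 *
    2 ^ (1 - (2 * p - 1)) * Real.pi * h5

end CauchyWeight

/-! ### Three-term recurrences in a Newton basis -/

section HypergeometricRecurrences

open Finset

/-- The expansion `∑ k, (-1) ^ (n + k) * choose n k * T n k * ∏ i < k, (y + l i)`. -/
def newtonSum (l : ℕ → ℂ) (T : ℕ → ℕ → ℂ) (y : ℂ) (n : ℕ) : ℂ :=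
  ∑ k ∈ range (n + 1), (-1) ^ (n + k) * (n.choose k : ℂ) * T n k * ∏ i ∈ range k, (y + l i)

lemma newtonSum_eq_sum_range (l : ℕ → ℂ) (T : ℕ → ℕ → ℂ) (y : ℂ) {n M : ℕ} (h : n + 1 ≤ M) :
    newtonSum l T y n =
      ∑ k ∈ range M, (-1) ^ (n + k) * (n.choose k : ℂ) * T n k * ∏ i ∈ range k, (y + l i) := by
  refine sum_subset (range_subset_range.2 h) fun k _ hk => ?_
  rw [Nat.choose_eq_zero_of_lt (by simpa using hk)]
  simp

/-- Coefficients are compared in the basis `φ_k = ∏ i < k, (y + l i)`, where `y φ_k = φ_{k+1} - l_k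
φ_k`. The hypothesis `h` is the comparison after removal of the binomials, cleared of denominators
by `(n+1)(n+2)`; `htop` is the case `k = n + 2`. -/
lemma newtonSum_recurrence (l : ℕ → ℂ) (T : ℕ → ℕ → ℂ) (y B C : ℂ) (n : ℕ)
    (htop : T (n + 2) (n + 2) = T (n + 1) (n + 1))
    (h : ∀ k ≤ n + 1, ((n : ℂ) + 2) * (n + 1) * T (n + 2) k =
      (n + 1) * k * T (n + 1) (k - 1) + (l k + B) * ((n + 1) * (n + 2 - k)) * T (n + 1) k -
        C * ((n + 2 - k) * (n + 1 - k)) * T n k) :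
    newtonSum l T y (n + 2) = (y - B) * newtonSum l T y (n + 1) - C * newtonSum l T y n := by
  set c : ℕ → ℕ → ℂ := fun n k => (-1) ^ (n + k) * (n.choose k : ℂ) * T n k with hc
  set φ : ℕ → ℂ := fun k => ∏ i ∈ range k, (y + l i) with hφ
  have hn1 : (n : ℂ) + 1 ≠ 0 := by exact_mod_cast n.succ_ne_zero
  have hn2 : (n : ℂ) + 2 ≠ 0 := by exact_mod_cast (n + 1).succ_ne_zero
  have hchoose : ∀ k ≤ n + 1, ((n + 1).choose k : ℂ) * (n + 2) = ((n + 2).choose k : ℂ) * (n + 2 - k) ∧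
      (n.choose k : ℂ) * (n + 1) = ((n + 1).choose k : ℂ) * (n + 1 - k) := by
    intro k hk
    have h1 := congrArg (Nat.cast (R := ℂ)) (Nat.choose_mul_succ_eq (n + 1) k)
    have h2 := congrArg (Nat.cast (R := ℂ)) (Nat.choose_mul_succ_eq n k)
    rw [Nat.cast_mul, Nat.cast_mul, Nat.cast_sub (by omega)] at h1
    rw [Nat.cast_mul, Nat.cast_mul, Nat.cast_sub (by omega)] at h2
    push_cast at h1 h2
    exact ⟨by linear_combination h1, h2⟩
  have hzero : c (n + 2) 0 = -(l 0 + B) * c (n + 1) 0 - C * c n 0 := by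
    have h0 := h 0 (Nat.zero_le _)
    simp only [Nat.cast_zero, mul_zero, zero_mul, zero_add, sub_zero] at h0
    have h1 : T (n + 2) 0 = (l 0 + B) * T (n + 1) 0 - C * T n 0 :=
      mul_left_cancel₀ (mul_ne_zero hn2 hn1) (by linear_combination h0)
    simp only [hc, Nat.choose_zero_right, h1, pow_add]
    ring
  have hsucc : ∀ k, c (n + 2) (k + 1) =
      c (n + 1) k - (l (k + 1) + B) * c (n + 1) (k + 1) - C * c n (k + 1) := by
    intro k
    rcases lt_trichotomy k (n + 1) with hk | rfl | hk
    · have h0 := h (k + 1) (by omega)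
      obtain ⟨h1, h2⟩ := hchoose (k + 1) (by omega)
      have h3 := congrArg (Nat.cast (R := ℂ)) (Nat.add_one_mul_choose_eq (n + 1) k)
      push_cast at h0 h1 h2 h3
      have h4 : ((n + 2).choose (k + 1) : ℂ) * T (n + 2) (k + 1) =
          ((n + 1).choose k : ℂ) * T (n + 1) k + (l (k + 1) + B) *
            (((n + 1).choose (k + 1) : ℂ) * T (n + 1) (k + 1)) -
            C * ((n.choose (k + 1) : ℂ) * T n (k + 1)) := by
        refine mul_left_cancel₀ (mul_ne_zero hn2 hn1) ?_
        linear_combination ((n + 2).choose (k + 1) : ℂ) * h0 - (n + 1) * T (n + 1) k * h3 -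
          (l (k + 1) + B) * (n + 1) * T (n + 1) (k + 1) * h1 +
          C * T n (k + 1) * ((n + 2) * h2 + (n + 1 - (k + 1)) * h1)
      simp only [hc]
      have e1 : (-1 : ℂ) ^ (n + 2 + (k + 1)) = -(-1) ^ (n + k) := by ring
      have e2 : (-1 : ℂ) ^ (n + 1 + k) = -(-1) ^ (n + k) := by ring
      have e3 : (-1 : ℂ) ^ (n + 1 + (k + 1)) = (-1) ^ (n + k) := by ring
      have e4 : (-1 : ℂ) ^ (n + (k + 1)) = -(-1) ^ (n + k) := by ring
      rw [e1, e2, e3, e4]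
      linear_combination -(-1) ^ (n + k) * h4
    · simp only [hc, Nat.choose_self, htop, Nat.choose_eq_zero_of_lt (show n + 1 < n + 1 + 1 by omega),
        Nat.choose_eq_zero_of_lt (show n < n + 1 + 1 by omega)]
      simp only [show n + 2 = n + 1 + 1 by ring]
      ring_nf
    · simp [hc, Nat.choose_eq_zero_of_lt (show n + 2 < k + 1 by omega),
        Nat.choose_eq_zero_of_lt (show n + 1 < k + 1 by omega),
        Nat.choose_eq_zero_of_lt (show n + 1 < k by omega),
        Nat.choose_eq_zero_of_lt (show n < k + 1 by omega)]
  have hφs : ∀ k, φ (k + 1) = φ k * (y + l k) := fun k => prod_range_succ _ _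
  have s2 : newtonSum l T y (n + 2) = ∑ k ∈ range (n + 3), c (n + 2) k * φ k :=
    newtonSum_eq_sum_range l T y le_rfl
  have s1 : newtonSum l T y (n + 1) = ∑ k ∈ range (n + 3), c (n + 1) k * φ k :=
    newtonSum_eq_sum_range l T y (by omega)
  have s1' : newtonSum l T y (n + 1) = ∑ k ∈ range (n + 2), c (n + 1) k * φ k :=
    newtonSum_eq_sum_range l T y le_rfl
  have s0 : newtonSum l T y n = ∑ k ∈ range (n + 3), c n k * φ k :=
    newtonSum_eq_sum_range l T y (by omega)
  have hy : y * newtonSum l T y (n + 1) + ∑ k ∈ range (n + 3), l k * (c (n + 1) k * φ k) =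
      ∑ k ∈ range (n + 2), c (n + 1) k * φ (k + 1) := by
    have e : c (n + 1) (n + 2) = 0 := by simp [hc]
    rw [s1', sum_range_succ _ (n + 2), e, mul_sum]
    simp only [hφs]
    rw [zero_mul, mul_zero, add_zero, ← sum_add_distrib]
    exact sum_congr rfl fun k _ => by ring
  have key : newtonSum l T y (n + 2) = ∑ k ∈ range (n + 2), c (n + 1) k * φ (k + 1) -
      (∑ k ∈ range (n + 3), l k * (c (n + 1) k * φ k)) - B * newtonSum l T y (n + 1) -
      C * newtonSum l T y n := by
    rw [s2, s1, s0, mul_sum, mul_sum, sum_range_succ' _ (n + 2), sum_range_succ' _ (n + 2),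
      sum_range_succ' _ (n + 2), sum_range_succ' _ (n + 2), hzero]
    have : ∑ k ∈ range (n + 2), c (n + 2) (k + 1) * φ (k + 1) =
        ∑ k ∈ range (n + 2), c (n + 1) k * φ (k + 1) -
        ∑ k ∈ range (n + 2), l (k + 1) * (c (n + 1) (k + 1) * φ (k + 1)) -
        ∑ k ∈ range (n + 2), B * (c (n + 1) (k + 1) * φ (k + 1)) -
        ∑ k ∈ range (n + 2), C * (c n (k + 1) * φ (k + 1)) := by
      rw [← sum_sub_distrib, ← sum_sub_distrib, ← sum_sub_distrib]
      exact sum_congr rfl fun k _ => by rw [hsucc]; ring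
    rw [this]
    ring
  linear_combination key - hy

lemma poch_zero (u : ℂ) : poch u 0 = 1 := by simp [poch]

lemma poch_succ (u : ℂ) (m : ℕ) : poch u (m + 1) = poch u m * (u + m) :=
  ascPochhammer_succ_eval m u

lemma poch_succ_left (u : ℂ) (m : ℕ) : poch u (m + 1) = u * poch (u + 1) m := by
  simp [poch, ascPochhammer_succ_left, Polynomial.eval_comp]

lemma poch_neg_natCast (n k : ℕ) :
    poch (-n) k = (-1) ^ k * (n.choose k : ℂ) * (k.factorial : ℂ) := by
  rw [poch, ascPochhammer_eval_neg_eq_descPochhammer, descPochhammer_eval_eq_descFactorial,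
    Nat.descFactorial_eq_factorial_mul_choose]
  push_cast
  ring

lemma pochTail_succ (u : ℂ) {n k : ℕ} (h : k ≤ n) :
    poch (u + k) (n + 1 - k) = poch (u + k) (n - k) * (u + n) := by
  rw [Nat.succ_sub h, poch_succ, Nat.cast_sub h]
  ring

/-- The factor `k` must stay: at `k = 0` the truncated `k - 1` would falsify the identity without
it. -/
lemma natCast_mul_pochTail_pred (u : ℂ) {n k : ℕ} (h : k ≤ n) :
    (k : ℂ) * poch (u + (k - 1 : ℕ)) (n - (k - 1)) =
      k * (u + k - 1) * poch (u + k) (n - k) := by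
  cases k with
  | zero => simp
  | succ k =>
    rw [Nat.add_sub_cancel, show n - k = n - (k + 1) + 1 by omega, poch_succ_left]
    push_cast
    rw [← add_assoc]
    ring

/-- The factor `n + 1 - k` covers `k = n + 1`, where `n - k` truncates and the bare identity fails.
-/
lemma sub_mul_pochTail (u : ℂ) {n k : ℕ} (h : k ≤ n + 1) :
    ((n : ℂ) + 1 - k) * (poch (u + k) (n - k) * (u + n)) =
      (n + 1 - k) * poch (u + k) (n + 1 - k) := by
  rcases Nat.lt_or_eq_of_le h with h | rfl
  · rw [pochTail_succ u (by omega)]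
  · push_cast
    ring

end HypergeometricRecurrences

/-! ### Laguerre, continuous dual Hahn and Wilson recurrences -/

section ClassicalRecurrences

open Finset

lemma laguerreL_eq_newtonSum (n : ℕ) (a x : ℂ) : (n.factorial : ℂ) * laguerreL n a x =
    (-1) ^ n * newtonSum 0 (fun n k => poch (a + 1 + k) (n - k)) x n := by
  rw [laguerreL, newtonSum, mul_sum, mul_sum]
  refine sum_congr rfl fun k hk => ?_
  have hk' : k ≤ n := Nat.lt_succ_iff.1 (mem_range.1 hk)
  have h1 : (n.factorial : ℂ) = n.choose k * k.factorial * (n - k).factorial := by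
    exact_mod_cast (Nat.choose_mul_factorial_mul_factorial hk').symm
  have h2 : (k.factorial : ℂ) ≠ 0 := by exact_mod_cast k.factorial_ne_zero
  have h3 : ((n - k).factorial : ℂ) ≠ 0 := by exact_mod_cast (n - k).factorial_ne_zero
  have h4 : ((-1 : ℂ)) ^ n * (-1) ^ (n + k) = (-1) ^ k := by
    rw [pow_add, ← mul_assoc, ← pow_add, Even.neg_one_pow ⟨n, rfl⟩, one_mul]
  simp only [Pi.zero_apply, add_zero, prod_const, card_range]
  rw [h1, neg_pow x, ← h4, show a + k + 1 = a + 1 + k by ring]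
  field_simp

lemma newtonSum_laguerre_recurrence (a y : ℂ) (n : ℕ) :
    newtonSum 0 (fun n k => poch (a + 1 + k) (n - k)) y (n + 2) =
      (y - (2 * n + 3 + a)) * newtonSum 0 (fun n k => poch (a + 1 + k) (n - k)) y (n + 1) -
      ((n + 1) * (n + 1 + a)) * newtonSum 0 (fun n k => poch (a + 1 + k) (n - k)) y n := by
  refine newtonSum_recurrence _ _ _ _ _ _ (by simp [poch_zero]) fun k hk => ?_
  have h2 := pochTail_succ (a + 1) hk
  have h1 := natCast_mul_pochTail_pred (a + 1) hk
  have h0 := sub_mul_pochTail (a + 1) hk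
  push_cast at h0 h1 h2 ⊢
  rw [show n + 2 - k = n + 1 + 1 - k by omega, h2]
  simp only [Pi.zero_apply]
  linear_combination -(n + 1 : ℂ) * h1 + (n + 1) * (n + 2 - k) * h0

lemma dualHahn_eq_newtonSum (n : ℕ) (y a b c : ℂ) : dualHahn n y a b c =
    (-1) ^ n * newtonSum (fun i => (a + i) ^ 2)
      (fun n k => poch (a + b + k) (n - k) * poch (a + c + k) (n - k)) y n := by
  rw [dualHahn, newtonSum, mul_sum]
  refine sum_congr rfl fun k _ => ?_
  have h2 : (k.factorial : ℂ) ≠ 0 := by exact_mod_cast k.factorial_ne_zero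
  have h4 : ((-1 : ℂ)) ^ n * (-1) ^ (n + k) = (-1) ^ k := by
    rw [pow_add, ← mul_assoc, ← pow_add, Even.neg_one_pow ⟨n, rfl⟩, one_mul]
  rw [poch_neg_natCast, ← h4]
  simp only [add_comm y]
  field_simp

/-- With `A_n = (n+a+b)(n+a+c)` and `C_n = n(n+b+c-1)` the constants are `A_{n+1} + C_{n+1} - a²`
and `A_n C_{n+1}`. -/
lemma newtonSum_dualHahn_recurrence (a b c y : ℂ) (n : ℕ) :
    newtonSum (fun i => (a + i) ^ 2)
      (fun n k => poch (a + b + k) (n - k) * poch (a + c + k) (n - k)) y (n + 2) =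
    (y - ((n + 1 + a + b) * (n + 1 + a + c) + (n + 1) * (n + b + c) - a ^ 2)) *
      newtonSum (fun i => (a + i) ^ 2)
        (fun n k => poch (a + b + k) (n - k) * poch (a + c + k) (n - k)) y (n + 1) -
    ((n + a + b) * (n + a + c) * ((n + 1) * (n + b + c))) * newtonSum (fun i => (a + i) ^ 2)
        (fun n k => poch (a + b + k) (n - k) * poch (a + c + k) (n - k)) y n := by
  refine newtonSum_recurrence _ _ _ _ _ _ (by simp [poch_zero]) fun k hk => ?_
  have h2 := pochTail_succ (a + b) hk
  have h1 := natCast_mul_pochTail_pred (a + b) hk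
  have h0 := sub_mul_pochTail (a + b) hk
  have h2' := pochTail_succ (a + c) hk
  have h1' := natCast_mul_pochTail_pred (a + c) hk
  have h0' := sub_mul_pochTail (a + c) hk
  have e1 : (k : ℂ) * (poch (a + b + (k - 1 : ℕ)) (n + 1 - (k - 1)) *
      poch (a + c + (k - 1 : ℕ)) (n + 1 - (k - 1))) = k * ((a + b + k - 1) * (a + c + k - 1)) *
      (poch (a + b + k) (n + 1 - k) * poch (a + c + k) (n + 1 - k)) := by
    rcases eq_or_ne (k : ℂ) 0 with hk0 | hk0
    · simp [hk0]
    · refine mul_left_cancel₀ hk0 ?_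
      linear_combination (k * poch (a + c + (k - 1 : ℕ)) (n + 1 - (k - 1)) : ℂ) * h1 +
        (k * (a + b + k - 1) * poch (a + b + k) (n + 1 - k)) * h1'
  have e0 : ((n : ℂ) + 1 - k) * (poch (a + b + k) (n - k) * poch (a + c + k) (n - k) *
      ((a + b + n) * (a + c + n))) =
      (n + 1 - k) * (poch (a + b + k) (n + 1 - k) * poch (a + c + k) (n + 1 - k)) := by
    rcases eq_or_ne ((n : ℂ) + 1 - k) 0 with hk0 | hk0
    · simp [hk0]
    · refine mul_left_cancel₀ hk0 ?_
      linear_combination ((n + 1 - k) * poch (a + c + k) (n - k) * (a + c + n) : ℂ) * h0 +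
        ((n + 1 - k) * poch (a + b + k) (n + 1 - k)) * h0'
  push_cast at e0 e1 h2 h2' ⊢
  rw [show n + 2 - k = n + 1 + 1 - k by omega, h2, h2']
  linear_combination -(n + 1 : ℂ) * e1 + (n + 1) * (n + b + c) * (n + 2 - k) * e0

lemma poch_add (u : ℂ) (m k : ℕ) : poch u (m + k) = poch u m * poch (u + m) k := by
  induction k with
  | zero => simp [poch_zero]
  | succ k ih =>
    rw [← add_assoc, poch_succ, poch_succ, ih]
    push_cast
    ring

lemma poch_ne_zero {u : ℂ} {m : ℕ} (h : ∀ i < m, u + i ≠ 0) : poch u m ≠ 0 := by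
  induction m with
  | zero => simp [poch_zero]
  | succ m ih =>
    rw [poch_succ]
    exact mul_ne_zero (ih fun i hi => h i (by omega)) (h m (by omega))

/-- The coefficients of the monic Wilson polynomials with parameters `a, b, 1/2, 0`. -/
def wilsonCoeff (a b : ℂ) (n k : ℕ) : ℂ :=
  poch (a + b + k) (n - k) * poch (a + 1 / 2 + k) (n - k) * poch (a + k) (n - k) /
    poch (n + (a + b - 1 / 2) + k) (n - k)

/-- The monic Wilson polynomial with parameters `a, b, 1/2, 0`, up to sign. -/
def wilsonMonic (a b y : ℂ) (n : ℕ) : ℂ := newtonSum (fun i => (a + i) ^ 2) (wilsonCoeff a b) y n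

/-- The coefficients of the three-term recurrence of the Wilson polynomials with parameters
`a, b, 1/2, 0` are products and sums of these. -/
def wilsonGamma (a b : ℂ) (j : ℕ) : ℂ :=
  if j = 0 then a * b / (2 * (a + b + 1 / 2)) else
  (j + 1) * (j + 2 * a) * (j + 2 * b) * (j + 2 * a + 2 * b - 1) /
    (16 * ((j + (a + b - 1 / 2)) * (j + 1 + (a + b - 1 / 2))))

/-- For `c = 1/2`, `d = 0` the symbol `(n+a+b+c+d-1)_n` is, up to the sign `(-1)^n`, the leading
coefficient in `y`. -/
lemma wilson_eq_wilsonMonic (n : ℕ) (y a b : ℂ)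
    (h : poch (n + (a + b - 1 / 2)) n ≠ 0) :
    wilson n y a b (1 / 2) 0 / poch (n + (a + b - 1 / 2)) n = (-1) ^ n * wilsonMonic a b y n := by
  rw [wilson, wilsonMonic, newtonSum, mul_sum, sum_div]
  refine sum_congr rfl fun k hk => ?_
  have hk' : k ≤ n := Nat.lt_succ_iff.1 (mem_range.1 hk)
  have h2 : (k.factorial : ℂ) ≠ 0 := by exact_mod_cast k.factorial_ne_zero
  have h4 : ((-1 : ℂ)) ^ n * (-1) ^ (n + k) = (-1) ^ k := by
    rw [pow_add, ← mul_assoc, ← pow_add, Even.neg_one_pow ⟨n, rfl⟩, one_mul]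
  have h5 := poch_add (n + (a + b - 1 / 2)) k (n - k)
  rw [Nat.add_sub_cancel' hk'] at h5
  rw [h5] at h
  have h6 := left_ne_zero_of_mul h
  have h7 := right_ne_zero_of_mul h
  rw [h5, poch_neg_natCast, ← h4, wilsonCoeff,
    show (n : ℂ) + a + b + 1 / 2 + 0 - 1 = n + (a + b - 1 / 2) by ring, add_zero]
  simp only [add_comm y]
  generalize poch (n + (a + b - 1 / 2)) k = P at *
  generalize poch (n + (a + b - 1 / 2) + k) (n - k) = Q at *
  field_simp

/-- The coefficientwise form of the recurrence of the Wilson polynomials. -/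
lemma wilson_coefficient_identity (n k a σ : ℂ) (hs : σ + n + k ≠ 0) (j0 : 2 * n + σ ≠ 0)
    (j1 : 2 * n + 1 + σ ≠ 0) (j2 : 2 * n + 2 + σ ≠ 0) (j3 : 2 * n + 3 + σ ≠ 0) :
    (n + 2) * (n + 1) *
      ((σ + 1 / 2 + (n + 1)) * (a + 1 / 2 + (n + 1)) * (a + (n + 1)) * (σ + n + k + 1) /
        ((2 * n + σ + 2) * (2 * n + σ + 3))) =
      (n + 1) * (k * ((σ + 1 / 2 + k - 1) * (a + 1 / 2 + k - 1) * (a + k - 1)) / (σ + n + k)) +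
      ((a + k) ^ 2 + ((2 * n + 3) * (n + 1 + a) * (2 * n + 3 + 2 * σ - 2 * a) * (n + 1 + σ) /
        (4 * ((2 * n + 2 + σ) * (2 * n + 3 + σ))) +
        (n + 1) * (2 * n + 1 + 2 * a) * (n + 1 + σ - a) * (2 * n + 1 + 2 * σ) /
        (4 * ((2 * n + 1 + σ) * (2 * n + 2 + σ))))) * ((n + 1) * (n + 2 - k)) -
      (n + 1) * (n + 1 + σ - a) * (2 * n + 1) * (2 * n + 1 + 2 * σ - 2 * a) * (n + σ) /
        (4 * ((2 * n + σ) * (2 * n + 1 + σ) * ((2 * n + 1 + σ) * (2 * n + 2 + σ)))) * (n + 2 - k) *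
        ((n + 1 - k) * ((2 * n + σ) * (2 * n + σ + 1)) / (σ + n + k)) := by
  -- The linear denominators stay opaque while fractions are cleared, and are expanded only for the
  -- final polynomial identity.
  obtain ⟨d1, hd1⟩ : ∃ d1, d1 = 2 * n + 1 + σ := ⟨_, rfl⟩
  obtain ⟨d0, hd0⟩ : ∃ d0, d0 = 2 * n + σ := ⟨_, rfl⟩
  obtain ⟨d2, hd2⟩ : ∃ d2, d2 = 2 * n + 2 + σ := ⟨_, rfl⟩
  obtain ⟨d3, hd3⟩ : ∃ d3, d3 = 2 * n + 3 + σ := ⟨_, rfl⟩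
  obtain ⟨s, hs'⟩ : ∃ s, s = σ + n + k := ⟨_, rfl⟩
  rw [add_right_comm (2 * n) σ 2, add_right_comm (2 * n) σ 3, add_right_comm (2 * n) σ 1,
    ← hd1, ← hd2, ← hd3, ← hd0, ← hs']
  rw [← hd1] at j1
  rw [← hd2] at j2
  rw [← hd3] at j3
  rw [← hd0] at j0
  rw [← hs'] at hs
  field_simp
  subst hd1 hd2 hd3 hd0 hs'
  ring

lemma wilsonMonic_recurrence_of_one_le (a b y : ℂ) {n : ℕ} (hn : 1 ≤ n)
    (h : ∀ i : ℕ, 1 ≤ i → i ≤ 2 * n + 3 → a + b - 1 / 2 + i ≠ 0) :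
    wilsonMonic a b y (n + 2) =
      (y - (wilsonGamma a b (2 * n + 2) + wilsonGamma a b (2 * n + 1))) *
        wilsonMonic a b y (n + 1) -
      wilsonGamma a b (2 * n + 1) * wilsonGamma a b (2 * n) * wilsonMonic a b y n := by
  refine newtonSum_recurrence _ _ _ _ _ _ (by simp [wilsonCoeff, poch_zero]) fun k hk => ?_
  -- All denominators are `σ` plus an integer expression in `n` and `k`, so `σ` replaces the
  -- parameter `b`.
  obtain ⟨σ, hσ⟩ : ∃ σ, σ = a + b - 1 / 2 := ⟨_, rfl⟩
  obtain rfl : b = σ + 1 / 2 - a := by rw [hσ]; ring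
  have hσ' : σ + 1 / 2 - 1 / 2 = σ := by ring
  have hab : a + (σ + 1 / 2 - a) = σ + 1 / 2 := by ring
  simp only [wilsonCoeff, wilsonGamma, hab, hσ', if_neg (show 2 * n + 2 ≠ 0 by omega),
    if_neg (show 2 * n + 1 ≠ 0 by omega), if_neg (show 2 * n ≠ 0 by omega)] at h ⊢
  set D := poch (((n + 1 : ℕ) : ℂ) + σ + k) (n + 1 - k) with hD
  have hs : σ + n + k ≠ 0 := by
    have := h (n + k) (by omega) (by omega)
    push_cast at this
    rwa [← add_assoc] at this
  have hs1 : σ + n + k + 1 ≠ 0 := by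
    have := h (n + k + 1) (by omega) (by omega)
    push_cast at this
    intro h0
    exact this (by linear_combination h0)
  have hj : ∀ i : ℕ, i ≤ 3 → 2 * (n : ℂ) + σ + i ≠ 0 := by
    intro i hi h0
    have := h (2 * n + i) (by omega) (by omega)
    push_cast at this
    exact this (by linear_combination h0)
  have j0 := hj 0 (by omega)
  have j1 := hj 1 (by omega)
  have j2 := hj 2 (by omega)
  have j3 := hj 3 (by omega)
  push_cast at j0 j1 j2 j3
  rw [add_zero] at j0
  have hD0 : D ≠ 0 := poch_ne_zero fun i hi h0 => by
    refine h (n + 1 + k + i) (by omega) (by omega) ?_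
    push_cast at h0 ⊢
    linear_combination h0
  -- The Pochhammer denominators at levels `n + 2`, `n + 1` (with `k - 1`) and `n` are all expressed
  -- through `D`.
  have hD2 : (σ + n + k + 1) * poch (((n + 2 : ℕ) : ℂ) + σ + k) (n + 2 - k) =
      D * ((2 * n + σ + 2) * (2 * n + σ + 3)) := by
    have e1 := poch_succ_left (((n + 1 : ℕ) : ℂ) + σ + k) (n + 1 - k + 1)
    rw [poch_succ, poch_succ, ← hD, show n + 1 - k + 1 = n + 2 - k by omega] at e1
    push_cast [Nat.cast_sub hk, Nat.cast_sub (show k ≤ n + 2 by omega)] at e1 ⊢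
    rw [show (n : ℂ) + 1 + σ + k + 1 = n + 2 + σ + k by ring] at e1
    linear_combination -e1
  have hD1 : (k : ℂ) * poch (((n + 1 : ℕ) : ℂ) + σ + (k - 1 : ℕ)) (n + 1 - (k - 1)) =
      k * ((σ + n + k) * D) := by
    rcases Nat.eq_zero_or_pos k with rfl | hk0
    · simp
    · congr 1
      rw [show n + 1 - (k - 1) = n + 1 - k + 1 by omega, poch_succ_left, hD,
        Nat.cast_sub (by omega)]
      push_cast
      rw [show (n : ℂ) + 1 + σ + (k - 1) + 1 = n + 1 + σ + k by ring]
      ring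
  have hDn : ((n : ℂ) + 1 - k) * (poch ((n : ℂ) + σ + k) (n - k) *
      ((2 * n + σ) * (2 * n + σ + 1))) = (n + 1 - k) * ((σ + n + k) * D) := by
    rcases Nat.lt_or_eq_of_le hk with hk0 | rfl
    · congr 1
      have e1 := poch_succ_left ((n : ℂ) + σ + k) (n - k + 1)
      rw [poch_succ, poch_succ, show n - k + 1 = n + 1 - k by omega] at e1
      push_cast [Nat.cast_sub hk, Nat.cast_sub (show k ≤ n by omega)] at e1 hD
      rw [hD, show (n : ℂ) + 1 + σ + k = n + σ + k + 1 by ring]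
      linear_combination e1
    · push_cast
      ring
  have q : ∀ u : ℂ, poch (u + k) (n + 2 - k) = poch (u + k) (n + 1 - k) * (u + (n + 1)) := by
    intro u
    have := pochTail_succ u hk
    push_cast at this
    rwa [show n + 1 + 1 - k = n + 2 - k by omega] at this
  -- `P / D` is the common factor of the three levels; once `t2`, `t1`, `t0` have extracted it, the
  -- rational identity `wilson_coefficient_identity` remains.
  set P := poch (σ + 1 / 2 + k) (n + 1 - k) * poch (a + 1 / 2 + k) (n + 1 - k) *
    poch (a + k) (n + 1 - k) with hP
  have t2 : poch (σ + 1 / 2 + k) (n + 2 - k) * poch (a + 1 / 2 + k) (n + 2 - k) *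
      poch (a + k) (n + 2 - k) / poch (((n + 2 : ℕ) : ℂ) + σ + k) (n + 2 - k) =
      P / D * ((σ + 1 / 2 + (n + 1)) * (a + 1 / 2 + (n + 1)) * (a + (n + 1)) * (σ + n + k + 1) /
        ((2 * n + σ + 2) * (2 * n + σ + 3))) := by
    have hne : poch (((n + 2 : ℕ) : ℂ) + σ + k) (n + 2 - k) ≠ 0 := by
      intro h0
      rw [h0, mul_zero] at hD2
      exact mul_ne_zero hD0 (mul_ne_zero j2 j3) hD2.symm
    rw [q, q, q, div_mul_div_comm, div_eq_div_iff hne (mul_ne_zero hD0 (mul_ne_zero j2 j3)), ← hD2]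
    ring
  have t1 : (k : ℂ) * (poch (σ + 1 / 2 + (k - 1 : ℕ)) (n + 1 - (k - 1)) *
      poch (a + 1 / 2 + (k - 1 : ℕ)) (n + 1 - (k - 1)) *
      poch (a + (k - 1 : ℕ)) (n + 1 - (k - 1)) /
      poch (((n + 1 : ℕ) : ℂ) + σ + (k - 1 : ℕ)) (n + 1 - (k - 1))) =
      P / D * (k * ((σ + 1 / 2 + k - 1) * (a + 1 / 2 + k - 1) * (a + k - 1)) / (σ + n + k)) := by
    rcases eq_or_ne (k : ℂ) 0 with hk0 | hk0
    · simp [hk0]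
    · have r : ∀ u : ℂ, poch (u + (k - 1 : ℕ)) (n + 1 - (k - 1)) =
          (u + k - 1) * poch (u + k) (n + 1 - k) := fun u =>
        mul_left_cancel₀ hk0 (by rw [natCast_mul_pochTail_pred u hk]; ring)
      rw [r, r, r, mul_left_cancel₀ hk0 hD1, hP]
      field_simp
  have t0 : ((n : ℂ) + 1 - k) * ((σ + 1 / 2 + n) * (a + 1 / 2 + n) * (a + n)) *
      (poch (σ + 1 / 2 + k) (n - k) * poch (a + 1 / 2 + k) (n - k) * poch (a + k) (n - k) /
      poch ((n : ℂ) + σ + k) (n - k)) =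
      P / D * ((n + 1 - k) * ((2 * n + σ) * (2 * n + σ + 1)) / (σ + n + k)) := by
    rcases eq_or_ne ((n : ℂ) + 1 - k) 0 with hk0 | hk0
    · simp [hk0]
    · have r : ∀ u : ℂ, poch (u + k) (n + 1 - k) = poch (u + k) (n - k) * (u + n) := fun u =>
        (mul_left_cancel₀ hk0 (sub_mul_pochTail u hk)).symm
      have hDn' := mul_left_cancel₀ hk0 hDn
      have hne : poch ((n : ℂ) + σ + k) (n - k) ≠ 0 := by
        intro h0
        rw [h0, zero_mul] at hDn'
        exact mul_ne_zero hs hD0 hDn'.symm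
      rw [hP, r, r, r, div_mul_div_comm, mul_div_assoc', div_eq_div_iff hne (mul_ne_zero hD0 hs),
        mul_comm D, ← hDn']
      ring
  rw [t2]
  generalize P / D = R at *
  have j1' : 2 * (n : ℂ) + 1 + σ ≠ 0 := by rwa [add_right_comm]
  have j2' : 2 * (n : ℂ) + 2 + σ ≠ 0 := by rwa [add_right_comm]
  have j3' : 2 * (n : ℂ) + 3 + σ ≠ 0 := by rwa [add_right_comm]
  have g2 : (((2 * n + 2 : ℕ) : ℂ) + 1) * ((2 * n + 2 : ℕ) + 2 * a) *
      ((2 * n + 2 : ℕ) + 2 * (σ + 1 / 2 - a)) * ((2 * n + 2 : ℕ) + 2 * a + 2 * (σ + 1 / 2 - a) - 1) /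
      (16 * (((2 * n + 2 : ℕ) + σ) * ((2 * n + 2 : ℕ) + 1 + σ))) =
      (2 * n + 3) * (n + 1 + a) * (2 * n + 3 + 2 * σ - 2 * a) * (n + 1 + σ) /
        (4 * ((2 * n + 2 + σ) * (2 * n + 3 + σ))) := by
    push_cast
    rw [div_eq_div_iff (by rw [show 2 * (n : ℂ) + 2 + 1 + σ = 2 * n + 3 + σ by ring]; simp [j2', j3'])
      (by simp [j2', j3'])]
    ring
  have g1 : (((2 * n + 1 : ℕ) : ℂ) + 1) * ((2 * n + 1 : ℕ) + 2 * a) *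
      ((2 * n + 1 : ℕ) + 2 * (σ + 1 / 2 - a)) * ((2 * n + 1 : ℕ) + 2 * a + 2 * (σ + 1 / 2 - a) - 1) /
      (16 * (((2 * n + 1 : ℕ) + σ) * ((2 * n + 1 : ℕ) + 1 + σ))) =
      (n + 1) * (2 * n + 1 + 2 * a) * (n + 1 + σ - a) * (2 * n + 1 + 2 * σ) /
        (4 * ((2 * n + 1 + σ) * (2 * n + 2 + σ))) := by
    push_cast
    rw [div_eq_div_iff (by rw [show 2 * (n : ℂ) + 1 + 1 + σ = 2 * n + 2 + σ by ring]; simp [j1', j2'])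
      (by simp [j1', j2'])]
    ring
  have g0 : (((2 * n : ℕ) : ℂ) + 1) * ((2 * n : ℕ) + 2 * a) *
      ((2 * n : ℕ) + 2 * (σ + 1 / 2 - a)) * ((2 * n : ℕ) + 2 * a + 2 * (σ + 1 / 2 - a) - 1) /
      (16 * (((2 * n : ℕ) + σ) * ((2 * n : ℕ) + 1 + σ))) =
      (2 * n + 1) * (n + a) * (2 * n + 1 + 2 * σ - 2 * a) * (n + σ) /
        (4 * ((2 * n + σ) * (2 * n + 1 + σ))) := by
    push_cast
    rw [div_eq_div_iff (by simp [j0, j1']) (by simp [j0, j1'])]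
    ring
  rw [g2, g1, g0]
  have hC : (n + 1) * (2 * n + 1 + 2 * a) * (n + 1 + σ - a) * (2 * n + 1 + 2 * σ) /
        (4 * ((2 * n + 1 + σ) * (2 * n + 2 + σ))) *
      ((2 * n + 1) * (n + a) * (2 * n + 1 + 2 * σ - 2 * a) * (n + σ) /
        (4 * ((2 * n + σ) * (2 * n + 1 + σ)))) =
      (n + 1) * (n + 1 + σ - a) * (2 * n + 1) * (2 * n + 1 + 2 * σ - 2 * a) * (n + σ) /
        (4 * ((2 * n + σ) * (2 * n + 1 + σ) * ((2 * n + 1 + σ) * (2 * n + 2 + σ)))) *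
      ((σ + 1 / 2 + n) * (a + 1 / 2 + n) * (a + n)) := by
    field_simp
    ring
  have hid := wilson_coefficient_identity (n : ℂ) k a σ hs j0 j1' j2' j3'
  rw [hC]
  linear_combination R * hid - (n + 1) * t1 + (n + 1) * (n + 1 + σ - a) * (2 * n + 1) *
    (2 * n + 1 + 2 * σ - 2 * a) * (n + σ) /
        (4 * ((2 * n + σ) * (2 * n + 1 + σ) * ((2 * n + 1 + σ) * (2 * n + 2 + σ)))) *
        (n + 2 - k) * t0

lemma wilsonMonic_zero (a b y : ℂ) : wilsonMonic a b y 0 = 1 := by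
  simp [wilsonMonic, newtonSum, wilsonCoeff, poch_zero]

lemma wilsonMonic_one (a b y : ℂ) (h : a + b + 1 / 2 ≠ 0) :
    wilsonMonic a b y 1 = y - wilsonGamma a b 0 := by
  have h' : 1 + (a + b - 1 / 2) ≠ 0 := fun h0 => h (by linear_combination h0)
  simp only [wilsonMonic, newtonSum, wilsonCoeff, wilsonGamma, sum_range_succ, range_zero, sum_empty,
    prod_range_succ, prod_empty, if_true, poch_succ, poch_zero, Nat.sub_self, Nat.sub_zero,
    Nat.choose_self, Nat.choose_zero_right]
  push_cast
  simp only [add_zero, zero_add, one_mul, pow_one, mul_one]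
  rw [show 1 + (a + b - 1 / 2) = a + b + 1 / 2 by ring]
  generalize hd : a + b + 1 / 2 = d at *
  field_simp
  rw [← hd]
  ring

lemma wilsonMonic_two (a b y : ℂ) (h1 : a + b + 1 / 2 ≠ 0) (h2 : a + b + 3 / 2 ≠ 0)
    (h3 : a + b + 5 / 2 ≠ 0) : wilsonMonic a b y 2 =
      (y - (wilsonGamma a b 2 + wilsonGamma a b 1)) * wilsonMonic a b y 1 -
        wilsonGamma a b 1 * wilsonGamma a b 0 := by
  rw [wilsonMonic_one a b y h1]
  simp only [wilsonMonic, newtonSum, wilsonCoeff, wilsonGamma, sum_range_succ, range_zero, sum_empty,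
    prod_range_succ, prod_empty, if_true, poch_succ, poch_zero, Nat.sub_self, Nat.sub_zero,
    Nat.choose_self, Nat.choose_zero_right, Nat.choose_one_right, one_ne_zero, two_ne_zero, if_false,
    show 2 - 1 = 1 by norm_num]
  push_cast
  simp only [add_zero, zero_add, one_mul, mul_one]
  rw [show 2 + (a + b - 1 / 2) = a + b + 3 / 2 by ring,
    show 2 + 1 + (a + b - 1 / 2) = a + b + 5 / 2 by ring,
    show 1 + (a + b - 1 / 2) = a + b + 1 / 2 by ring,
    show 1 + 1 + (a + b - 1 / 2) = a + b + 3 / 2 by ring]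
  have e1 : a + b + 3 / 2 + 1 = a + b + 5 / 2 := by ring
  rw [e1]
  obtain ⟨d, hd⟩ : ∃ d, d = a + b + 1 / 2 := ⟨_, rfl⟩
  obtain ⟨d2, hd2⟩ : ∃ d, d = a + b + 3 / 2 := ⟨_, rfl⟩
  obtain ⟨d3, hd3⟩ : ∃ d, d = a + b + 5 / 2 := ⟨_, rfl⟩
  rw [← hd] at h1
  rw [← hd2] at h2
  rw [← hd3] at h3
  rw [← hd, ← hd2, ← hd3]
  field_simp
  subst hd hd2 hd3
  ring

/-- The three-term recurrence of the Wilson polynomials with parameters `a, b, 1/2, 0`. -/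
lemma wilsonMonic_recurrence (a b y : ℂ) (n : ℕ)
    (h : ∀ i : ℕ, 1 ≤ i → i ≤ 2 * n + 3 → a + b - 1 / 2 + i ≠ 0) :
    wilsonMonic a b y (n + 2) =
      (y - (wilsonGamma a b (2 * n + 2) + wilsonGamma a b (2 * n + 1))) *
        wilsonMonic a b y (n + 1) -
      wilsonGamma a b (2 * n + 1) * wilsonGamma a b (2 * n) * wilsonMonic a b y n := by
  -- The value `a + b = 1/2` is allowed. The generic formula for `γ_0` then reads `0/0`, so
  -- `wilsonGamma` takes its cancelled form and `n = 0` is treated separately.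
  rcases Nat.eq_zero_or_pos n with rfl | hn
  · have h1 := h 1 le_rfl (by norm_num)
    have h2 := h 2 (by norm_num) (by norm_num)
    have h3 := h 3 (by norm_num) (by norm_num)
    push_cast at h1 h2 h3
    rw [wilsonMonic_zero, mul_one]
    exact wilsonMonic_two a b y (fun h0 => h1 (by linear_combination h0))
      (fun h0 => h2 (by linear_combination h0)) (fun h0 => h3 (by linear_combination h0))
  · exact wilsonMonic_recurrence_of_one_le a b y hn h

end ClassicalRecurrences

/-! ### Products of norms and Gamma quotients -/

section GammaQuotients

open Finset

/-- Applied to norms, the telescoping converts the product of the `h₁(j)`, built from `r_{2j}`, into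
that of the `h₄(2j+1)`, built from `r_{2j+2}`. -/
lemma prod_range_even_shift (r : ℕ → ℂ) (N : ℕ) :
    (∏ j ∈ range N, r (2 * j + 2)) * r 0 = (∏ j ∈ range N, r (2 * j)) * r (2 * N) := by
  induction N with
  | zero => simp
  | succ N ih =>
    rw [prod_range_succ, prod_range_succ, mul_right_comm, ih]
    ring_nf

lemma Gamma_add_natCast {x : ℝ} (hx : 0 < x) (n : ℕ) :
    (Real.Gamma (x + n) : ℂ) = poch x n * Real.Gamma x := by
  induction n with
  | zero => simp [poch_zero]
  | succ n ih =>
    have h : x + n ≠ 0 := by positivity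
    rw [Nat.cast_succ, ← add_assoc, Real.Gamma_add_one h, Complex.ofReal_mul, ih, poch_succ]
    push_cast
    ring

lemma poch_two_mul (u : ℂ) (n : ℕ) :
    poch u (2 * n) = 4 ^ n * (poch (u / 2) n * poch ((u + 1) / 2) n) := by
  induction n with
  | zero => simp [poch_zero]
  | succ n ih =>
    rw [show 2 * (n + 1) = 2 * n + 1 + 1 by ring, poch_succ, poch_succ, poch_succ, poch_succ, ih]
    push_cast
    ring

lemma poch_reflect (u : ℂ) (m : ℕ) : poch u m = (-1) ^ m * poch (1 - u - m) m := by
  induction m with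
  | zero => simp [poch_zero]
  | succ m ih =>
    rw [poch_succ, poch_succ_left (1 - u - (m + 1 : ℕ)), ih]
    push_cast
    rw [show 1 - u - ((m : ℂ) + 1) + 1 = 1 - u - m by ring]
    ring

end GammaQuotients

/-! ### Partition functions of the Gaussian and Laguerre weights -/

section GaussLaguerre

open Polynomial Filter Topology

theorem gauss_grandPartition (N : ℕ) (X : ℂ) :
    PartitionConverges volume (potentialOne gaussV gaussF) (potentialTwo gaussV gaussF) N ∧
      grandPartition volume (potentialOne gaussV gaussF) (potentialTwo gaussV gaussF) N X =
        2 ^ N * gaussAlpha X N * ∏ j ∈ Finset.range N, (gaussH4 (2 * j + 1) : ℂ) := by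
  have hw := gauss_isClassicalWeight N
  -- The squared norms of the monic Hermite polynomials.
  set r : ℕ → ℂ := fun j => (j.factorial : ℂ) * (Real.sqrt Real.pi : ℂ) / 2 ^ j with hr
  have hpi : (Real.sqrt Real.pi : ℂ) ≠ 0 :=
    Complex.ofReal_ne_zero.2 (Real.sqrt_pos.2 Real.pi_pos).ne'
  have hr0 : ∀ j, r j ≠ 0 := fun j =>
    div_ne_zero (mul_ne_zero (mod_cast j.factorial_ne_zero) hpi) (pow_ne_zero _ two_ne_zero)
  have c1 : (-(C 2 * Polynomial.X) : ℂ[X]).coeff 1 = -2 := by simp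
  have c2 : (1 : ℂ[X]).coeff 2 = 0 := by simp [coeff_one]
  have hnorm : ∀ j < 2 * N, orthoNorm 1 (-(C 2 * Polynomial.X))
      (momentFunctional (volume.restrict Set.univ) fun x => Real.exp (-2 * gaussV x)) j = r j := by
    intro j hj
    rw [hw.orthoNorm_eq j hj, gauss_mass, rodriguesLead, c1, c2]
    simp only [mul_zero, add_zero, Finset.prod_const, Finset.card_range, hr]
    rw [neg_pow (2 : ℂ), mul_inv, div_eq_mul_inv, ← inv_pow, show ((-1 : ℂ))⁻¹ = -1 by norm_num,
      ← mul_assoc, mul_right_comm _ _ ((-1 : ℂ) ^ j), ← mul_pow]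
    norm_num
    ring
  have hsk : ∀ j, skewLead 1 (-(C 2 * Polynomial.X)) j = -1 := fun j => by
    rw [skewLead, c1, c2]
    norm_num
  refine ⟨by simpa using hw.partitionConverges, ?_⟩
  -- Here `γ_{2i+2} + γ_{2i+1} = 2i + 5/2` and `γ_{2i+1} γ_{2i} = (i+1)(i+1/2)`: the Laguerre
  -- recurrence with parameter `-1/2`.
  have h := hw.grandPartition_eq (fun i _ => by rw [c1, c2]; norm_num)
    (fun j hj => by rw [hnorm j hj]; exact hr0 j) X (fun j => ((j : ℂ) + 1) / 2)
    (fun n => (n.factorial : ℂ) * laguerreL n (-1 / 2) (-X ^ 2)) (fun j hj => by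
      rw [classicalGamma, hnorm j (by omega), hnorm (j + 1) hj, hsk, div_eq_mul_inv (r _)]
      simp only [hr, Nat.factorial_succ]
      have := hr0 j
      have : (j.factorial : ℂ) ≠ 0 := mod_cast j.factorial_ne_zero
      push_cast
      field_simp
      ring) (by simp [laguerreL, poch_zero]) (fun _ => by
      simp [laguerreL, Finset.sum_range_succ, poch_zero, poch_succ]
      ring) (fun i _ => by
      simp only [laguerreL_eq_newtonSum]
      rw [newtonSum_laguerre_recurrence]
      push_cast
      ring)
  rw [Measure.restrict_univ] at h hnorm
  rw [h, mul_assoc]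
  congr 1
  have h1 : ∏ j ∈ Finset.range N, classicalH1 1 (-(C 2 * Polynomial.X))
      (momentFunctional volume fun x => Real.exp (-2 * gaussV x)) j =
      ∏ j ∈ Finset.range N, r (2 * j) := Finset.prod_congr rfl fun j hj => by
    rw [classicalH1, hnorm _ (by have := Finset.mem_range.1 hj; omega), hsk, div_neg, neg_neg, div_one]
  have h4 : ∏ j ∈ Finset.range N, (gaussH4 (2 * j + 1) : ℂ) = ∏ j ∈ Finset.range N, r (2 * j + 2) :=
    Finset.prod_congr rfl fun j _ => by
      rw [gaussH4, show (((2 * j + 1 : ℕ) : ℝ) + 2) = ((2 * j + 2 : ℕ) : ℝ) + 1 by push_cast; ring,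
        Real.Gamma_nat_eq_factorial]
      simp only [hr]
      push_cast
      rw [one_div, inv_pow]
      ring
  have ht := prod_range_even_shift r N
  rw [h1, h4, gaussAlpha]
  -- The two products of norms differ by `r (2N) / r 0`.
  have hp : (Finset.range N).prod (fun j => r (2 * j + 2)) =
      (∏ j ∈ Finset.range N, r (2 * j)) * (((2 * N).factorial : ℂ) / 4 ^ N) := by
    refine mul_right_cancel₀ (hr0 0) (ht.trans ?_)
    simp only [hr, pow_mul]
    norm_num
    ring
  rw [hp]
  have : ((2 * N).factorial : ℂ) ≠ 0 := mod_cast (2 * N).factorial_ne_zero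
  field_simp

theorem laguerre_grandPartition (N : ℕ) (X : ℂ) {a : ℝ} (ha : -1 < a) :
    PartitionConverges (volume.restrict (Set.Ioi 0)) (potentialOne (laguerreV a) laguerreF)
        (potentialTwo (laguerreV a) laguerreF) N ∧
      grandPartition (volume.restrict (Set.Ioi 0)) (potentialOne (laguerreV a) laguerreF)
        (potentialTwo (laguerreV a) laguerreF) N X =
        2 ^ N * laguerreAlpha a X N * ∏ j ∈ Finset.range N, (laguerreH4 a (2 * j + 1) : ℂ) := by
  have hw := laguerre_isClassicalWeight ha N
  set F : ℂ[X] := Polynomial.X with hF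
  set τ : ℂ[X] := C ((a : ℂ) + 1) - Polynomial.X with hτ
  -- The squared norms of the monic Laguerre polynomials.
  set r : ℕ → ℂ := fun j => (j.factorial : ℂ) * (Real.Gamma (a + j + 1) : ℂ) with hr
  have hG : ∀ j : ℕ, (Real.Gamma (a + j + 1) : ℂ) ≠ 0 := fun j => Complex.ofReal_ne_zero.2
    (Real.Gamma_pos_of_pos (by linarith [j.cast_nonneg (α := ℝ)])).ne'
  have hr0 : ∀ j, r j ≠ 0 := fun j => mul_ne_zero (mod_cast j.factorial_ne_zero) (hG j)
  have c1 : τ.coeff 1 = -1 := by simp [hτ, coeff_one]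
  have c2 : F.coeff 2 = 0 := by simp [hF, coeff_X]
  have hnorm : ∀ j < 2 * N, orthoNorm F τ (momentFunctional (volume.restrict (Set.Ioi 0))
      fun x => Real.exp (-2 * laguerreV a x)) j = r j := by
    intro j hj
    rw [hw.orthoNorm_eq j hj, laguerre_mass ha, rodriguesLead, c1, c2]
    simp only [mul_zero, add_zero, Finset.prod_const, Finset.card_range, hr]
    rw [← mul_assoc, inv_mul_cancel₀ (pow_ne_zero _ (by norm_num)), one_mul]
  have hsk : ∀ j, skewLead F τ j = -1 / 2 := fun j => by
    rw [skewLead, c1, c2]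
    norm_num
  refine ⟨hw.partitionConverges, ?_⟩
  -- Now `γ_{2i+1} γ_{2i} = (i+1)(i+1/2)(i+1+a/2)(i+(a+1)/2)`, which reveals the dual Hahn
  -- parameters `(a+1)/2, 1/2, 0`.
  have h := hw.grandPartition_eq (fun i _ => by rw [c1, c2]; norm_num)
    (fun j hj => by rw [hnorm j hj]; exact hr0 j) X
    (fun j => ((j : ℂ) + 1) * (j + 1 + a) / 4)
    (fun n => dualHahn n (-X ^ 2) ((a + 1) / 2) (1 / 2) 0) (fun j hj => by
      rw [classicalGamma, hnorm j (by omega), hnorm (j + 1) hj, hsk, mul_div_assoc', div_eq_iff (hr0 j)]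
      simp only [hr, Nat.factorial_succ]
      rw [show a + ((j + 1 : ℕ) : ℝ) + 1 = a + j + 1 + 1 by push_cast; ring,
        Real.Gamma_add_one (by linarith [j.cast_nonneg (α := ℝ)])]
      push_cast
      ring) (by simp [dualHahn, poch_zero]) (fun _ => by
      simp [dualHahn, Finset.sum_range_succ, poch_zero, poch_succ]
      ring) (fun i _ => by
      simp only [dualHahn_eq_newtonSum]
      rw [newtonSum_dualHahn_recurrence]
      push_cast
      ring)
  rw [h, mul_assoc]
  congr 1
  have h1 : ∏ j ∈ Finset.range N, classicalH1 F τ (momentFunctional (volume.restrict (Set.Ioi 0))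
      fun x => Real.exp (-2 * laguerreV a x)) j = 2 ^ N * ∏ j ∈ Finset.range N, r (2 * j) := by
    have : ∀ j ∈ Finset.range N, classicalH1 F τ (momentFunctional (volume.restrict (Set.Ioi 0))
        fun x => Real.exp (-2 * laguerreV a x)) j = 2 * r (2 * j) := fun j hj => by
      rw [classicalH1, hnorm _ (by have := Finset.mem_range.1 hj; omega), hsk]
      ring
    rw [Finset.prod_congr rfl this, Finset.prod_mul_distrib, Finset.prod_const, Finset.card_range]
  have h4 : ∏ j ∈ Finset.range N, (laguerreH4 a (2 * j + 1) : ℂ) =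
      (1 / 2) ^ N * ∏ j ∈ Finset.range N, r (2 * j + 2) := by
    have : ∀ j ∈ Finset.range N, (laguerreH4 a (2 * j + 1) : ℂ) = 1 / 2 * r (2 * j + 2) :=
      fun j _ => by
        rw [laguerreH4, show (((2 * j + 1 : ℕ) : ℝ) + 2) = ((2 * j + 2 : ℕ) : ℝ) + 1 by push_cast; ring,
          Real.Gamma_nat_eq_factorial,
          show ((2 * j + 1 : ℕ) : ℝ) + a + 2 = a + (2 * j + 2 : ℕ) + 1 by push_cast; ring]
        simp only [hr]
        push_cast
        ring
    rw [Finset.prod_congr rfl this, Finset.prod_mul_distrib, Finset.prod_const, Finset.card_range]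
  have ht := prod_range_even_shift r N
  have hg := Gamma_add_natCast (x := a + 1) (by linarith) (2 * N)
  rw [poch_two_mul, show a + 1 + ((2 * N : ℕ) : ℝ) = a + (2 * N : ℕ) + 1 by ring] at hg
  push_cast at hg
  rw [show (a : ℂ) + 1 + 1 = a + 2 by ring] at hg
  have hp1 : poch (((a : ℂ) + 1) / 2) N ≠ 0 := by
    intro h0
    have := hG (2 * N)
    push_cast at this
    rw [hg, h0] at this
    simp at this
  have hp2 : poch (((a : ℂ) + 2) / 2) N ≠ 0 := by
    intro h0
    have := hG (2 * N)
    push_cast at this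
    rw [hg, h0] at this
    simp at this
  have hp : (Finset.range N).prod (fun j => r (2 * j + 2)) =
      (∏ j ∈ Finset.range N, r (2 * j)) * (((2 * N).factorial : ℂ) *
        (4 ^ N * (poch ((a + 1) / 2) N * poch ((a + 2) / 2) N))) := by
    refine mul_right_cancel₀ (hr0 0) (ht.trans ?_)
    simp only [hr]
    push_cast
    rw [hg]
    simp
    ring
  rw [h1, h4, hp, laguerreAlpha]
  have : ((2 * N).factorial : ℂ) ≠ 0 := mod_cast (2 * N).factorial_ne_zero
  have h24 : (1 / 2 : ℂ) ^ N * 4 ^ N = 2 ^ N := by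
    rw [← mul_pow]
    norm_num
  field_simp
  rw [← h24]
  field_simp

end GaussLaguerre

/-! ### Weights with quadratic `f`: reduction to Wilson polynomials -/

section WilsonType

open Polynomial Filter Topology

lemma poch_eq_prod_range (u : ℂ) (m : ℕ) : poch u m = ∏ i ∈ Finset.range m, (u + i) := by
  induction m with
  | zero => simp [poch_zero]
  | succ m ih => rw [poch_succ, Finset.prod_range_succ, ih]

/-- It compares the leading coefficients of consecutive Rodrigues polynomials. The form without
division is needed because `v + j - 1` may vanish at `j = 0`. -/
lemma poch_diag_succ (v : ℂ) (j : ℕ) :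
    poch (v - 1 + (j + 1 : ℕ)) (j + 1) * (v + j - 1) =
      poch (v - 1 + j) j * ((v + 2 * j - 1) * (v + 2 * j)) := by
  have h := poch_succ_left (v - 1 + j) j
  rw [poch_succ] at h ⊢
  push_cast
  rw [show v - 1 + ((j : ℂ) + 1) = v - 1 + j + 1 by ring]
  linear_combination -(v + 2 * j) * h

variable {I : Set ℝ} {l : Filter ℝ} {V f g : ℝ → ℝ} {F τ : ℂ[X]} {N : ℕ}

/-- The partition function of a classical weight with `f` of degree two, `f = 1 ∓ x²`, in terms of
Wilson polynomials. -/
theorem IsClassicalWeight.grandPartition_eq_wilson (hw : IsClassicalWeight I l V f g F τ N)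
    {e A B : ℂ} (he : e ^ 2 = 1) (hc2 : F.coeff 2 = e) (hc1 : τ.coeff 1 = e * (2 * A + 2 * B))
    (M : ℕ → ℝ) (hM : ∀ j < 2 * N, ∫ x in I, f x ^ j * Real.exp (-2 * V x) = M j)
    (hM0 : ∀ j < 2 * N, M j ≠ 0)
    (hrec : ∀ j, j + 1 < 2 * N →
      (M (j + 1) : ℂ) * ((2 * A + 2 * B + 2 * j) * (2 * A + 2 * B + 2 * j + 1)) =
        4 * ((j + 2 * A) * (j + 2 * B)) * M j)
    (hne : ∀ i : ℕ, i + 3 ≤ 4 * N → 2 * A + 2 * B + i ≠ 0) (X : ℂ) :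
    grandPartition (volume.restrict I) (potentialOne V f) (potentialTwo V f) N X =
      2 ^ N * ((∏ j ∈ Finset.range N, -e * (((2 * j).factorial * M (2 * j) /
        poch (2 * A + 2 * B - 1 + (2 * j : ℕ)) (2 * j)) / (A + B + 2 * j))) *
        ((-4 * e) ^ N * (wilson N (e * X ^ 2 / 4) A B (1 / 2) 0 / poch (N + (A + B - 1 / 2)) N))) := by
  obtain ⟨v, hv⟩ : ∃ v, v = 2 * A + 2 * B := ⟨_, rfl⟩
  have hAB : A + B = v / 2 := by rw [hv]; ring
  rw [← hv] at hc1 hne hrec ⊢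
  have he0 : e ≠ 0 := fun h0 => by simp [h0] at he
  have hq0 : ∀ j < 2 * N, poch (v - 1 + j) j ≠ 0 := fun j hj => poch_ne_zero fun i hi h0 => by
    refine hne (j - 1 + i) (by omega) ?_
    rw [Nat.cast_add, Nat.cast_sub (by omega)]
    push_cast
    linear_combination h0
  have hnorm : ∀ j < 2 * N, orthoNorm F τ
      (momentFunctional (volume.restrict I) fun x => Real.exp (-2 * V x)) j =
      (-e) ^ j * (j.factorial * M j / poch (v - 1 + j) j) := by
    intro j hj
    have hlead : rodriguesLead F τ j = e ^ j * poch (v - 1 + j) j := by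
      rw [rodriguesLead, hc1, hc2, poch_eq_prod_range, ← Finset.card_range j, ← Finset.prod_const, Finset.card_range, ← Finset.prod_mul_distrib]
      exact Finset.prod_congr rfl fun s _ => by ring
    have hej : e ^ j * e ^ j = 1 := by rw [← mul_pow, ← sq, he, one_pow]
    rw [hw.orthoNorm_eq j hj, hM j hj, hlead, neg_pow e, mul_inv, 
      inv_eq_of_mul_eq_one_left hej]
    ring
  have hr0 : ∀ j < 2 * N, orthoNorm F τ
      (momentFunctional (volume.restrict I) fun x => Real.exp (-2 * V x)) j ≠ 0 := fun j hj => by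
    rw [hnorm j hj]
    exact mul_ne_zero (pow_ne_zero _ (neg_ne_zero.2 he0)) (div_ne_zero (mul_ne_zero
      (mod_cast j.factorial_ne_zero) (Complex.ofReal_ne_zero.2 (hM0 j hj))) (hq0 j hj))
  have hsk : ∀ j : ℕ, skewLead F τ j = e * (v + 2 * j) / 2 := fun j => by
    rw [skewLead, hc1, hc2]
    ring
  have hγ : ∀ j, j + 1 < 2 * N → classicalGamma F τ
      (momentFunctional (volume.restrict I) fun x => Real.exp (-2 * V x)) j =
      -4 * e * wilsonGamma A B j := by
    intro j hj
    have n0 := hne (2 * j) (by omega)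
    have n1 := hne (2 * j + 1) (by omega)
    push_cast at n0 n1
    rw [← add_assoc] at n1
    have m1 : (M (j + 1) : ℂ) = 4 * ((j + 2 * A) * (j + 2 * B)) * M j /
        ((v + 2 * j) * (v + 2 * j + 1)) := by
      rw [eq_div_iff (mul_ne_zero n0 n1), hrec j hj]
    have hq := poch_diag_succ v j
    rw [classicalGamma, mul_div_assoc', div_eq_iff (hr0 j (by omega)), hnorm j (by omega),
      hnorm (j + 1) hj, hsk, m1, wilsonGamma, Nat.factorial_succ, hAB]
    have hqj := hq0 j (by omega)
    have hqj1 := hq0 (j + 1) hj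
    -- At `j = 0` the quotient would involve `v - 1`, which is not assumed nonzero; the norms are
    -- inserted directly.
    rcases Nat.eq_zero_or_pos j with rfl | hj0
    · rw [if_pos rfl]
      simp only [poch_zero, poch_succ, zero_add, Nat.cast_zero, mul_zero, add_zero, pow_zero,
        Nat.factorial_zero, Nat.cast_one, pow_one, one_mul, sub_add_cancel] at n0 n1 ⊢
      have e1 : v / 2 + 1 / 2 = (v + 1) / 2 := by ring
      rw [e1]
      field_simp
      linear_combination -(A * B * M 0) * he
    · have n2 := hne (j - 1) (by omega)
      have n3 := hne (2 * j - 1) (by omega)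
      rw [Nat.cast_sub (by omega)] at n2 n3
      push_cast at n2 n3
      rw [← add_sub_assoc] at n2 n3
      have hq' : poch (v - 1 + (j + 1 : ℕ)) (j + 1) =
          poch (v - 1 + j) j * ((v + 2 * j - 1) * (v + 2 * j)) / (v + j - 1) :=
        (eq_div_iff n2).2 hq
      rw [hq', if_neg hj0.ne', show (j : ℂ) + (v / 2 - 1 / 2) = (v + 2 * j - 1) / 2 by ring,
        show (j : ℂ) + 1 + (v / 2 - 1 / 2) = (v + 2 * j + 1) / 2 by ring,
        show (j : ℂ) + 2 * A + 2 * B - 1 = v + j - 1 by rw [hv]; ring, pow_succ (-e) j]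
      generalize poch (v - 1 + j) j = Q at *
      generalize v + 2 * (j : ℂ) - 1 = d1 at *
      generalize v + 2 * (j : ℂ) + 1 = d2 at *
      generalize v + 2 * (j : ℂ) = d3 at *
      generalize v + (j : ℂ) - 1 = d4 at *
      generalize (-e) ^ j = E at *
      push_cast
      field_simp
      linear_combination -(16 * E * j.factorial * (j + 2 * A) * (j + 2 * B) * M j) * he
  have hN0 : 0 < N → v + 1 ≠ 0 := fun hN => by simpa using hne 1 (by omega)
  have h := hw.grandPartition_eq (fun i hi => by
      rw [hc1, hc2, mul_comm (i : ℂ), ← mul_add]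
      exact mul_ne_zero he0 (hne i (by omega))) hr0 X _
    -- Since `e² = 1`, `X² = 4e · (e X² / 4)`, and the factor `(4e) ^ n` makes the solution monic in
    -- `X²`.
    (fun n => (4 * e) ^ n * wilsonMonic A B (e * X ^ 2 / 4) n) hγ
    (by simp [wilsonMonic_zero]) (fun hN => by
      have : A + B + 1 / 2 ≠ 0 := by
        rw [hAB, show v / 2 + 1 / 2 = (v + 1) / 2 by ring]
        exact div_ne_zero (hN0 hN) two_ne_zero
      rw [wilsonMonic_one _ _ _ this]
      linear_combination X ^ 2 * he) (fun i hi => by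
      rw [wilsonMonic_recurrence _ _ _ _ fun k hk1 hk2 h0 => hne (2 * k - 1) (by omega) (by
        rw [Nat.cast_sub (by omega)]
        push_cast
        rw [hAB] at h0
        linear_combination 2 * h0)]
      linear_combination (4 * e) ^ (i + 1) * wilsonMonic A B (e * X ^ 2 / 4) (i + 1) * X ^ 2 * he)
  rw [h]
  have hW := wilson_eq_wilsonMonic N (e * X ^ 2 / 4) A B (poch_ne_zero fun i hi h0 => by
    refine hne (2 * (N + i) - 1) (by omega) ?_
    rw [Nat.cast_sub (by omega)]
    push_cast
    rw [hAB] at h0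
    linear_combination 2 * h0)
  rw [hW]
  congr 2
  · refine Finset.prod_congr rfl fun j hj => ?_
    have hj' := Finset.mem_range.1 hj
    have n0 := hne (2 * (2 * j)) (by omega)
    push_cast at n0
    have he2 : (-e) ^ (2 * j) = 1 := by rw [pow_mul, neg_sq, he, one_pow]
    rw [classicalH1, hnorm _ (by omega), hsk, he2, one_mul, hAB,
      show v / 2 + 2 * (j : ℂ) = (v + 2 * (2 * j)) / 2 by ring]
    have hq := hq0 (2 * j) (by omega)
    push_cast at hq ⊢
    generalize poch (v - 1 + 2 * j) (2 * j) = Q at *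
    generalize v + 2 * (2 * (j : ℂ)) = d at *
    field_simp
    linear_combination ((2 * j).factorial * M (2 * j) : ℂ) * he
  · rw [← mul_assoc, ← mul_pow]
    congr 2
    ring

end WilsonType

/-! ### Partition function of the generalised Cauchy weight -/

section CauchyPartition

open Polynomial Filter Topology

theorem cauchy_grandPartition (N : ℕ) (X : ℂ) {p : ℝ} (q : ℝ) (hp : 2 * (N : ℝ) - 1 / 2 < p) :
    PartitionConverges volume (potentialOne (cauchyV p q) cauchyF)
        (potentialTwo (cauchyV p q) cauchyF) N ∧
      grandPartition volume (potentialOne (cauchyV p q) cauchyF)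
        (potentialTwo (cauchyV p q) cauchyF) N X =
        2 ^ N * (∏ j ∈ Finset.range N, (cauchyH1 p q j : ℂ)) *
          ((-4) ^ N * wilson N (X ^ 2 / 4) ((-p - q * Complex.I + 1) / 2)
            ((-p + q * Complex.I + 1) / 2) (1 / 2) 0 / poch (N + 1 / 2 - p) N) := by
  have hw := cauchy_isClassicalWeight q hp
  refine ⟨by simpa using hw.partitionConverges, ?_⟩
  have hpj : ∀ j < 2 * N, 1 / 2 < p - j := fun j hj => by
    have : (j : ℝ) + 1 ≤ 2 * N := mod_cast hj
    linarith
  have h := hw.grandPartition_eq_wilson (e := 1) (A := (-p - q * Complex.I + 1) / 2)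
    (B := (-p + q * Complex.I + 1) / 2) (one_pow 2) (by simp [coeff_one, coeff_X_pow])
    (by simp [coeff_C]; ring) (fun j => cauchyIntegral (p - j) q) (fun j _ => cauchy_mass_eq p q j)
    (fun j hj => (cauchyIntegral_pos q (hpj j hj)).ne') (fun j hj => by
      -- The mass recurrence applies at `p - j - 1`, because `(j + 2A)(j + 2B) = (p-j-1)² + q²`.
      have h1 := cauchyIntegral_add_one q (hpj (j + 1) hj)
      rw [show p - ((j + 1 : ℕ) : ℝ) + 1 = p - j by push_cast; ring] at h1
      have h2 := congrArg (fun x : ℝ => (x : ℂ)) h1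
      push_cast at h2 ⊢
      linear_combination -2 * h2 + 4 * q ^ 2 * cauchyIntegral (p - j) q * Complex.I_sq) (fun i hi h0 => by
      have h1 : 2 - 2 * p + i = 0 := by
        have : ((2 - 2 * p + i : ℝ) : ℂ) = 0 := by
          push_cast
          linear_combination h0
        exact_mod_cast this
      have h2 : (i : ℝ) + 3 ≤ 4 * N := mod_cast hi
      linarith) X
  rw [Measure.restrict_univ] at h
  rw [h, mul_assoc (2 ^ N), mul_one (-4), one_mul (X ^ 2),
    show (N : ℂ) + ((-p - q * Complex.I + 1) / 2 + (-p + q * Complex.I + 1) / 2 - 1 / 2) =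
      N + 1 / 2 - p by ring, ← mul_div_assoc ((-4) ^ N)]
  congr 2
  refine Finset.prod_congr rfl fun j hj => ?_
  have hj' := Finset.mem_range.1 hj
  have hj1 : (j : ℝ) + 1 ≤ N := mod_cast hj'
  have hd : 0 < 2 * p - 4 * j - 2 := by linarith
  have hI := cauchyIntegral_eq q (hpj (2 * j) (by omega))
  have hg := Gamma_add_natCast (x := 2 * p - 4 * j) (by linarith) (2 * j)
  rw [show 2 * p - 4 * (j : ℝ) + (2 * j : ℕ) = 2 * p - 2 * j by push_cast; ring] at hg
  -- Reversing an even number of factors costs no sign and leads to the positive base `2p - 4j`,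
  -- where the symbol is a quotient of Gamma values.
  have hq : poch (2 * ((-p - q * Complex.I + 1) / 2) + 2 * ((-p + q * Complex.I + 1) / 2) - 1 +
      (2 * j : ℕ)) (2 * j) = poch ((2 * p - 4 * j : ℝ) : ℂ) (2 * j) := by
    rw [poch_reflect, Even.neg_one_pow (even_two_mul j), one_mul]
    congr 1
    push_cast
    ring
  have h1 : Real.Gamma (2 * (p - (2 * j : ℕ)) - 1) = (2 * p - 4 * j - 2) *
      Real.Gamma (2 * p - 4 * j - 2) := by
    rw [← Real.Gamma_add_one hd.ne']
    congr 1
    push_cast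
    ring
  have h2 : (2 : ℝ) ^ (4 * j - 2 * p + 3) = 2 * 2 ^ (2 - 2 * (p - (2 * j : ℕ))) := by
    rw [show (4 * j - 2 * p + 3 : ℝ) = 1 + (2 - 2 * (p - (2 * j : ℕ))) by push_cast; ring,
      Real.rpow_add two_pos, Real.rpow_one]
  have h3 : Real.Gamma (2 * j + 1) = (2 * j).factorial := by
    rw [← Real.Gamma_nat_eq_factorial]
    push_cast
    rfl
  have g1 : (Real.Gamma (2 * p - 4 * j) : ℂ) ≠ 0 :=
    Complex.ofReal_ne_zero.2 (Real.Gamma_pos_of_pos (by linarith)).ne'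
  have g2 : (Real.Gamma (2 * p - 2 * j) : ℂ) ≠ 0 :=
    Complex.ofReal_ne_zero.2 (Real.Gamma_pos_of_pos (by linarith)).ne'
  have hP : poch ((2 * p - 4 * j : ℝ) : ℂ) (2 * j) ≠ 0 := left_ne_zero_of_mul (hg ▸ g2)
  have hD : ((2 * p - 4 * j - 2 : ℝ) : ℂ) ≠ 0 := Complex.ofReal_ne_zero.2 hd.ne'
  have hs : (-p - q * Complex.I + 1) / 2 + (-p + q * Complex.I + 1) / 2 + 2 * (j : ℂ) =
      -(((2 * p - 4 * j - 2 : ℝ) : ℂ) / 2) := by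
    push_cast
    ring
  have hG : (‖Complex.Gamma (p - 2 * j + q * Complex.I)‖ : ℂ) ≠ 0 := by
    refine Complex.ofReal_ne_zero.2 (norm_ne_zero_iff.2 (Complex.Gamma_ne_zero_of_re_pos ?_))
    simp
    linarith
  rw [hq, hI, h1, cauchyH1, h2, h3, hs]
  rw [show ((p - (2 * j : ℕ) : ℝ) : ℂ) = p - 2 * j by push_cast; ring]
  simp only [Complex.ofReal_mul, Complex.ofReal_div, Complex.ofReal_pow, Complex.ofReal_natCast, hg]
  field_simp
  simp

end CauchyPartition

/-! ### Partition function of the Jacobi weight -/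

section JacobiPartition

open Polynomial Filter Topology

/-- Together the two products run through `v + 2i` for `i < 2N`. -/
lemma prod_four_mul_add (v : ℂ) (N : ℕ) :
    (∏ j ∈ Finset.range N, (v + 4 * j)) * ∏ j ∈ Finset.range N, (v + 4 * j + 2) =
      4 ^ N * (poch (v / 2) N * poch (v / 2 + N) N) := by
  rw [← poch_add, ← two_mul, ← Finset.prod_mul_distrib]
  induction N with
  | zero => simp [poch_zero]
  | succ N ih =>
    rw [Finset.prod_range_succ, ih, show 2 * (N + 1) = 2 * N + 1 + 1 by ring, poch_succ, poch_succ]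
    push_cast
    ring

/-- The total mass of the Jacobi weight with parameters `a + j`, `b + j`. -/
def jacobiMass (a b : ℝ) (j : ℕ) : ℝ :=
  2 ^ (a + b + 2 * j + 1) * (Real.Gamma (a + j + 1) * Real.Gamma (b + j + 1) /
        Real.Gamma (a + b + 2 * j + 2))

variable {a b : ℝ}

lemma jacobiMass_pos (ha : -1 < a) (hb : -1 < b) (j : ℕ) : 0 < jacobiMass a b j := by
  have hj := j.cast_nonneg (α := ℝ)
  have h1 := Real.Gamma_pos_of_pos (show 0 < a + j + 1 by linarith)
  have h2 := Real.Gamma_pos_of_pos (show 0 < b + j + 1 by linarith)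
  have h3 := Real.Gamma_pos_of_pos (show 0 < a + b + 2 * j + 2 by linarith)
  unfold jacobiMass
  positivity

lemma jacobiMass_succ (ha : -1 < a) (hb : -1 < b) (j : ℕ) :
    jacobiMass a b (j + 1) * ((a + b + 2 + 2 * j) * (a + b + 2 + 2 * j + 1)) =
      4 * ((a + j + 1) * (b + j + 1)) * jacobiMass a b j := by
  have hj := j.cast_nonneg (α := ℝ)
  have h3 := Real.Gamma_pos_of_pos (show 0 < a + b + 2 * j + 2 by linarith)
  have p1 : 0 < a + b + 2 * j + 2 := by linarith
  have p2 : 0 < a + b + 2 * j + 2 + 1 := by linarith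
  unfold jacobiMass
  push_cast
  rw [show a + ((j : ℝ) + 1) + 1 = a + j + 1 + 1 by ring,
    show b + ((j : ℝ) + 1) + 1 = b + j + 1 + 1 by ring,
    show a + b + 2 * ((j : ℝ) + 1) + 2 = a + b + 2 * j + 2 + 1 + 1 by ring,
    show a + b + 2 * ((j : ℝ) + 1) + 1 = a + b + 2 * j + 1 + 2 by ring,
    Real.Gamma_add_one (show a + j + 1 ≠ 0 by linarith),
    Real.Gamma_add_one (show b + j + 1 ≠ 0 by linarith),
    Real.Gamma_add_one p2.ne', Real.Gamma_add_one p1.ne', Real.rpow_add two_pos,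
    show a + b + 2 + 2 * (j : ℝ) = a + b + 2 * j + 2 by ring]
  field_simp
  norm_num
  ring

lemma jacobiMass_mul_poch (ha : -1 < a) (hb : -1 < b) (j : ℕ) :
    (jacobiMass a b j : ℂ) * poch (a + b + 2) (2 * j) =
      jacobiMass a b 0 * (4 ^ j * (poch (a + 1) j * poch (b + 1) j)) := by
  induction j with
  | zero => simp [poch_zero]
  | succ j ih =>
    have h := congrArg (fun x : ℝ => (x : ℂ)) (jacobiMass_succ ha hb j)
    push_cast at h
    rw [show 2 * (j + 1) = 2 * j + 1 + 1 by ring, poch_succ, poch_succ, poch_succ, poch_succ]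
    push_cast
    linear_combination poch (a + b + 2) (2 * j) * h + 4 * ((a + j + 1) * (b + j + 1)) * ih

/-- The norms of the Jacobi polynomials. -/
def jacobiNorm (a b : ℝ) (j : ℕ) : ℂ :=
  j.factorial * jacobiMass a b j / poch ((a : ℂ) + b + 2 - 1 + j) j

/-- The quotient `Γ(a+b+2j+3) / Γ(a+b+j+2)` is the Pochhammer symbol in the leading coefficient of
the Rodrigues polynomial of degree `j + 1`. -/
lemma jacobiH4_eq (ha : -1 < a) (hb : -1 < b) (j : ℕ) :
    (jacobiH4 a b j : ℂ) = (a + b + 2 + 2 * j) / 2 * jacobiNorm a b (j + 1) := by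
  have hj := j.cast_nonneg (α := ℝ)
  have p1 : 0 < a + b + 2 * j + 2 := by linarith
  have p2 : 0 < a + b + 2 * j + 2 + 1 := by linarith
  have hg := Gamma_add_natCast (x := a + b + j + 2) (by linarith) (j + 1)
  rw [show a + b + j + 2 + ((j + 1 : ℕ) : ℝ) = a + b + 2 * j + 2 + 1 by push_cast; ring,
    Real.Gamma_add_one p1.ne'] at hg
  have g1 : (Real.Gamma (a + b + 2 * j + 2) : ℂ) ≠ 0 :=
    Complex.ofReal_ne_zero.2 (Real.Gamma_pos_of_pos p1).ne'
  have g2 : (Real.Gamma (a + b + 2 * j + 4) : ℂ) ≠ 0 :=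
    Complex.ofReal_ne_zero.2 (Real.Gamma_pos_of_pos (by linarith)).ne'
  have g0 : ((a + b + 2 * j + 2 : ℝ) : ℂ) ≠ 0 := Complex.ofReal_ne_zero.2 p1.ne'
  have hP : poch ((a + b + j + 2 : ℝ) : ℂ) (j + 1) ≠ 0 := by
    intro h0
    rw [h0, zero_mul, Complex.ofReal_mul] at hg
    exact mul_ne_zero g0 g1 hg
  have hfac : Real.Gamma (j + 2) = (j + 1).factorial := by
    rw [← Real.Gamma_nat_eq_factorial]
    congr 1
    push_cast
    ring
  have hpow : (2 : ℝ) ^ (a + b + 2 * ((j + 1 : ℕ) : ℝ) + 1) = 2 * 2 ^ (a + b + 2 * j + 2) := by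
    rw [show a + b + 2 * ((j + 1 : ℕ) : ℝ) + 1 = 1 + (a + b + 2 * j + 2) by push_cast; ring,
      Real.rpow_add two_pos, Real.rpow_one]
  rw [jacobiNorm, jacobiMass, hpow, jacobiH4, hfac,
    show a + ((j + 1 : ℕ) : ℝ) + 1 = j + a + 2 by push_cast; ring,
    show b + ((j + 1 : ℕ) : ℝ) + 1 = j + b + 2 by push_cast; ring,
    show a + b + 2 * ((j + 1 : ℕ) : ℝ) + 2 = a + b + 2 * j + 4 by push_cast; ring,
    show (j : ℝ) + a + b + 2 = a + b + j + 2 by ring,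
    show 2 * (j : ℝ) + a + b + 2 = a + b + 2 * j + 2 by ring,
    show 2 * (j : ℝ) + a + b + 4 = a + b + 2 * j + 4 by ring,
    show (a : ℂ) + b + 2 - 1 + (j + 1 : ℕ) = ((a + b + j + 2 : ℝ) : ℂ) by push_cast; ring,
    show (a : ℂ) + b + 2 + 2 * j = ((a + b + 2 * j + 2 : ℝ) : ℂ) by push_cast; ring]
  simp only [Complex.ofReal_mul, Complex.ofReal_div, Complex.ofReal_natCast, Complex.ofReal_ofNat] at hg ⊢
  field_simp
  linear_combination -((j + 1).factorial * Real.Gamma (j + a + 2) * Real.Gamma (j + b + 2) : ℂ) * hg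

theorem jacobi_grandPartition (N : ℕ) (X : ℂ) (ha : -1 < a) (hb : -1 < b) :
    PartitionConverges (volume.restrict (Set.Ioo (-1) 1)) (potentialOne (jacobiV a b) jacobiF)
        (potentialTwo (jacobiV a b) jacobiF) N ∧
      grandPartition (volume.restrict (Set.Ioo (-1) 1)) (potentialOne (jacobiV a b) jacobiF)
        (potentialTwo (jacobiV a b) jacobiF) N X =
        2 ^ N * jacobiAlpha a b X N * ∏ j ∈ Finset.range N, (jacobiH4 a b (2 * j + 1) : ℂ) := by
  have hw := jacobi_isClassicalWeight ha hb N
  refine ⟨hw.partitionConverges, ?_⟩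
  have hv : ∀ i : ℕ, (a : ℂ) + b + 2 + i ≠ 0 := fun i h0 => by
    have : a + b + 2 + i = 0 := by exact_mod_cast h0
    linarith [i.cast_nonneg (α := ℝ)]
  have hAB : 2 * (((a : ℂ) + 1) / 2) + 2 * (((b : ℂ) + 1) / 2) = a + b + 2 := by ring
  have h := hw.grandPartition_eq_wilson (e := -1) (A := (a + 1) / 2) (B := (b + 1) / 2) (by norm_num)
    (by simp [coeff_one]) (by simp [coeff_C]; ring) (jacobiMass a b) (fun j _ => jacobi_mass ha hb j)
    (fun j _ => (jacobiMass_pos ha hb j).ne') (fun j _ => by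
      have h1 := congrArg (fun x : ℝ => (x : ℂ)) (jacobiMass_succ ha hb j)
      push_cast at h1
      linear_combination h1) (fun i _ => by rw [hAB]; exact hv i) X
  rw [h, mul_assoc (2 ^ N), hAB]
  congr 1
  have hr0 : jacobiNorm a b 0 = jacobiMass a b 0 := by simp [jacobiNorm, poch_zero]
  have hM0 : (jacobiMass a b 0 : ℂ) ≠ 0 := Complex.ofReal_ne_zero.2 (jacobiMass_pos ha hb 0).ne'
  have ht := prod_range_even_shift (jacobiNorm a b) N
  have hS := prod_four_mul_add ((a : ℂ) + b + 2) N
  have hMN := jacobiMass_mul_poch ha hb (2 * N)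
  -- The factors `a + b + 2 + 4j` from the `h₁` and `a + b + 4 + 4j` from the `h₄` are merged by
  -- `prod_four_mul_add`.
  have h1 : ∏ j ∈ Finset.range N, -(-1 : ℂ) * (((2 * j).factorial * jacobiMass a b (2 * j) /
      poch ((a : ℂ) + b + 2 - 1 + (2 * j : ℕ)) (2 * j)) / ((a + 1) / 2 + (b + 1) / 2 + 2 * j)) =
      2 ^ N * (∏ j ∈ Finset.range N, jacobiNorm a b (2 * j)) /
        ∏ j ∈ Finset.range N, ((a : ℂ) + b + 2 + 4 * j) := by
    rw [← Finset.card_range N, ← Finset.prod_const, Finset.card_range, ← Finset.prod_mul_distrib,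
      ← Finset.prod_div_distrib]
    refine Finset.prod_congr rfl fun j _ => ?_
    rw [show ((a : ℂ) + 1) / 2 + (b + 1) / 2 + 2 * j = (a + b + 2 + 4 * j) / 2 by ring, jacobiNorm]
    have := hv (4 * j)
    push_cast at this
    field_simp
  have h4 : ∏ j ∈ Finset.range N, (jacobiH4 a b (2 * j + 1) : ℂ) =
      (∏ j ∈ Finset.range N, ((a : ℂ) + b + 2 + 4 * j + 2)) / 2 ^ N *
        ∏ j ∈ Finset.range N, jacobiNorm a b (2 * j + 2) := by
    rw [← Finset.card_range N, ← Finset.prod_const, Finset.card_range, ← Finset.prod_div_distrib,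
      ← Finset.prod_mul_distrib]
    refine Finset.prod_congr rfl fun j _ => ?_
    rw [jacobiH4_eq ha hb]
    push_cast
    ring
  have hS0 : ∏ j ∈ Finset.range N, ((a : ℂ) + b + 2 + 4 * j) ≠ 0 :=
    Finset.prod_ne_zero_iff.2 fun j _ => by simpa using hv (4 * j)
  -- Positivity of the base is asked for only when the symbol is nonempty; for `N = 0` the base in
  -- `n3` may be negative.
  have hpos : ∀ {u : ℂ} {n : ℕ} (x : ℝ), u = x → (0 < n → 0 < x) → poch u n ≠ 0 := by
    intro u n x hu hx
    refine poch_ne_zero fun i hi h0 => ?_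
    have h2 := hx (by omega)
    rw [hu] at h0
    have : x + i = 0 := by exact_mod_cast h0
    linarith [i.cast_nonneg (α := ℝ)]
  have n1 : poch (((a : ℂ) + b + 2) / 2) N ≠ 0 :=
    hpos ((a + b + 2) / 2) (by push_cast; ring) fun _ => by linarith
  have n2 : poch (((a : ℂ) + b + 2) / 2 + N) N ≠ 0 :=
    hpos ((a + b + 2) / 2 + N) (by push_cast; ring) fun _ => by
      linarith [N.cast_nonneg (α := ℝ)]
  have n3 : poch ((N : ℂ) + ((a + 1) / 2 + (b + 1) / 2 - 1 / 2)) N ≠ 0 :=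
    hpos (N + (a + b + 1) / 2) (by push_cast; ring) fun hN => by
      have : (1 : ℝ) ≤ N := mod_cast hN
      linarith
  have n4 : poch (((a : ℂ) + 1) / 2) N ≠ 0 :=
    hpos ((a + 1) / 2) (by push_cast; ring) fun _ => by linarith
  have n5 : poch (((a : ℂ) + 2) / 2) N ≠ 0 :=
    hpos ((a + 2) / 2) (by push_cast; ring) fun _ => by linarith
  have n6 : poch ((b : ℂ) + 1) (2 * N) ≠ 0 :=
    hpos (b + 1) (by push_cast; ring) fun _ => by linarith
  have n7 : poch ((a : ℂ) + b + 2) (2 * (2 * N)) ≠ 0 :=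
    hpos (a + b + 2) (by push_cast; ring) fun _ => by linarith
  have g1 := Gamma_add_natCast (x := b + 1) (by linarith) (2 * N)
  have g2 := Gamma_add_natCast (x := a + b + 2) (by linarith) (2 * (2 * N))
  have g3 : (Real.Gamma (b + 1) : ℂ) ≠ 0 :=
    Complex.ofReal_ne_zero.2 (Real.Gamma_pos_of_pos (by linarith)).ne'
  have g4 : (Real.Gamma (a + b + 2) : ℂ) ≠ 0 :=
    Complex.ofReal_ne_zero.2 (Real.Gamma_pos_of_pos (by linarith)).ne'
  rw [show b + 1 + ((2 * N : ℕ) : ℝ) = 2 * N + b + 1 by push_cast; ring] at g1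
  rw [show a + b + 2 + ((2 * (2 * N) : ℕ) : ℝ) = 4 * N + a + b + 2 by push_cast; ring] at g2
  have hq := poch_two_mul ((a : ℂ) + b + 2 - 1 + (2 * N : ℕ)) N
  rw [show ((a : ℂ) + b + 2 - 1 + (2 * N : ℕ)) / 2 = N + ((a + 1) / 2 + (b + 1) / 2 - 1 / 2) by
      push_cast; ring,
    show ((a : ℂ) + b + 2 - 1 + (2 * N : ℕ) + 1) / 2 = (a + b + 2) / 2 + N by push_cast; ring] at hq
  have ha2 := poch_two_mul ((a : ℂ) + 1) N
  rw [show (a : ℂ) + 1 + 1 = a + 2 by ring] at ha2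
  have hM : (jacobiMass a b (2 * N) : ℂ) = jacobiMass a b 0 * (4 ^ (2 * N) * (4 ^ N *
      (poch ((a + 1) / 2) N * poch ((a + 2) / 2) N) * poch (b + 1) (2 * N))) /
      poch (a + b + 2) (2 * (2 * N)) := by
    rw [eq_div_iff n7, hMN, ha2]
  have hp : ∏ j ∈ Finset.range N, jacobiNorm a b (2 * j + 2) =
      (∏ j ∈ Finset.range N, jacobiNorm a b (2 * j)) * jacobiNorm a b (2 * N) / jacobiMass a b 0 := by
    rw [eq_div_iff hM0, ← hr0, ht]
  have hS2 : ∏ j ∈ Finset.range N, ((a : ℂ) + b + 2 + 4 * j + 2) =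
      4 ^ N * (poch ((a + b + 2) / 2) N * poch ((a + b + 2) / 2 + N) N) /
        ∏ j ∈ Finset.range N, ((a : ℂ) + b + 2 + 4 * j) := by
    rw [eq_div_iff hS0, mul_comm, hS]
  have hfac : ((2 * N).factorial : ℂ) ≠ 0 := mod_cast (2 * N).factorial_ne_zero
  rw [h1, h4, hp, hS2, jacobiNorm, hM, hq, jacobiAlpha,
    show (-1 : ℂ) * X ^ 2 / 4 = -X ^ 2 / 4 by ring, show (-4 : ℂ) * -1 = 4 by norm_num]
  simp only [Complex.ofReal_mul, Complex.ofReal_div, Complex.ofReal_pow, Complex.ofReal_natCast,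
    Complex.ofReal_ofNat, g1, g2]
  simp only [Complex.ofReal_add, Complex.ofReal_one, Complex.ofReal_ofNat]
  have h4N : (4 : ℂ) ^ N = 2 ^ N * 2 ^ N := by rw [← mul_pow]; norm_num
  have h42N : (4 : ℂ) ^ (2 * N) = 4 ^ N * 4 ^ N := by rw [two_mul, pow_add]
  rw [h42N, h4N]
  have n8 : (2 : ℂ) ^ N ≠ 0 := pow_ne_zero _ two_ne_zero
  -- What remains is a rational identity between the named quantities, all of whose denominators are
  -- known to be nonzero.
  clear h hMN hM hS hS2 hp ht h1 h4 hr0 hq ha2 g1 g2 h4N h42N hw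
  generalize (2 : ℂ) ^ N = t at *
  generalize (∏ j ∈ Finset.range N, ((a : ℂ) + b + 2 + 4 * j)) = S at *
  generalize (∏ j ∈ Finset.range N, jacobiNorm a b (2 * j)) = R at *
  generalize poch (((a : ℂ) + b + 2) / 2) N = P1 at *
  generalize poch (((a : ℂ) + b + 2) / 2 + N) N = P2 at *
  generalize poch ((N : ℂ) + ((a + 1) / 2 + (b + 1) / 2 - 1 / 2)) N = P3 at *
  generalize poch (((a : ℂ) + 1) / 2) N = P4 at *
  generalize poch (((a : ℂ) + 2) / 2) N = P5 at *
  generalize poch ((b : ℂ) + 1) (2 * N) = P6 at *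
  generalize poch ((a : ℂ) + b + 2) (2 * (2 * N)) = P7 at *
  field_simp

end JacobiPartition

end MixedCharge

end
theorem mainTheorem4 (N : ℕ) (X : ℂ) :
    -- the general formula
    (∀ (μ : Measure ℝ) [SigmaFinite μ] (V₁ V₂ : ℝ → ℝ)
        (p : ℕ → Polynomial ℂ) (ζ h₁ h₄ α : ℕ → ℂ),
      (∀ k : ℕ, k < 2 * N → Integrable (fun x => x ^ k * Real.exp (-V₁ x)) μ) →
      (∀ k : ℕ, k + 4 ≤ 4 * N → Integrable (fun x => x ^ k * Real.exp (-2 * V₂ x)) μ) →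
      SkewRelations μ V₁ V₂ N p ζ h₁ h₄ →
      AlphaRecurrence X ζ h₁ h₄ N α →
      PartitionConverges μ V₁ V₂ N ∧
      grandPartition μ V₁ V₂ N X = 2 ^ N * α N * ∏ j ∈ Finset.range N, h₄ (2 * j + 1)) ∧
    -- the Gaussian weight: Laguerre polynomials
    (PartitionConverges volume (potentialOne gaussV gaussF) (potentialTwo gaussV gaussF) N ∧
      grandPartition volume (potentialOne gaussV gaussF) (potentialTwo gaussV gaussF) N X =
        2 ^ N * gaussAlpha X N * ∏ j ∈ Finset.range N, (gaussH4 (2 * j + 1) : ℂ)) ∧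
    -- the Laguerre weight: continuous dual Hahn polynomials
    (∀ a : ℝ, -1 < a →
      PartitionConverges (volume.restrict (Set.Ioi 0)) (potentialOne (laguerreV a) laguerreF)
        (potentialTwo (laguerreV a) laguerreF) N ∧
      grandPartition (volume.restrict (Set.Ioi 0)) (potentialOne (laguerreV a) laguerreF)
        (potentialTwo (laguerreV a) laguerreF) N X =
        2 ^ N * laguerreAlpha a X N * ∏ j ∈ Finset.range N, (laguerreH4 a (2 * j + 1) : ℂ)) ∧
    -- the Jacobi weight: Wilson polynomials
    (∀ a b : ℝ, -1 < a → -1 < b →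
      PartitionConverges (volume.restrict (Set.Ioo (-1) 1)) (potentialOne (jacobiV a b) jacobiF)
        (potentialTwo (jacobiV a b) jacobiF) N ∧
      grandPartition (volume.restrict (Set.Ioo (-1) 1)) (potentialOne (jacobiV a b) jacobiF)
        (potentialTwo (jacobiV a b) jacobiF) N X =
        2 ^ N * jacobiAlpha a b X N * ∏ j ∈ Finset.range N, (jacobiH4 a b (2 * j + 1) : ℂ)) ∧
    -- the generalised Cauchy weight: Wilson polynomials
    (∀ p q : ℝ, 2 * (N : ℝ) - 1 / 2 < p →
      PartitionConverges volume (potentialOne (cauchyV p q) cauchyF)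
        (potentialTwo (cauchyV p q) cauchyF) N ∧
      grandPartition volume (potentialOne (cauchyV p q) cauchyF)
        (potentialTwo (cauchyV p q) cauchyF) N X =
        2 ^ N * (∏ j ∈ Finset.range N, (cauchyH1 p q j : ℂ)) *
          ((-4) ^ N * wilson N (X ^ 2 / 4) ((-p - q * Complex.I + 1) / 2)
            ((-p + q * Complex.I + 1) / 2) (1 / 2) 0 / poch (N + 1 / 2 - p) N)) := by
  refine ⟨fun μ _ V₁ V₂ p ζ h₁ h₄ α hV₁ hV₂ hp hα => ⟨partitionConverges_of_integrable hV₁ hV₂,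
    grandPartition_eq_of_alphaRecurrence X hV₁ hV₂ hp hα⟩, gauss_grandPartition N X,
    fun a ha => laguerre_grandPartition N X ha, fun a b ha hb => jacobi_grandPartition N X ha hb,
    fun p q hp => cauchy_grandPartition N X q hp⟩
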